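/- Let $k$ be an algebraically closed field of characteristic $p>2$, let $V$ be a finite-dimensional $k$-vector space, and let $G$ be one of the following simply connected classical algebraic groups over $k$, the characteristic $p$ being very good for $G$: (i) $G=\mathrm{SL}(V)$ with $\dim V\ge 2$ and $p\nmid\dim V$; (ii) $G=\mathrm{Sp}(V,\omega)$ with $V\neq 0$ and $\omega$ a non-degenerate alternating bilinear form on $V$; (iii) $G=\mathrm{Spin}(V,Q)$ with $\dim V\ge 3$ and $Q$ a non-degenerate quadratic form on $V$. Let $\mathfrak g=\mathrm{Lie}(G)$. Call a Lie algebra semisimple if its solvable radical is zero. Then every maximal non-semisimple subalgebra $\mathfrak h$ of $\mathfrak g$ (that is, every maximal element, with respect to inclusion, of the set of non-semisimple Lie subalgebras of $\mathfrak g$) is parabolic: there is a parabolic subgroup $P$ of $G$ (a closed subgroup containing a Borel subgroup, i.e. containing a maximal closed connected solvable subgroup of $G$) such that $\mathfrak h=\mathrm{Lie}(P)$. -/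

import Mathlib

open scoped DualNumber

namespace ClassicalLie

section Linear

universe u v

variable (k : Type u) {A : Type v} [Field k] [Ring A] [Algebra k A]

/-- Formal polynomial expressions in the linear functionals on `A`: every polynomial function
on `A` is the evaluation of such an expression. -/
abbrev PolyFun (A : Type v) [Ring A] [Algebra k A] : Type (max u v) :=
  MvPolynomial (Module.Dual k A) k

variable {k}

/-- The value of a polynomial function at a point of `A`. -/
noncomputable def PolyFun.evalAt (a : A) : PolyFun k A →ₐ[k] k :=
  MvPolynomial.aeval (fun φ : Module.Dual k A => φ a)

/-- The value `f (a + ε b)` of a polynomial function at a point of `A` over the dual numbers. -/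
noncomputable def PolyFun.evalDual (a b : A) : PolyFun k A →ₐ[k] k[ε] :=
  MvPolynomial.aeval (fun φ : Module.Dual k A => TrivSqZeroExt.inl (φ a) + TrivSqZeroExt.inr (φ b))

variable (k) in
/-- The Zariski topology on the group of units of `A`: a basis of open sets is given by the
non-vanishing loci of polynomial functions. -/
abbrev zariski (A : Type v) [Ring A] [Algebra k A] : TopologicalSpace Aˣ :=
  TopologicalSpace.generateFrom
    {U : Set Aˣ | ∃ f : PolyFun k A, U = {x : Aˣ | PolyFun.evalAt (x : A) f ≠ 0}}

/-- The (left-invariant) derivation `f ↦ (a ↦ d/dε f (a + ε a x))` of polynomial functions. -/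
noncomputable def PolyFun.leftInv (x : A) : Derivation k (PolyFun k A) (PolyFun k A) :=
  MvPolynomial.mkDerivation k
    (fun φ : Module.Dual k A => MvPolynomial.X (φ ∘ₗ LinearMap.mulRight k x))

theorem PolyFun.evalDual_mul (a x : A) (f : PolyFun k A) :
    PolyFun.evalDual a (a * x) f =
      TrivSqZeroExt.inl (PolyFun.evalAt a f) +
        TrivSqZeroExt.inr (PolyFun.evalAt a (PolyFun.leftInv x f)) := by
  induction f using MvPolynomial.induction_on with
  | C r =>
    have h : (MvPolynomial.C r : PolyFun k A) = algebraMap k (PolyFun k A) r := rfl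
    rw [h, AlgHom.commutes, AlgHom.commutes, Derivation.map_algebraMap, map_zero]
    simp [TrivSqZeroExt.algebraMap_eq_inl]
  | add p q hp hq =>
    simp only [map_add, hp, hq, TrivSqZeroExt.inl_add, TrivSqZeroExt.inr_add]
    abel
  | mul_X p φ hp =>
    have h1 : PolyFun.evalAt a (MvPolynomial.X φ : PolyFun k A) = φ a := by
      simp [PolyFun.evalAt]
    have h2 : PolyFun.evalDual a (a * x) (MvPolynomial.X φ : PolyFun k A) =
        TrivSqZeroExt.inl (φ a) + TrivSqZeroExt.inr (φ (a * x)) := by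
      simp [PolyFun.evalDual]
    have h3 : PolyFun.evalAt a (PolyFun.leftInv x (MvPolynomial.X φ : PolyFun k A)) =
        φ (a * x) := by
      simp [PolyFun.evalAt, PolyFun.leftInv]
    rw [map_mul, map_mul, Derivation.leibniz, map_add, hp, h2]
    simp only [smul_eq_mul, map_mul, h1, h3]
    ext
    · simp [mul_comm]
    · simp only [TrivSqZeroExt.snd_add, TrivSqZeroExt.snd_mul, TrivSqZeroExt.fst_add,
        TrivSqZeroExt.fst_inl, TrivSqZeroExt.snd_inl, TrivSqZeroExt.fst_inr, TrivSqZeroExt.snd_inr,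
        smul_eq_mul, MulOpposite.smul_eq_mul_unop, MulOpposite.unop_op]
      ring

/-- The polynomial function `f` vanishes on `H`. -/
def Vanishes (H : Subgroup Aˣ) (f : PolyFun k A) : Prop :=
  ∀ x ∈ H, PolyFun.evalAt (x : A) f = 0

theorem evalDual_one_eq_zero_iff {H : Subgroup Aˣ} {f : PolyFun k A} (hf : Vanishes H f) (x : A) :
    PolyFun.evalDual 1 x f = 0 ↔ PolyFun.evalAt 1 (PolyFun.leftInv x f) = 0 := by
  have h := PolyFun.evalDual_mul 1 x f
  rw [one_mul] at h
  have h1 : PolyFun.evalAt (1 : A) f = 0 := hf 1 H.one_mem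
  rw [h, h1]
  simp [TrivSqZeroExt.ext_iff]

/-- Linear combinations of the derivations `leftInv x` after evaluation at a point. -/
theorem evalAt_leftInv_linear (a x y : A) (r : k) (f : PolyFun k A) :
    PolyFun.evalAt a (PolyFun.leftInv (r • x + y) f) =
      r * PolyFun.evalAt a (PolyFun.leftInv x f) + PolyFun.evalAt a (PolyFun.leftInv y f) := by
  induction f using MvPolynomial.induction_on with
  | C s =>
    have h : (MvPolynomial.C s : PolyFun k A) = algebraMap k (PolyFun k A) s := rfl
    simp [h]
  | add p q hp hq => simp only [map_add, hp, hq]; ring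
  | mul_X p φ hp =>
    have h3 : ∀ z : A, PolyFun.evalAt a (PolyFun.leftInv z (MvPolynomial.X φ : PolyFun k A)) =
        φ (a * z) := fun z => by
      simp [PolyFun.evalAt, PolyFun.leftInv]
    simp only [Derivation.leibniz, map_add, smul_eq_mul, map_mul, hp, h3, mul_add,
      mul_smul_comm, map_smul]
    ring

attribute [local instance 100] LieRing.ofAssociativeRing

theorem evalAt_leftInv_lie (a x y : A) (f : PolyFun k A) :
    PolyFun.evalAt a (PolyFun.leftInv ⁅x, y⁆ f) =
      PolyFun.evalAt a (PolyFun.leftInv x (PolyFun.leftInv y f)) -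
        PolyFun.evalAt a (PolyFun.leftInv y (PolyFun.leftInv x f)) := by
  induction f using MvPolynomial.induction_on with
  | C s =>
    have h : (MvPolynomial.C s : PolyFun k A) = algebraMap k (PolyFun k A) s := rfl
    simp [h]
  | add p q hp hq => simp only [map_add, hp, hq]; ring
  | mul_X p φ hp =>
    have h3 : ∀ z : A, PolyFun.evalAt a (PolyFun.leftInv z (MvPolynomial.X φ : PolyFun k A)) =
        φ (a * z) := fun z => by
      simp [PolyFun.evalAt, PolyFun.leftInv]
    have h4 : ∀ z w : A, PolyFun.evalAt a (PolyFun.leftInv z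
        (PolyFun.leftInv w (MvPolynomial.X φ : PolyFun k A))) = φ (a * z * w) := fun z w => by
      simp [PolyFun.evalAt, PolyFun.leftInv]
    simp only [Derivation.leibniz, map_add, smul_eq_mul, map_mul, hp, h3, h4]
    rw [LieRing.of_associative_ring_bracket, mul_sub, map_sub, ← mul_assoc, ← mul_assoc]
    ring

theorem Vanishes.leftInv {H : Subgroup Aˣ} {x : A}
    (hx : ∀ f : PolyFun k A, Vanishes H f → PolyFun.evalDual 1 x f = 0)
    {f : PolyFun k A} (hf : Vanishes H f) : Vanishes H (PolyFun.leftInv x f) := by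
  intro a ha
  let τ : PolyFun k A →ₐ[k] PolyFun k A :=
    MvPolynomial.aeval (fun φ : Module.Dual k A =>
      MvPolynomial.X (φ ∘ₗ LinearMap.mulLeft k (a : A)))
  have hτ : ∀ b : A, (PolyFun.evalAt b).comp τ = PolyFun.evalAt (k := k) ((a : A) * b) := fun b =>
    MvPolynomial.algHom_ext fun φ => by simp [τ, PolyFun.evalAt]
  have hd : (PolyFun.evalDual 1 x).comp τ = PolyFun.evalDual (k := k) (a : A) ((a : A) * x) :=
    MvPolynomial.algHom_ext fun φ => by simp [τ, PolyFun.evalDual]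
  have hv : Vanishes H (τ f) := fun b hb => by
    have h := hf (a * b) (H.mul_mem ha hb)
    rw [Units.val_mul, ← hτ] at h
    exact h
  have h := hx _ hv
  rw [← AlgHom.comp_apply, hd, PolyFun.evalDual_mul] at h
  simpa using congrArg TrivSqZeroExt.snd h

variable (k) in
/-- The Lie algebra (tangent space at `1`) of a closed subgroup `H` of the group of units of `A`: all `x` in `A` such that
`1 + ε x` is a point of `H` over the dual numbers, that is `f (1 + ε x) = 0` for all polynomial
functions `f` that vanish on `H`. The bracket is `⁅x, y⁆ = x * y - y * x`. -/
noncomputable def lieAlg (H : Subgroup Aˣ) : LieSubalgebra k A where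
  carrier := {x : A | ∀ f : PolyFun k A, Vanishes H f → PolyFun.evalDual 1 x f = 0}
  zero_mem' := fun f hf => by
    rw [evalDual_one_eq_zero_iff hf]
    have h := evalAt_leftInv_linear (1 : A) 0 0 (1 : k) f
    simpa using h
  add_mem' := fun {x y} hx hy f hf => by
    have h1 := (evalDual_one_eq_zero_iff hf x).1 (hx f hf)
    have h2 := (evalDual_one_eq_zero_iff hf y).1 (hy f hf)
    have h := evalAt_leftInv_linear (1 : A) x y (1 : k) f
    rw [one_smul, h1, h2] at h
    exact (evalDual_one_eq_zero_iff hf _).2 (by simpa using h)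
  smul_mem' := fun r x hx f hf => by
    have h1 := (evalDual_one_eq_zero_iff hf x).1 (hx f hf)
    have h0 := evalAt_leftInv_linear (1 : A) 0 0 (1 : k) f
    have h := evalAt_leftInv_linear (1 : A) x 0 r f
    rw [add_zero, h1] at h
    refine (evalDual_one_eq_zero_iff hf _).2 (h.trans ?_)
    simpa using h0
  lie_mem' := fun {x y} hx hy f hf => by
    refine (evalDual_one_eq_zero_iff hf _).2 ?_
    rw [evalAt_leftInv_lie,
      (evalDual_one_eq_zero_iff (Vanishes.leftInv hy hf) x).1 (hx _ (Vanishes.leftInv hy hf)),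
      (evalDual_one_eq_zero_iff (Vanishes.leftInv hx hf) y).1 (hy _ (Vanishes.leftInv hx hf)),
      sub_zero]

variable (k) in
/-- A Borel subgroup of `G`: a maximal closed connected solvable subgroup. -/
def IsBorel (G B : Subgroup Aˣ) : Prop :=
  Maximal (fun H : Subgroup Aˣ => H ≤ G ∧ @IsClosed Aˣ (zariski k A) (H : Set Aˣ) ∧
    @IsConnected Aˣ (zariski k A) (H : Set Aˣ) ∧ Group.IsSolvable H) B

variable (k) in
/-- A parabolic subgroup of `G`: a closed subgroup that contains a Borel subgroup of `G`. -/
def IsParabolic (G P : Subgroup Aˣ) : Prop :=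
  P ≤ G ∧ @IsClosed Aˣ (zariski k A) (P : Set Aˣ) ∧ ∃ B : Subgroup Aˣ, IsBorel k G B ∧ B ≤ P

/-- A parabolic subalgebra of `Lie G`: the Lie algebra of a parabolic subgroup of `G`. -/
def IsParabolicSubalgebra {G : Subgroup Aˣ} (h : LieSubalgebra k (lieAlg k G)) : Prop :=
  ∃ P : Subgroup Aˣ, IsParabolic k G P ∧ h.map (lieAlg k G).incl = lieAlg k P

end Linear

/-- A maximal non-semisimple subalgebra: a maximal element of the set of subalgebras whose
solvable radical is non-zero. -/
def IsMaximalNonSemisimple {k L : Type*} [Field k] [LieRing L] [LieAlgebra k L]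
    (h : LieSubalgebra k L) : Prop :=
  Maximal (fun m : LieSubalgebra k L => ¬ LieAlgebra.HasTrivialRadical k m) h

section Groups

variable {k V : Type*} [Field k] [AddCommGroup V] [Module k V]

variable (k V) in
/-- The special linear group `SL(V)`. -/
noncomputable def SL : Subgroup (Module.End k V)ˣ :=
  (Units.map (LinearMap.det : Module.End k V →* k)).ker

/-- The symplectic group `Sp(V)` of an alternating form `ω`. -/
def Sp (ω : LinearMap.BilinForm k V) : Subgroup (Module.End k V)ˣ where
  carrier := {g | ∀ v w : V, ω ((g : Module.End k V) v) ((g : Module.End k V) w) = ω v w}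
  one_mem' := fun _ _ => rfl
  mul_mem' := fun {g h} hg hh v w => by
    simp only [Units.val_mul, Module.End.mul_apply]
    rw [hg, hh]
  inv_mem' := fun {g} hg v w => by
    have h : ∀ u : V, (g : Module.End k V) (((g⁻¹ : (Module.End k V)ˣ) : Module.End k V) u) = u := fun u => by
      rw [← Module.End.mul_apply, Units.mul_inv, Module.End.one_apply]
    rw [← hg, h, h]

/-- The spin group `Spin(V)` of a quadratic form `Q`, inside the units of the Clifford algebra. -/
def Spin (Q : QuadraticForm k V) : Subgroup (CliffordAlgebra Q)ˣ :=
  (spinGroup.toUnits : spinGroup Q →* (CliffordAlgebra Q)ˣ).range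

end Groups

end ClassicalLie

/-!
Maximal non-semisimple subalgebras of the Lie algebras of `SL(V)`, `Sp(V)` and `Spin(V)` are
parabolic. Let `h` be such a subalgebra and let `V` be the natural module. The idea is to show that
`h` stabilizes a subspace `W` of the kind whose stabilizers are parabolic, and that the full
stabilizer of `W` is the Lie algebra of a parabolic subgroup and is not semisimple. By maximality it
is then equal to `h` (`isParabolicSubalgebra_of_stabilizer`).

*The invariant subspace.* A Lie algebra that is not semisimple has a non-zero abelian ideal `I`, and
the generalized eigenspaces on `V` of each `a` in `I` are stable. For traceless endomorphisms, with
`dim V` invertible in `k`, irreducibility would therefore leave only the eigenvalue zero; then the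
common kernel of `I` is stable and non-zero, so it is `V`, which contradicts `I ≠ 0`
(`exists_invariant_of_trace_eq_zero`). For Lie algebras of isometries either a generalized
eigenspace for a non-zero eigenvalue is stable and isotropic, or `I` consists of nilpotent elements
and the intersection of the common kernel of `I` with `I V` is (`exists_invariant_isotropic`).

*Stabilizers are parabolic.* The candidate for a Borel subgroup inside the stabilizer of `W` is the
identity component of the stabilizer of a full flag, resp. a maximal isotropic flag, through `W`.
That stabilizer is closed and solvable. A connected solvable group `H` that contains the candidate
has eigenvectors modulo each member of the flag, by the Lie–Kolchin theorem
(`exists_eigenvector_mod_of_isConnected`), and the root subgroups in the candidate force these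
eigenvectors to lie in the flag; so `H` stabilizes the flag (`isParabolic_stabSL`,
`IsFormGroup.le_stabilizer_flag`). The only exception occurs in type D, where a maximal isotropic
subspace has at most one companion that contains the same hyperplane, and connectedness of `H`
excludes that the two are exchanged (`IsFormGroup.mem_of_selfdual`). The Lie–Kolchin theorem is
proved for abstract solvable groups with a space of functions, where connectedness means that there
is no proper closed subgroup of finite index.

*Stabilizers in the Lie algebra.* An element of `Lie G` that stabilizes `W` is a sum of operators of
rank one (or two, for a form) that stabilize `W`, and each of these is, up to scalars, tangent to a
unipotent one-parameter subgroup or to a torus in the stabilizer of `W` in `G` (`mem_lieAlg_stabSL`,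
`IsFormGroup.mem_lieAlg_stabilizer`). The scalars are harmless, because `Lie G` contains no non-zero
scalars.

Symplectic and spin groups are treated together through `IsFormGroup`. For the spin group this
requires that it is closed, that is, that it consists of all even elements of spinor norm one that
normalize the space of vectors (`mem_Spin_iff`); this follows from the theorem of Cartan and
Dieudonné and the fact that the twisted centralizer of `V` in the Clifford algebra consists of
scalars.
-/

open scoped commutatorElement

namespace ClassicalLie

/-! ### Invariant subspaces of non-semisimple Lie algebras of endomorphisms -/

section InvariantSubspaces

variable {k V L : Type*} [Field k] [AddCommGroup V] [Module k V]

attribute [local instance 100] LieRing.ofAssociativeRing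

/-- A commuting family of endomorphisms that preserves a non-zero subspace has a common eigenvector
in it: a minimal non-zero invariant subspace lies in an eigenspace of each member. -/
theorem exists_common_eigenvector [IsAlgClosed k] [FiniteDimensional k V]
    (S : Set (Module.End k V)) (hS : ∀ s ∈ S, ∀ t ∈ S, s * t = t * s)
    (X : Submodule k V) (hX : X ≠ ⊥) (hstab : ∀ s ∈ S, ∀ v ∈ X, s v ∈ X) :
    ∃ v ∈ X, v ≠ 0 ∧ ∀ s ∈ S, ∃ c : k, s v = c • v := by
  obtain ⟨Y, hYX, hY⟩ := exists_minimal_le_of_wellFoundedLT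
    (fun Y : Submodule k V => Y ≠ ⊥ ∧ ∀ s ∈ S, ∀ v ∈ Y, s v ∈ Y) X ⟨hX, hstab⟩
  obtain ⟨v, hvY, hv0⟩ := Submodule.exists_mem_ne_zero_of_ne_bot hY.prop.1
  refine ⟨v, hYX hvY, hv0, fun s hs => ?_⟩
  have hYs : ∀ u ∈ Y, s u ∈ Y := hY.prop.2 s hs
  have : Nontrivial Y := Submodule.nontrivial_iff_ne_bot.2 hY.prop.1
  obtain ⟨c, hc⟩ := Module.End.exists_eigenvalue (s.restrict hYs)
  obtain ⟨u, hu⟩ := hc.exists_hasEigenvector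
  have hsu : s (u : V) = c • (u : V) := by
    have h := congrArg Subtype.val hu.apply_eq_smul
    simpa using h
  have hle : Y ≤ Y ⊓ Module.End.eigenspace s c := by
    refine hY.le_of_le ⟨?_, ?_⟩ inf_le_left
    · refine (Submodule.ne_bot_iff _).2 ⟨u, ⟨u.2, Module.End.mem_eigenspace_iff.2 hsu⟩, ?_⟩
      exact fun h => hu.2 (Subtype.ext h)
    · rintro t ht w ⟨hw1, hw2⟩
      refine ⟨hY.prop.2 t ht w hw1, Module.End.mem_eigenspace_iff.2 ?_⟩
      have h := LinearMap.congr_fun (hS s hs t ht) w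
      rw [Module.End.mul_apply, Module.End.mul_apply, Module.End.mem_eigenspace_iff.1 hw2] at h
      rw [h, map_smul]
  exact ⟨c, Module.End.mem_eigenspace_iff.1 (hle hvY).2⟩

/-- If `a` commutes with `[a, y]`, then `y` preserves the generalized eigenspaces of `a`. -/
theorem mem_maxGenEigenspace_of_commute_lie (a y : Module.End k V)
    (h : a * (a * y - y * a) = (a * y - y * a) * a) (c : k) {v : V}
    (hv : v ∈ a.maxGenEigenspace c) : y v ∈ a.maxGenEigenspace c := by
  rw [Module.End.mem_maxGenEigenspace] at hv ⊢
  obtain ⟨n, hn⟩ := hv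
  set b : Module.End k V := a - c • 1 with hb
  have hz : b * y - y * b = a * y - y * a := by
    rw [hb]; simp [sub_mul, mul_sub]
  have hbz : Commute b (b * y - y * b) := by
    rw [hz, hb]
    exact Commute.sub_left h (by simp [Commute, SemiconjBy])
  have key : ∀ m : ℕ, b ^ (m + 1) * y = y * b ^ (m + 1) + (m + 1) • ((b * y - y * b) * b ^ m) := by
    intro m
    induction m with
    | zero => simp
    | succ m ih =>
      rw [pow_succ' b (m + 1), mul_assoc, ih, mul_add, mul_smul_comm, ← mul_assoc b (_ - _),
        hbz.eq, mul_assoc (_ - _) b, ← pow_succ' b m, ← mul_assoc b y,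
        show b * y = y * b + (b * y - y * b) by abel, add_mul, succ_nsmul _ (m + 1)]
      simp only [mul_assoc, ← pow_succ']
      rw [show y * b + (b * y - y * b) - y * b = b * y - y * b by abel]
      abel
  refine ⟨n + 1, ?_⟩
  rw [← Module.End.mul_apply, key, LinearMap.add_apply, LinearMap.smul_apply, Module.End.mul_apply,
    Module.End.mul_apply, hn, pow_succ', Module.End.mul_apply, hn]
  simp

/-- Generalized eigenspaces of a skew endomorphism with eigenvalues of non-zero sum are
orthogonal; here for a single non-zero eigenvalue. -/
theorem apply_eq_zero_of_mem_maxGenEigenspace (B : LinearMap.BilinForm k V) (a : Module.End k V)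
    (ha : ∀ u v, B (a u) v + B u (a v) = 0) {c : k} (h2 : (2 : k) ≠ 0) (hc : c ≠ 0) {u v : V}
    (hu : u ∈ a.maxGenEigenspace c) (hv : v ∈ a.maxGenEigenspace c) : B u v = 0 := by
  rw [Module.End.mem_maxGenEigenspace] at hu hv
  obtain ⟨m, hm⟩ := hu
  obtain ⟨n, hn⟩ := hv
  obtain ⟨s, hs⟩ : ∃ s, m + n = s := ⟨_, rfl⟩
  induction s generalizing m n u v with
  | zero =>
    obtain rfl : m = 0 := by omega
    have : u = 0 := by simpa using hm
    simp [this]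
  | succ s ih =>
    rcases m with _ | m
    · have : u = 0 := by simpa using hm
      simp [this]
    rcases n with _ | n
    · have : v = 0 := by simpa using hn
      simp [this]
    rw [pow_succ, Module.End.mul_apply] at hm hn
    have h1 := ih m hm (n + 1) (by rw [pow_succ, Module.End.mul_apply]; exact hn) (by omega)
    have h2' := ih (m + 1) (by rw [pow_succ, Module.End.mul_apply]; exact hm) n hn (by omega)
    simp only [LinearMap.sub_apply, LinearMap.smul_apply, Module.End.one_apply, map_sub,
      map_smul, smul_eq_mul] at h1 h2'
    have h3 : 2 * c * B u v = 0 := by linear_combination ha u v - h1 - h2'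
    simpa [h2, hc] using h3

variable [LieRing L] [LieAlgebra k L]

theorem lie_lie_commute_of_isLieAbelian (ρ : L →ₗ⁅k⁆ Module.End k V) (I : LieIdeal k L)
    [hI : IsLieAbelian I] {a : L} (ha : a ∈ I) (x : L) :
    ρ a * (ρ a * ρ x - ρ x * ρ a) = (ρ a * ρ x - ρ x * ρ a) * ρ a := by
  have h := congrArg Subtype.val (hI.trivial ⟨a, ha⟩ ⟨⁅a, x⁆, lie_mem_left k L I a x ha⟩)
  have h' := congrArg ρ (show ⁅a, ⁅a, x⁆⁆ = 0 from h)
  rw [LieHom.map_lie, LieHom.map_lie, map_zero, LieRing.of_associative_ring_bracket,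
    LieRing.of_associative_ring_bracket, sub_eq_zero] at h'
  exact h'

theorem mul_comm_of_isLieAbelian (ρ : L →ₗ⁅k⁆ Module.End k V) (I : LieIdeal k L)
    [hI : IsLieAbelian I] {a b : L} (ha : a ∈ I) (hb : b ∈ I) : ρ a * ρ b = ρ b * ρ a := by
  have h := congrArg Subtype.val (hI.trivial ⟨a, ha⟩ ⟨b, hb⟩)
  have h' := congrArg ρ (show ⁅a, b⁆ = 0 from h)
  rwa [LieHom.map_lie, map_zero, LieRing.of_associative_ring_bracket, sub_eq_zero] at h'

/-- Commuting nilpotent endomorphisms that preserve a non-zero subspace kill a non-zero vector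
of it. -/
theorem exists_common_kernel [IsAlgClosed k] [FiniteDimensional k V]
    (S : Set (Module.End k V)) (hS : ∀ s ∈ S, ∀ t ∈ S, s * t = t * s)
    (hnil : ∀ s ∈ S, s.maxGenEigenspace 0 = ⊤)
    (X : Submodule k V) (hX : X ≠ ⊥) (hstab : ∀ s ∈ S, ∀ v ∈ X, s v ∈ X) :
    ∃ v ∈ X, v ≠ 0 ∧ ∀ s ∈ S, s v = 0 := by
  obtain ⟨v, hvX, hv0, hv⟩ := exists_common_eigenvector S hS X hX hstab
  refine ⟨v, hvX, hv0, fun s hs => ?_⟩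
  obtain ⟨c, hc⟩ := hv s hs
  have hvs : v ∈ s.maxGenEigenspace 0 := by rw [hnil s hs]; trivial
  obtain ⟨n, hn⟩ := (Module.End.mem_maxGenEigenspace _ _ _).1 hvs
  have hpow : ∀ m : ℕ, ((s - (0 : k) • (1 : Module.End k V)) ^ m) v = c ^ m • v := by
    intro m
    induction m with
    | zero => simp
    | succ m ih =>
      rw [pow_succ', Module.End.mul_apply, ih, map_smul]
      simp [hc, smul_smul, pow_succ]
  rw [hpow, smul_eq_zero] at hn
  rcases hn with hn | hn
  · rw [hc, eq_zero_of_pow_eq_zero hn, zero_smul]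
  · exact absurd hn hv0

theorem maxGenEigenspace_zero_eq_top [IsAlgClosed k] [FiniteDimensional k V] (a : Module.End k V)
    (h : ∀ c : k, c ≠ 0 → a.maxGenEigenspace c = ⊥) : a.maxGenEigenspace 0 = ⊤ := by
  rw [eq_top_iff, ← Module.End.iSup_maxGenEigenspace_eq_top a]
  refine iSup_le fun c => ?_
  by_cases hc : c = 0
  · rw [hc]
  · rw [h c hc]; exact bot_le

/-- A non-semisimple Lie algebra of traceless endomorphisms, in a dimension prime to the
characteristic, is reducible. -/
theorem exists_invariant_of_trace_eq_zero [IsAlgClosed k] [FiniteDimensional k V]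
    (hV : (Module.finrank k V : k) ≠ 0) (ρ : L →ₗ⁅k⁆ Module.End k V)
    (hinj : Function.Injective ρ) (hL : ¬ LieAlgebra.HasTrivialRadical k L)
    (htr : ∀ x, LinearMap.trace k V (ρ x) = 0) :
    ∃ W : Submodule k V, W ≠ ⊥ ∧ W ≠ ⊤ ∧ ∀ x, ∀ u ∈ W, ρ x u ∈ W := by
  rw [LieAlgebra.hasTrivialRadical_iff_no_abelian_ideals] at hL
  push Not at hL
  obtain ⟨I, hI, hI0⟩ := hL
  by_contra! hirr
  have hVn : (⊤ : Submodule k V) ≠ ⊥ := by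
    intro h
    have : Subsingleton V := (Submodule.subsingleton_iff k).1 (subsingleton_of_bot_eq_top h.symm)
    exact hV (by rw [Module.finrank_zero_of_subsingleton, Nat.cast_zero])
  have hdich : ∀ W : Submodule k V, (∀ x, ∀ u ∈ W, ρ x u ∈ W) → W ≠ ⊥ → W = ⊤ := by
    intro W hW h0
    by_contra h1
    obtain ⟨x, u, hu, hxu⟩ := hirr W h0 h1
    exact hxu (hW x u hu)
  have hnil : ∀ a ∈ I, (ρ a).maxGenEigenspace 0 = ⊤ := by
    intro a ha
    refine maxGenEigenspace_zero_eq_top _ fun c hc => ?_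
    by_contra hne
    have htop := hdich ((ρ a).maxGenEigenspace c) (fun x u hu =>
      mem_maxGenEigenspace_of_commute_lie _ _ (lie_lie_commute_of_isLieAbelian ρ I ha x) c hu) hne
    have hn : IsNilpotent (ρ a - c • (1 : Module.End k V)) := by
      refine ⟨(ρ a).maxGenEigenspaceIndex c, LinearMap.ext fun v => ?_⟩
      have hv : v ∈ (ρ a).maxGenEigenspace c := by rw [htop]; trivial
      rw [Module.End.maxGenEigenspace_eq, Module.End.mem_genEigenspace_nat] at hv
      exact hv
    have h := (LinearMap.isNilpotent_trace_of_isNilpotent hn).eq_zero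
    rw [map_sub, htr, map_smul, LinearMap.trace_one, zero_sub, neg_eq_zero, smul_eq_mul,
      mul_eq_zero] at h
    exact h.elim hc hV
  obtain ⟨v, -, hv0, hv⟩ := exists_common_kernel (ρ '' (I : Set L))
    (by rintro _ ⟨a, ha, rfl⟩ _ ⟨b, hb, rfl⟩; exact mul_comm_of_isLieAbelian ρ I ha hb)
    (by rintro _ ⟨a, ha, rfl⟩; exact hnil a ha) ⊤ hVn (fun _ _ _ _ => trivial)
  let W : Submodule k V :=
    { carrier := {u | ∀ a ∈ I, ρ a u = 0}
      zero_mem' := fun a _ => map_zero _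
      add_mem' := fun hu hw a ha => by rw [map_add, hu a ha, hw a ha, add_zero]
      smul_mem' := fun c u hu a ha => by rw [map_smul, hu a ha, smul_zero] }
  have hW : W = ⊤ := by
    refine hdich W (fun x u hu a ha => ?_) ?_
    · have h := hu _ (lie_mem_left k L I a x ha)
      rw [LieHom.map_lie, LieRing.of_associative_ring_bracket, LinearMap.sub_apply,
        Module.End.mul_apply, Module.End.mul_apply, hu a ha, map_zero, sub_zero] at h
      exact h
    · exact (Submodule.ne_bot_iff _).2 ⟨v, fun a ha => hv _ ⟨a, ha, rfl⟩, hv0⟩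
  refine hI0 ((LieSubmodule.eq_bot_iff _).2 fun a ha => hinj ?_)
  rw [map_zero]
  ext u
  have hu : u ∈ W := by rw [hW]; trivial
  exact hu a ha

/-- A non-semisimple Lie algebra of endomorphisms that are skew for a bilinear form preserves a
non-zero totally isotropic subspace. -/
theorem exists_invariant_isotropic [IsAlgClosed k] [FiniteDimensional k V] (h2 : (2 : k) ≠ 0)
    (B : LinearMap.BilinForm k V) (ρ : L →ₗ⁅k⁆ Module.End k V)
    (hinj : Function.Injective ρ) (hL : ¬ LieAlgebra.HasTrivialRadical k L)
    (hskew : ∀ x u v, B (ρ x u) v + B u (ρ x v) = 0) :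
    ∃ W : Submodule k V, W ≠ ⊥ ∧ (∀ u ∈ W, ∀ v ∈ W, B u v = 0) ∧ ∀ x, ∀ u ∈ W, ρ x u ∈ W := by
  rw [LieAlgebra.hasTrivialRadical_iff_no_abelian_ideals] at hL
  push Not at hL
  obtain ⟨I, hI, hI0⟩ := hL
  by_cases hsemi : ∃ a ∈ I, ∃ c : k, c ≠ 0 ∧ (ρ a).maxGenEigenspace c ≠ ⊥
  · obtain ⟨a, ha, c, hc, hne⟩ := hsemi
    exact ⟨_, hne, fun u hu v hv => apply_eq_zero_of_mem_maxGenEigenspace B _ (hskew a) h2 hc hu hv,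
      fun x u hu => mem_maxGenEigenspace_of_commute_lie _ _
        (lie_lie_commute_of_isLieAbelian ρ I ha x) c hu⟩
  push Not at hsemi
  have hnil : ∀ a ∈ I, (ρ a).maxGenEigenspace 0 = ⊤ := fun a ha =>
    maxGenEigenspace_zero_eq_top _ (hsemi a ha)
  -- the isotropic subspace is the intersection of the common kernel of `I` with `I V`
  let X : Submodule k V := Submodule.span k {w | ∃ a ∈ I, ∃ u, ρ a u = w}
  have hXstab : ∀ x, ∀ u ∈ X, ρ x u ∈ X := by
    intro x u hu
    induction hu using Submodule.span_induction with
    | mem w hw =>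
      obtain ⟨a, ha, u, rfl⟩ := hw
      have h : ρ x (ρ a u) = ρ a (ρ x u) + ρ ⁅x, a⁆ u := by
        rw [LieHom.map_lie, LieRing.of_associative_ring_bracket, LinearMap.sub_apply,
          Module.End.mul_apply, Module.End.mul_apply]
        abel
      rw [h]
      exact X.add_mem (Submodule.subset_span ⟨a, ha, _, rfl⟩)
        (Submodule.subset_span ⟨_, lie_mem_right k L I x a ha, _, rfl⟩)
    | zero => rw [map_zero]; exact X.zero_mem
    | add u w _ _ hu hw => rw [map_add]; exact X.add_mem hu hw
    | smul c u _ hu => rw [map_smul]; exact X.smul_mem c hu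
  have hX0 : X ≠ ⊥ := by
    intro h
    refine hI0 ((LieSubmodule.eq_bot_iff _).2 fun a ha => hinj ?_)
    rw [map_zero]
    ext u
    have hu : ρ a u ∈ X := Submodule.subset_span ⟨a, ha, u, rfl⟩
    rw [h] at hu
    exact hu
  obtain ⟨v, hvX, hv0, hv⟩ := exists_common_kernel (ρ '' (I : Set L))
    (by rintro _ ⟨a, ha, rfl⟩ _ ⟨b, hb, rfl⟩; exact mul_comm_of_isLieAbelian ρ I ha hb)
    (by rintro _ ⟨a, ha, rfl⟩; exact hnil a ha) X hX0
    (by rintro _ ⟨a, ha, rfl⟩ u hu; exact hXstab a u hu)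
  let W : Submodule k V :=
    { carrier := {u | u ∈ X ∧ ∀ a ∈ I, ρ a u = 0}
      zero_mem' := ⟨X.zero_mem, fun a _ => map_zero _⟩
      add_mem' := fun hu hw => ⟨X.add_mem hu.1 hw.1, fun a ha => by
        rw [map_add, hu.2 a ha, hw.2 a ha, add_zero]⟩
      smul_mem' := fun c u hu => ⟨X.smul_mem c hu.1, fun a ha => by
        rw [map_smul, hu.2 a ha, smul_zero]⟩ }
  refine ⟨W, (Submodule.ne_bot_iff _).2 ⟨v, ⟨hvX, fun a ha => hv _ ⟨a, ha, rfl⟩⟩, hv0⟩, ?_, ?_⟩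
  · rintro u ⟨-, hu⟩ w ⟨hw, -⟩
    induction hw using Submodule.span_induction with
    | mem w hw =>
      obtain ⟨a, ha, w, rfl⟩ := hw
      have h := hskew a u w
      rwa [hu a ha, map_zero, LinearMap.zero_apply, zero_add] at h
    | zero => rw [map_zero]
    | add w w' _ _ hw hw' => rw [map_add, hw, hw', add_zero]
    | smul c w _ hw => rw [map_smul, hw, smul_zero]
  · rintro x u ⟨huX, hu⟩
    refine ⟨hXstab x u huX, fun a ha => ?_⟩
    have h := hu _ (lie_mem_left k L I a x ha)
    rw [LieHom.map_lie, LieRing.of_associative_ring_bracket, LinearMap.sub_apply,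
      Module.End.mul_apply, Module.End.mul_apply, hu a ha, map_zero, sub_zero] at h
    exact h

/-- The ideal of all `x` in `L` with `x V ≤ W`, `x X ≤ Y` and `x Z = 0`, for invariant subspaces
`W`, `X`, `Y` and `Z`. -/
def filtrationIdeal (ρ : L →ₗ⁅k⁆ Module.End k V) (W X Y Z : Submodule k V)
    (hW : ∀ x, ∀ u ∈ W, ρ x u ∈ W) (hX : ∀ x, ∀ u ∈ X, ρ x u ∈ X)
    (hY : ∀ x, ∀ u ∈ Y, ρ x u ∈ Y) (hZ : ∀ x, ∀ u ∈ Z, ρ x u ∈ Z) : LieIdeal k L where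
  carrier := {x | (∀ u, ρ x u ∈ W) ∧ (∀ u ∈ X, ρ x u ∈ Y) ∧ ∀ u ∈ Z, ρ x u = 0}
  zero_mem' := by simp
  add_mem' := by
    rintro x y ⟨hx1, hx2, hx3⟩ ⟨hy1, hy2, hy3⟩
    simp only [Set.mem_ofPred_eq, map_add, LinearMap.add_apply]
    exact ⟨fun u => W.add_mem (hx1 u) (hy1 u), fun u hu => Y.add_mem (hx2 u hu) (hy2 u hu),
      fun u hu => by rw [hx3 u hu, hy3 u hu, add_zero]⟩
  smul_mem' := by
    rintro c x ⟨hx1, hx2, hx3⟩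
    simp only [Set.mem_ofPred_eq, map_smul, LinearMap.smul_apply]
    exact ⟨fun u => W.smul_mem c (hx1 u), fun u hu => Y.smul_mem c (hx2 u hu),
      fun u hu => by rw [hx3 u hu, smul_zero]⟩
  lie_mem := by
    rintro x y ⟨hy1, hy2, hy3⟩
    simp only [Set.mem_ofPred_eq, LieHom.map_lie, LieRing.of_associative_ring_bracket,
      LinearMap.sub_apply, Module.End.mul_apply]
    exact ⟨fun u => W.sub_mem (hW x _ (hy1 u)) (hy1 _),
      fun u hu => Y.sub_mem (hY x _ (hy2 u hu)) (hy2 _ (hX x u hu)),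
      fun u hu => by rw [hy3 u hu, hy3 _ (hZ x u hu), map_zero, sub_zero]⟩

/-- A Lie algebra of endomorphisms is not semisimple if it preserves subspaces `W ≤ W'` and has a
non-zero element `y` with `y W = 0`, `y W' ≤ W` and `y V ≤ W'`. All such elements, or those among
them that kill `W'` and map `V` into `W`, form a non-zero abelian ideal. -/
theorem not_hasTrivialRadical_of_nilpotent (ρ : L →ₗ⁅k⁆ Module.End k V)
    (hinj : Function.Injective ρ) (W W' : Submodule k V) (hWW' : W ≤ W')
    (hW : ∀ x, ∀ u ∈ W, ρ x u ∈ W) (hW' : ∀ x, ∀ u ∈ W', ρ x u ∈ W') (y : L) (hy0 : y ≠ 0)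
    (hyW : ∀ u ∈ W, ρ y u = 0) (hyW' : ∀ u ∈ W', ρ y u ∈ W) (hyV : ∀ u, ρ y u ∈ W') :
    ¬ LieAlgebra.HasTrivialRadical k L := by
  rw [LieAlgebra.hasTrivialRadical_iff_no_abelian_ideals]
  intro h
  let J := filtrationIdeal ρ W W W W' hW hW hW hW'
  let I := filtrationIdeal ρ W' W' W W hW' hW' hW hW
  have hJ : J = ⊥ := by
    refine h J ⟨fun x y => Subtype.ext (hinj ?_)⟩
    obtain ⟨x, hx1, -, hx3⟩ := x
    obtain ⟨y, hy1, -, hy3⟩ := y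
    change ρ ⁅x, y⁆ = ρ 0
    ext u
    rw [LieHom.map_lie, map_zero, LieRing.of_associative_ring_bracket, LinearMap.sub_apply,
      Module.End.mul_apply, Module.End.mul_apply, hx3 _ (hWW' (hy1 u)), hy3 _ (hWW' (hx1 u))]
    simp
  have hI : I = ⊥ := by
    refine h I ⟨fun x y => Subtype.ext ?_⟩
    obtain ⟨x, hx1, hx2, hx3⟩ := x
    obtain ⟨y, hy1, hy2, hy3⟩ := y
    have hxy : ⁅x, y⁆ ∈ J := by
      refine ⟨fun u => ?_, fun u hu => ?_, fun u hu => ?_⟩ <;>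
        rw [LieHom.map_lie, LieRing.of_associative_ring_bracket, LinearMap.sub_apply,
          Module.End.mul_apply, Module.End.mul_apply]
      · exact W.sub_mem (hx2 _ (hy1 u)) (hy2 _ (hx1 u))
      · rw [hy3 u hu, hx3 u hu]; simp
      · rw [hx3 _ (hy2 u hu), hy3 _ (hx2 u hu)]; simp
    rw [hJ] at hxy
    exact hxy
  have hy : y ∈ I := ⟨hyV, hyW', hyW⟩
  rw [hI] at hy
  exact hy0 hy

end InvariantSubspaces

/-! ### The Zariski topology on groups of units -/

section Zariski

variable {k A : Type*} [Field k] [Ring A] [Algebra k A]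

@[simp]
theorem PolyFun.evalAt_X (a : A) (φ : Module.Dual k A) :
    PolyFun.evalAt a (MvPolynomial.X φ : PolyFun k A) = φ a := by
  simp [PolyFun.evalAt]

@[simp]
theorem PolyFun.evalDual_X (a b : A) (φ : Module.Dual k A) :
    PolyFun.evalDual a b (MvPolynomial.X φ : PolyFun k A) =
      TrivSqZeroExt.inl (φ a) + TrivSqZeroExt.inr (φ b) := by
  simp [PolyFun.evalDual]

/-- A quadratic function `a ↦ b(a, a)` on a finite-dimensional algebra is polynomial, and its
derivative at `1` is `x ↦ b(1, x) + b(x, 1)`. -/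
theorem exists_polyFun_bilin [FiniteDimensional k A] (b : A →ₗ[k] A →ₗ[k] k) :
    ∃ f : PolyFun k A, (∀ a, PolyFun.evalAt a f = b a a) ∧
      ∀ x, PolyFun.evalDual 1 x f =
        TrivSqZeroExt.inl (b 1 1) + TrivSqZeroExt.inr (b 1 x + b x 1) := by
  let e := Module.finBasis k A
  have hb : ∀ x y, b x y = ∑ i, e.coord i x * b (e i) y := by
    intro x y
    conv_lhs => rw [← e.sum_repr x]
    simp [-Module.Basis.sum_repr]
  refine ⟨∑ i, MvPolynomial.X (e.coord i) * MvPolynomial.X (b (e i)), fun a => ?_, fun x => ?_⟩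
  · rw [map_sum, hb]
    simp
  · rw [map_sum]
    have : ∀ i, PolyFun.evalDual 1 x (MvPolynomial.X (e.coord i) * MvPolynomial.X (b (e i)) :
        PolyFun k A) = TrivSqZeroExt.inl (e.coord i 1 * b (e i) 1) +
          TrivSqZeroExt.inr (e.coord i 1 * b (e i) x + e.coord i x * b (e i) 1) := by
      intro i
      rw [map_mul, PolyFun.evalDual_X, PolyFun.evalDual_X]
      ext <;> simp [mul_comm]
    rw [Finset.sum_congr rfl fun i _ => this i, hb 1 1, hb 1 x, hb x 1,
      ← Finset.sum_add_distrib, TrivSqZeroExt.inl_sum, TrivSqZeroExt.inr_sum,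
      ← Finset.sum_add_distrib]

theorem isClosed_vanishing (f : PolyFun k A) :
    @IsClosed Aˣ (zariski k A) {x : Aˣ | PolyFun.evalAt (x : A) f = 0} := by
  let : TopologicalSpace Aˣ := zariski k A
  refine isOpen_compl_iff.1 ?_
  exact TopologicalSpace.isOpen_generateFrom_of_mem ⟨f, rfl⟩

theorem isClosed_vanishing_set (S : Set (PolyFun k A)) :
    @IsClosed Aˣ (zariski k A) {x : Aˣ | ∀ f ∈ S, PolyFun.evalAt (x : A) f = 0} := by
  let : TopologicalSpace Aˣ := zariski k A
  have : {x : Aˣ | ∀ f ∈ S, PolyFun.evalAt (x : A) f = 0} =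
      ⋂ f ∈ S, {x : Aˣ | PolyFun.evalAt (x : A) f = 0} := by
    ext x; simp
  rw [this]
  exact isClosed_biInter fun f _ => isClosed_vanishing f

/-- Left translations are continuous for the Zariski topology. -/
theorem continuous_mul_left_zariski (g : Aˣ) :
    @Continuous Aˣ Aˣ (zariski k A) (zariski k A) (fun x => g * x) := by
  let : TopologicalSpace Aˣ := zariski k A
  refine continuous_generateFrom_iff.2 ?_
  rintro _ ⟨f, rfl⟩
  let τ : PolyFun k A →ₐ[k] PolyFun k A :=
    MvPolynomial.aeval (fun φ : Module.Dual k A =>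
      MvPolynomial.X (φ ∘ₗ LinearMap.mulLeft k (g : A)))
  have hτ : ∀ b : A, (PolyFun.evalAt b).comp τ = PolyFun.evalAt (k := k) ((g : A) * b) := fun b =>
    MvPolynomial.algHom_ext fun φ => by simp [τ, PolyFun.evalAt]
  refine TopologicalSpace.isOpen_generateFrom_of_mem ⟨τ f, ?_⟩
  ext x
  have h : PolyFun.evalAt (x : A) (τ f) = PolyFun.evalAt ((g : A) * x) f := by
    rw [← hτ, AlgHom.comp_apply]
  simp [h]

variable (k) in
/-- The identity component of a group of units, for the Zariski topology. -/
def identityComponent (T : Subgroup Aˣ) : Subgroup Aˣ :=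
  letI : TopologicalSpace Aˣ := zariski k A
  have hmul : ∀ g ∈ connectedComponentIn (T : Set Aˣ) 1,
      (fun x => g * x) '' connectedComponentIn (T : Set Aˣ) 1 ⊆
        connectedComponentIn (T : Set Aˣ) 1 := by
    intro g hg
    have hgT := connectedComponentIn_subset _ _ hg
    rw [connectedComponentIn_eq hg]
    refine IsPreconnected.subset_connectedComponentIn ?_ ?_ ?_
    · rw [← connectedComponentIn_eq hg]
      exact isPreconnected_connectedComponentIn.image _ (continuous_mul_left_zariski g).continuousOn
    · rw [← connectedComponentIn_eq hg]
      exact ⟨1, mem_connectedComponentIn T.one_mem, mul_one g⟩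
    · rw [← connectedComponentIn_eq hg]
      rintro _ ⟨x, hx, rfl⟩
      exact T.mul_mem hgT (connectedComponentIn_subset _ _ hx)
  { carrier := connectedComponentIn (T : Set Aˣ) 1
    one_mem' := mem_connectedComponentIn T.one_mem
    mul_mem' := fun {g h} hg hh => hmul g hg ⟨h, hh, rfl⟩
    inv_mem' := fun {g} hg => by
      have hgT := connectedComponentIn_subset _ _ hg
      have hsub : (fun x => g⁻¹ * x) '' connectedComponentIn (T : Set Aˣ) 1 ⊆
          connectedComponentIn (T : Set Aˣ) 1 := by
        refine IsPreconnected.subset_connectedComponentIn ?_ ?_ ?_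
        · exact isPreconnected_connectedComponentIn.image _
            (continuous_mul_left_zariski g⁻¹).continuousOn
        · exact ⟨g, hg, inv_mul_cancel g⟩
        · rintro _ ⟨x, hx, rfl⟩
          exact T.mul_mem (T.inv_mem hgT) (connectedComponentIn_subset _ _ hx)
      exact hsub ⟨1, mem_connectedComponentIn T.one_mem, mul_one _⟩ }

theorem identityComponent_le (T : Subgroup Aˣ) : identityComponent k T ≤ T := by
  let : TopologicalSpace Aˣ := zariski k A
  exact connectedComponentIn_subset (T : Set Aˣ) 1

theorem isConnected_identityComponent (T : Subgroup Aˣ) :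
    @IsConnected Aˣ (zariski k A) (identityComponent k T : Set Aˣ) := by
  let : TopologicalSpace Aˣ := zariski k A
  exact isConnected_connectedComponentIn_iff.2 T.one_mem

theorem subset_identityComponent {T : Subgroup Aˣ} {S : Set Aˣ}
    (hS : @IsPreconnected Aˣ (zariski k A) S) (h1 : (1 : Aˣ) ∈ S) (hST : S ⊆ T) :
    S ⊆ identityComponent k T := by
  let : TopologicalSpace Aˣ := zariski k A
  exact hS.subset_connectedComponentIn h1 hST

theorem isClosed_identityComponent {T : Subgroup Aˣ}
    (hT : @IsClosed Aˣ (zariski k A) (T : Set Aˣ)) :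
    @IsClosed Aˣ (zariski k A) (identityComponent k T : Set Aˣ) := by
  let : TopologicalSpace Aˣ := zariski k A
  refine isClosed_of_closure_subset ?_
  exact subset_identityComponent (isConnected_identityComponent T).isPreconnected.closure
    (subset_closure (identityComponent k T).one_mem)
    (closure_minimal (identityComponent_le T) hT)

/-- A one-parameter group `t ↦ 1 + t N` in `T` lies in the identity component. -/
theorem mem_identityComponent_of_line [Infinite k] {T : Subgroup Aˣ} (N : A) (u : k → Aˣ)
    (hu : ∀ t, (u t : A) = 1 + t • N) (hT : ∀ t, u t ∈ T) (t : k) :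
    u t ∈ identityComponent k T := by
  let : TopologicalSpace Aˣ := zariski k A
  let : TopologicalSpace k := TopologicalSpace.cofinite
  have hopen : ∀ s : Set k, IsOpen s ↔ (s.Nonempty → sᶜ.Finite) := fun s => Iff.rfl
  have hpre : IsPreconnected (Set.univ : Set k) := by
    refine (fun U W hU hW _ hU' hW' => ?_)
    obtain ⟨x, -, hx⟩ := hU'
    obtain ⟨y, -, hy⟩ := hW'
    have h1 := (hopen U).1 hU ⟨x, hx⟩
    have h2 := (hopen W).1 hW ⟨y, hy⟩
    obtain ⟨z, hz⟩ := (h1.union h2).infinite_compl.nonempty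
    simp only [Set.compl_union, compl_compl] at hz
    exact ⟨z, trivial, hz⟩
  have hcont : Continuous u := by
    refine continuous_generateFrom_iff.2 ?_
    rintro _ ⟨f, rfl⟩
    let c : PolyFun k A →ₐ[k] Polynomial k := MvPolynomial.aeval
      (fun φ : Module.Dual k A => Polynomial.C (φ 1) + Polynomial.X * Polynomial.C (φ N))
    have hc : ∀ t, ((Polynomial.aeval t).comp c) f = PolyFun.evalAt (u t : A) f := by
      intro t
      congr 1
      exact MvPolynomial.algHom_ext fun φ => by
        simp [c, PolyFun.evalAt, hu, mul_comm t]
    have hset : u ⁻¹' {x : Aˣ | PolyFun.evalAt (x : A) f ≠ 0} = {t | (c f).eval t ≠ 0} := by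
      ext t
      have h := hc t
      rw [AlgHom.comp_apply, Polynomial.coe_aeval_eq_eval] at h
      simp [h]
    rw [hset, hopen]
    rintro ⟨t, ht⟩
    have hne : c f ≠ 0 := fun h => ht (by rw [h, Polynomial.eval_zero])
    refine (Polynomial.finite_setOfPred_isRoot hne).subset fun s hs => ?_
    simpa using hs
  have h1 : u 0 = 1 := Units.ext (by rw [hu, zero_smul, add_zero, Units.val_one])
  refine subset_identityComponent (S := Set.range u) ?_ ⟨0, h1⟩ ?_ ⟨t, rfl⟩
  · rw [← Set.image_univ]
    exact hpre.image u hcont.continuousOn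
  · rintro _ ⟨t, rfl⟩
    exact hT t

/-- A connected group has no proper closed subgroup of finite index. -/
theorem eq_top_of_finiteIndex_of_isConnected {H : Subgroup Aˣ}
    (hH : @IsConnected Aˣ (zariski k A) (H : Set Aˣ)) (K : Subgroup H) [K.FiniteIndex]
    (S : Set (PolyFun k A))
    (hK : ∀ h : H, h ∈ K ↔ ∀ f ∈ S, PolyFun.evalAt ((h : Aˣ) : A) f = 0) : K = ⊤ := by
  let : TopologicalSpace Aˣ := zariski k A
  let Z : Set Aˣ := {x : Aˣ | ∀ f ∈ S, PolyFun.evalAt (x : A) f = 0}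
  have hZ : IsClosed Z := isClosed_vanishing_set S
  have hZK : ∀ h : H, (h : Aˣ) ∈ Z ↔ h ∈ K := fun h => (hK h).symm
  let C : H ⧸ K → Set Aˣ := fun q => (fun x => ((q.out : H) : Aˣ)⁻¹ * x) ⁻¹' Z
  have hC : ∀ q, IsClosed (C q) := fun q => hZ.preimage (continuous_mul_left_zariski _)
  have hCK : ∀ (h : H) (q : H ⧸ K), (h : Aˣ) ∈ C q ↔ (h : H ⧸ K) = q := by
    intro h q
    have h1 : (h : Aˣ) ∈ C q ↔ (((q.out)⁻¹ * h : H) : Aˣ) ∈ Z := Iff.rfl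
    rw [h1, hZK, ← QuotientGroup.eq, QuotientGroup.out_eq']
    exact eq_comm
  rw [eq_top_iff]
  intro g _
  by_contra hg
  have h := isPreconnected_closed_iff.1 hH.isPreconnected (C (1 : H))
    (⋃ q ∈ {q : H ⧸ K | q ≠ ((1 : H) : H ⧸ K)}, C q) (hC _)
    (Set.Finite.isClosed_biUnion (Set.toFinite _) fun q _ => hC q) ?_ ?_ ?_
  · obtain ⟨x, hxH, hx1, hx2⟩ := h
    simp only [Set.mem_iUnion] at hx2
    obtain ⟨q, hq, hx2⟩ := hx2
    have e1 := (hCK ⟨x, hxH⟩ _).1 hx1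
    have e2 := (hCK ⟨x, hxH⟩ _).1 hx2
    exact hq (e2.symm.trans e1)
  · intro x hx
    by_cases hq : ((⟨x, hx⟩ : H) : H ⧸ K) = ((1 : H) : H ⧸ K)
    · exact Or.inl ((hCK ⟨x, hx⟩ _).2 hq)
    · refine Or.inr ?_
      simp only [Set.mem_iUnion]
      exact ⟨_, hq, (hCK ⟨x, hx⟩ _).2 rfl⟩
  · exact ⟨1, H.one_mem, (hCK 1 _).2 rfl⟩
  · refine ⟨g, g.2, ?_⟩
    simp only [Set.mem_iUnion]
    refine ⟨(g : H ⧸ K), fun h => hg ?_, (hCK g _).2 rfl⟩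
    have h' := QuotientGroup.eq.1 h.symm
    simpa using h'

attribute [local instance 100] LieRing.ofAssociativeRing

theorem lieAlg_mono {P G : Subgroup Aˣ} (h : P ≤ G) : lieAlg k P ≤ lieAlg k G :=
  fun _ hx f hf => hx f fun g hg => hf g (h hg)

/-- The tangent vector at `t = 1` of a curve `t ↦ t ^ l a + t ^ m b + t ^ n c` in `P` belongs to the
Lie algebra of `P`. -/
theorem mem_lieAlg_of_curve [Infinite k] (P : Subgroup Aˣ) (a b c : A) (l m n : ℤ)
    (h1 : a + b + c = 1)
    (hP : ∀ t : kˣ, ∃ g ∈ P, (g : A) = ((t ^ l : kˣ) : k) • a + ((t ^ m : kˣ) : k) • b +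
      ((t ^ n : kˣ) : k) • c) :
    (l : k) • a + (m : k) • b + (n : k) • c ∈ lieAlg k P := by
  intro f hf
  let γ : PolyFun k A →ₐ[k] LaurentPolynomial k := MvPolynomial.aeval
    (fun φ : Module.Dual k A => LaurentPolynomial.C (φ a) * LaurentPolynomial.T l +
      LaurentPolynomial.C (φ b) * LaurentPolynomial.T m +
      LaurentPolynomial.C (φ c) * LaurentPolynomial.T n)
  have hγ : ∀ t : kˣ, LaurentPolynomial.eval₂ (RingHom.id k) t (γ f) = 0 := by
    intro t
    obtain ⟨g, hg, hgt⟩ := hP t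
    rw [← hf g hg]
    have h : (LaurentPolynomial.eval₂ (RingHom.id k) t).comp (γ : PolyFun k A →+* _) =
        (PolyFun.evalAt (g : A) : PolyFun k A →ₐ[k] k) := by
      refine MvPolynomial.ringHom_ext (fun r => ?_) fun φ => ?_
      · simp [γ, PolyFun.evalAt, ← LaurentPolynomial.C_eq_algebraMap]
      · simp only [γ, RingHom.comp_apply, RingHom.coe_coe, MvPolynomial.aeval_X, map_add,
          LaurentPolynomial.eval₂_C_mul_T, PolyFun.evalAt_X, hgt, map_smul, RingHom.id_apply,
          smul_eq_mul]
        ring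
    exact RingHom.congr_fun h f
  have hγ0 : γ f = 0 := by
    obtain ⟨N, F, hF⟩ := LaurentPolynomial.exists_T_pow (γ f)
    have hroot : ∀ t : k, t ≠ 0 → F.eval t = 0 := by
      intro t ht
      have h := congrArg (LaurentPolynomial.eval₂ (RingHom.id k) (Units.mk0 t ht)) hF
      rw [map_mul, hγ, zero_mul, LaurentPolynomial.eval₂_toLaurent] at h
      simpa [Polynomial.eval₂_id] using h
    have hF0 : F = 0 := by
      refine Polynomial.eq_zero_of_infinite_isRoot F ?_
      refine Set.Infinite.mono (s := {0}ᶜ) (fun t ht => hroot t ht) ?_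
      exact (Set.finite_singleton (0 : k)).infinite_compl
    rw [hF0, map_zero] at hF
    have hT : IsUnit (LaurentPolynomial.T N : LaurentPolynomial k) := LaurentPolynomial.isUnit_T _
    exact (hT.mul_left_eq_zero.1 hF.symm)
  let ε1 : (k[ε])ˣ :=
    { val := 1 + DualNumber.eps, inv := 1 - DualNumber.eps
      val_inv := by ext <;> simp
      inv_val := by ext <;> simp }
  have hpow : ∀ j : ℕ, ((ε1 ^ j : (k[ε])ˣ) : k[ε]) = 1 + TrivSqZeroExt.inr (j : k) := by
    intro j
    induction j with
    | zero => simp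
    | succ j ih =>
      rw [pow_succ, Units.val_mul, ih]
      ext <;> simp [ε1, add_comm]
  have hzpow : ∀ j : ℤ, ((ε1 ^ j : (k[ε])ˣ) : k[ε]) = 1 + TrivSqZeroExt.inr (j : k) := by
    intro j
    obtain ⟨j, rfl | rfl⟩ := j.eq_nat_or_neg
    · rw [zpow_natCast, hpow]; simp
    · have h : (ε1 ^ (-(j : ℤ)) : (k[ε])ˣ) = (ε1 ^ j)⁻¹ := by rw [zpow_neg, zpow_natCast]
      rw [h]
      refine Units.inv_eq_of_mul_eq_one_right ?_
      rw [hpow]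
      ext <;> simp
  have hd : (LaurentPolynomial.eval₂ (algebraMap k k[ε]) ε1).comp (γ : PolyFun k A →+* _) =
      (PolyFun.evalDual 1 ((l : k) • a + (m : k) • b + (n : k) • c) :
        PolyFun k A →ₐ[k] k[ε]) := by
    refine MvPolynomial.ringHom_ext (fun r => ?_) fun φ => ?_
    · simp [γ, PolyFun.evalDual, ← LaurentPolynomial.C_eq_algebraMap]
    · simp only [γ, RingHom.comp_apply, RingHom.coe_coe, MvPolynomial.aeval_X, map_add,
        LaurentPolynomial.eval₂_C_mul_T, PolyFun.evalDual_X, hzpow, ← h1, map_smul, smul_eq_mul]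
      ext
      · simp [TrivSqZeroExt.algebraMap_eq_inl]
      · simp [TrivSqZeroExt.algebraMap_eq_inl]
        ring
  have h := RingHom.congr_fun hd f
  rw [RingHom.comp_apply, RingHom.coe_coe, hγ0, map_zero] at h
  exact h.symm

/-- The tangent vector `N` of a one-parameter group `t ↦ 1 + t N` in `P`. -/
theorem mem_lieAlg_of_line [Infinite k] (P : Subgroup Aˣ) (N : A)
    (hP : ∀ t : k, ∃ g ∈ P, (g : A) = 1 + t • N) : N ∈ lieAlg k P := by
  have h := mem_lieAlg_of_curve P N (1 - N) 0 1 0 0 (by abel) fun t : kˣ => by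
    obtain ⟨g, hg, hgt⟩ := hP ((t : k) - 1)
    refine ⟨g, hg, ?_⟩
    rw [hgt, sub_smul]
    simp
    abel
  simpa using h

variable (k) in
/-- The restrictions to `H` of polynomial functions. -/
noncomputable def regularFunctions (H : Subgroup Aˣ) : Submodule k (H → k) :=
  LinearMap.range
    (LinearMap.pi fun h : H => (PolyFun.evalAt (k := k) ((h : Aˣ) : A)).toLinearMap)

theorem mem_regularFunctions {H : Subgroup Aˣ} {F : H → k} :
    F ∈ regularFunctions k H ↔
      ∃ f : PolyFun k A, ∀ h : H, PolyFun.evalAt ((h : Aˣ) : A) f = F h := by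
  simp only [regularFunctions, LinearMap.mem_range, funext_iff]
  rfl

end Zariski

/-! ### The Lie–Kolchin theorem -/

section LieKolchin

variable {k V Γ : Type*} [Field k] [AddCommGroup V] [Module k V] [Group Γ]

/-- A group `Γ` with a space `R` of `k`-valued functions is connected if it has no proper subgroup
of finite index that is the zero locus of functions in `R`. -/
def NoClosedFiniteIndex (R : Submodule k (Γ → k)) : Prop :=
  ∀ K : Subgroup Γ, K.FiniteIndex → ∀ S : Set (Γ → k), S ⊆ R →
    (∀ g, g ∈ K ↔ ∀ F ∈ S, F g = 0) → K = ⊤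

/-- All matrix coefficients of the representation `ρ` belong to the space `R` of functions. -/
def HasCoefficientsIn (R : Submodule k (Γ → k)) (ρ : Γ →* Module.End k V) : Prop :=
  ∀ (v : V) (φ : Module.Dual k V), (fun g => φ (ρ g v)) ∈ R

theorem finiteIndex_of_finite_range {X : Type*} (K : Subgroup Γ) (f : Γ → X)
    (hf : (Set.range f).Finite) (h : ∀ g h, f g = f h → g⁻¹ * h ∈ K) : K.FiniteIndex := by
  have := hf.to_subtype
  have : Finite (Γ ⧸ K) := by
    refine Finite.of_injective (fun q : Γ ⧸ K => (⟨f q.out, ⟨_, rfl⟩⟩ : Set.range f)) ?_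
    intro p q hpq
    have h1 := h _ _ (congrArg Subtype.val hpq)
    rw [← QuotientGroup.eq, QuotientGroup.out_eq', QuotientGroup.out_eq'] at h1
    exact h1
  exact Subgroup.finiteIndex_of_finite_quotient

theorem NoClosedFiniteIndex.mem_of_stabilizer {R : Submodule k (Γ → k)}
    (hR : NoClosedFiniteIndex R) {ρ : Γ →* Module.End k V} (hρ : HasCoefficientsIn R ρ)
    (W : Submodule k V) (K : Subgroup Γ) (hK : K.FiniteIndex)
    (h : ∀ g, g ∈ K ↔ ∀ w ∈ W, ρ g w ∈ W) (g : Γ) {w : V} (hw : w ∈ W) : ρ g w ∈ W := by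
  have htop := hR K hK {F | ∃ w ∈ W, ∃ φ : Module.Dual k V, W ≤ LinearMap.ker φ ∧
      F = fun g => φ (ρ g w)} (by rintro _ ⟨w, -, φ, -, rfl⟩; exact hρ w φ) fun g => by
    rw [h]
    constructor
    · rintro hg _ ⟨w, hw, φ, hφ, rfl⟩
      exact hφ (hg w hw)
    · intro hg w hw
      by_contra hn
      obtain ⟨φ, hφ, hle⟩ := Submodule.exists_le_ker_of_notMem hn
      exact hφ (hg _ ⟨w, hw, φ, hle, rfl⟩)
  exact (h g).1 (by rw [htop]; trivial) w hw

theorem NoClosedFiniteIndex.mul_comm_of_centralizer {R : Submodule k (Γ → k)}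
    (hR : NoClosedFiniteIndex R) {ρ : Γ →* Module.End k V} (hρ : HasCoefficientsIn R ρ)
    (m : Module.End k V) (K : Subgroup Γ) (hK : K.FiniteIndex)
    (h : ∀ g, g ∈ K ↔ ρ g * m = m * ρ g) (g : Γ) : ρ g * m = m * ρ g := by
  have htop := hR K hK {F | ∃ (v : V) (φ : Module.Dual k V),
      F = (fun g => φ (ρ g (m v))) - fun g => (φ ∘ₗ m) (ρ g v)}
      (by rintro _ ⟨v, φ, rfl⟩; exact R.sub_mem (hρ _ _) (hρ _ _)) fun g => by
    rw [h]
    constructor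
    · rintro hg _ ⟨v, φ, rfl⟩
      have := LinearMap.congr_fun hg v
      simp only [Module.End.mul_apply] at this
      simp [this]
    · intro hg
      ext v
      refine sub_eq_zero.1 ((Module.forall_dual_apply_eq_zero_iff k _).1 fun φ => ?_)
      have := hg _ ⟨v, φ, rfl⟩
      simpa using this
  exact (h g).1 (by rw [htop]; trivial)

/-- Only finitely many systems of eigenvalues occur for a family of endomorphisms. -/
theorem finite_setOf_joint_eigenvalues {ι U : Type*} [AddCommGroup U] [Module k U]
    [FiniteDimensional k U] (f : ι → Module.End k U) :
    {χ : ι → k | ∃ u, u ≠ 0 ∧ ∀ i, f i u = χ i • u}.Finite := by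
  set E : Set (ι → k) := {χ : ι → k | ∃ u, u ≠ 0 ∧ ∀ i, f i u = χ i • u} with hE
  have hex : ∀ χ : E, ∃ u, u ≠ 0 ∧ ∀ i, f i u = χ.1 i • u := fun χ => χ.2
  choose u hu0 hu using hex
  have hli : LinearIndependent k u := by
    rw [linearIndependent_iff']
    intro s
    induction s using Finset.cons_induction with
    | empty => simp
    | cons χ s hχ ih =>
      intro g hg
      have hs : ∀ ψ ∈ s, g ψ = 0 := by
        intro ψ hψ
        obtain ⟨i, hi⟩ : ∃ i, ψ.1 i ≠ χ.1 i := by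
          by_contra! hall
          have : ψ = χ := Subtype.ext (funext hall)
          exact hχ (this ▸ hψ)
        have h1 := congrArg (f i) hg
        rw [map_zero, map_sum, Finset.sum_cons] at h1
        have h2 := congrArg (fun x => χ.1 i • x) hg
        simp only [smul_zero, Finset.sum_cons, smul_add, Finset.smul_sum] at h2
        have h3 : ∑ ξ ∈ s, (g ξ * (ξ.1 i - χ.1 i)) • u ξ = 0 := by
          have h4 : ∀ ξ ∈ s, (g ξ * (ξ.1 i - χ.1 i)) • u ξ =
              f i (g ξ • u ξ) - χ.1 i • g ξ • u ξ := by
            intro ξ _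
            rw [map_smul, hu]
            module
          rw [Finset.sum_congr rfl h4, Finset.sum_sub_distrib]
          rw [map_smul, hu, smul_comm] at h1
          rw [← sub_eq_zero] at h1
          calc _ = (χ.1 i • g χ • u χ + ∑ x ∈ s, f i (g x • u x) - 0) -
                (χ.1 i • g χ • u χ + ∑ x ∈ s, χ.1 i • g x • u x) := by abel
            _ = 0 := by rw [h1, h2, sub_zero]
        have h5 := ih (fun ξ => g ξ * (ξ.1 i - χ.1 i)) h3 ψ hψ
        exact (mul_eq_zero.1 h5).resolve_right (sub_ne_zero.2 hi)
      intro ψ hψ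
      rcases Finset.mem_cons.1 hψ with rfl | hψ
      · rw [Finset.sum_cons, Finset.sum_eq_zero (fun ξ hξ => by rw [hs ξ hξ, zero_smul]),
          add_zero, smul_eq_zero] at hg
        exact hg.resolve_right (hu0 _)
      · exact hs ψ hψ
  have := hli.finite
  exact Set.toFinite E

/-- Schur's lemma over an algebraically closed field. -/
theorem exists_eq_smul_one_of_commute [IsAlgClosed k] [FiniteDimensional k V] [Nontrivial V]
    (ρ : Γ →* Module.End k V)
    (hirr : ∀ W : Submodule k V, (∀ g, ∀ w ∈ W, ρ g w ∈ W) → W = ⊥ ∨ W = ⊤)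
    (m : Module.End k V) (hm : ∀ g, ρ g * m = m * ρ g) : ∃ c : k, m = c • 1 := by
  obtain ⟨c, hc⟩ := Module.End.exists_eigenvalue m
  refine ⟨c, ?_⟩
  have h := hirr (Module.End.eigenspace m c) fun g w hw => by
    rw [Module.End.mem_eigenspace_iff] at hw ⊢
    rw [← Module.End.mul_apply, ← hm, Module.End.mul_apply, hw, map_smul]
  have htop := h.resolve_left hc
  ext v
  have hv : v ∈ Module.End.eigenspace m c := by rw [htop]; trivial
  simpa using Module.End.mem_eigenspace_iff.1 hv

/-- In an irreducible representation of a connected group, normal subgroups with commutative image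
act by scalars: the group permutes the finitely many weight spaces of such a subgroup. -/
theorem exists_eq_smul_one_of_commutative [IsAlgClosed k] [FiniteDimensional k V] [Nontrivial V]
    {R : Submodule k (Γ → k)} (hR : NoClosedFiniteIndex R) {ρ : Γ →* Module.End k V}
    (hρ : HasCoefficientsIn R ρ)
    (hirr : ∀ W : Submodule k V, (∀ g, ∀ w ∈ W, ρ g w ∈ W) → W = ⊥ ∨ W = ⊤)
    (N : Subgroup Γ) [hN : N.Normal] (hcomm : ∀ a ∈ N, ∀ b ∈ N, ρ a * ρ b = ρ b * ρ a)
    {a : Γ} (ha : a ∈ N) : ∃ c : k, ρ a = c • 1 := by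
  obtain ⟨v, -, hv0, hv⟩ := exists_common_eigenvector (ρ '' (N : Set Γ))
    (by rintro _ ⟨a, ha, rfl⟩ _ ⟨b, hb, rfl⟩; exact hcomm a ha b hb) ⊤ top_ne_bot
    (fun _ _ _ _ => trivial)
  have hv' : ∀ a : Γ, ∃ c : k, a ∈ N → ρ a v = c • v := by
    intro a
    by_cases ha : a ∈ N
    · obtain ⟨c, hc⟩ := hv _ ⟨a, ha, rfl⟩
      exact ⟨c, fun _ => hc⟩
    · exact ⟨0, fun h => absurd h ha⟩
  choose χ hχ using hv'
  have hcj : ∀ g, ∀ a ∈ N, g⁻¹ * a * g ∈ N := fun g a ha => by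
    simpa using hN.conj_mem a ha g⁻¹
  let W : Submodule k V :=
    { carrier := {u | ∀ a ∈ N, ρ a u = χ a • u}
      zero_mem' := fun a _ => by simp
      add_mem' := fun hu hw a ha => by rw [map_add, hu a ha, hw a ha, smul_add]
      smul_mem' := fun c u hu a ha => by rw [map_smul, hu a ha, smul_comm] }
  have hgW : ∀ g, ∀ u ∈ W, ∀ a ∈ N, ρ a (ρ g u) = χ (g⁻¹ * a * g) • ρ g u := by
    intro g u hu a ha
    rw [← map_smul, ← hu _ (hcj g a ha), ← Module.End.mul_apply, ← Module.End.mul_apply, ← map_mul,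
      ← map_mul]
    congr 2
    group
  have hinj : ∀ g u, ρ g u = 0 → u = 0 := by
    intro g u h
    have : ρ g⁻¹ (ρ g u) = u := by
      rw [← Module.End.mul_apply, ← map_mul, inv_mul_cancel, map_one, Module.End.one_apply]
    rw [← this, h, map_zero]
  let K : Subgroup Γ :=
    { carrier := {g | ∀ a ∈ N, χ (g⁻¹ * a * g) = χ a}
      one_mem' := fun a _ => by simp
      mul_mem' := fun {g h} hg hh a ha => by
        rw [← hg a ha, ← hh _ (hcj g a ha)]
        congr 1
        group
      inv_mem' := fun {g} hg a ha => by
        have h1 : g * a * g⁻¹ ∈ N := hN.conj_mem a ha g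
        rw [inv_inv, ← hg _ h1]
        congr 1
        group }
  have hK : K.FiniteIndex := by
    refine finiteIndex_of_finite_range K (fun g => fun a : N => χ (g⁻¹ * a * g)) ?_ ?_
    · refine (finite_setOf_joint_eigenvalues (fun a : N => ρ a)).subset ?_
      rintro _ ⟨g, rfl⟩
      exact ⟨ρ g v, fun h => hv0 (hinj g v h), fun a => hgW g v (fun a ha => hχ a ha) a a.2⟩
    · intro g h hgh a ha
      have h1 : g * a * g⁻¹ ∈ N := hN.conj_mem a ha g
      have h2 := congrFun hgh ⟨_, h1⟩
      simp only at h2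
      rw [show (g⁻¹ * h)⁻¹ * a * (g⁻¹ * h) = h⁻¹ * (g * a * g⁻¹) * h by group, ← h2]
      congr 1
      group
  have hWinv : ∀ g, ∀ w ∈ W, ρ g w ∈ W := by
    intro g w hw
    refine hR.mem_of_stabilizer hρ W K hK (fun g => ⟨fun hg w hw a ha => ?_, fun hg a ha => ?_⟩) g hw
    · rw [hgW g w hw a ha, hg a ha]
    · have h1 := hg v (fun a ha => hχ a ha) a ha
      rw [hgW g v (fun a ha => hχ a ha) a ha] at h1
      exact smul_left_injective k (fun h => hv0 (hinj g v h)) h1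
  have hWtop := (hirr W hWinv).resolve_left
    ((Submodule.ne_bot_iff _).2 ⟨v, fun a ha => hχ a ha, hv0⟩)
  refine ⟨χ a, ?_⟩
  ext u
  have hu : u ∈ W := by rw [hWtop]; trivial
  simpa using hu a ha

/-- In an irreducible representation of a connected group, a normal subgroup acts by scalars if its
commutators do. Modulo scalars its image is finite, as its elements are, modulo scalars,
distinguished by their commutator characters; so the connected group centralizes it. -/
theorem exists_eq_smul_one_of_commutator [IsAlgClosed k] [FiniteDimensional k V] [Nontrivial V]
    {R : Submodule k (Γ → k)} (hR : NoClosedFiniteIndex R) {ρ : Γ →* Module.End k V}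
    (hρ : HasCoefficientsIn R ρ)
    (hirr : ∀ W : Submodule k V, (∀ g, ∀ w ∈ W, ρ g w ∈ W) → W = ⊥ ∨ W = ⊤)
    (M : Subgroup Γ) [hM : M.Normal] (hcomm : ∀ a ∈ M, ∀ b ∈ M, ∃ c : k, ρ ⁅a, b⁆ = c • 1)
    {m : Γ} (hm : m ∈ M) : ∃ c : k, ρ m = c • 1 := by
  have hinv : ∀ g, ρ g * ρ g⁻¹ = 1 := fun g => by rw [← map_mul, mul_inv_cancel, map_one]
  have hinv' : ∀ g, ρ g⁻¹ * ρ g = 1 := fun g => by rw [← map_mul, inv_mul_cancel, map_one]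
  let Z : Subgroup Γ :=
    { carrier := {a | a ∈ M ∧ ∀ b ∈ M, ρ a * ρ b = ρ b * ρ a}
      one_mem' := ⟨M.one_mem, fun b _ => by simp⟩
      mul_mem' := fun {g h} hg hh => ⟨M.mul_mem hg.1 hh.1, fun b hb => by
        rw [map_mul, mul_assoc, hh.2 b hb, ← mul_assoc, hg.2 b hb, mul_assoc]⟩
      inv_mem' := fun {g} hg => ⟨M.inv_mem hg.1, fun b hb => by
        calc ρ g⁻¹ * ρ b = ρ g⁻¹ * (ρ b * ρ g) * ρ g⁻¹ := by
              rw [mul_assoc, mul_assoc, hinv, mul_one]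
          _ = ρ b * ρ g⁻¹ := by rw [← hg.2 b hb, ← mul_assoc, hinv', one_mul]⟩ }
  have hZ : Z.Normal := ⟨fun a ha g => ⟨hM.conj_mem a ha.1 g, fun b hb => by
    have h1 : g⁻¹ * b * g ∈ M := by simpa using hM.conj_mem b hb g⁻¹
    have h2 := ha.2 _ h1
    rw [← map_mul, ← map_mul] at h2 ⊢
    calc ρ (g * a * g⁻¹ * b) = ρ g * ρ (a * (g⁻¹ * b * g)) * ρ g⁻¹ := by
          rw [← map_mul, ← map_mul]; congr 1; group
      _ = ρ (b * (g * a * g⁻¹)) := by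
          rw [h2, ← map_mul, ← map_mul]; congr 1; group⟩⟩
  have hZs : ∀ a ∈ Z, ∃ c : k, ρ a = c • 1 := fun a ha =>
    exists_eq_smul_one_of_commutative hR hρ hirr Z (fun a ha b hb => ha.2 b hb.1) ha
  let K : Subgroup Γ :=
    { carrier := {g | ρ g * ρ m = ρ m * ρ g}
      one_mem' := by simp
      mul_mem' := fun {g h} hg hh => by
        change ρ (g * h) * ρ m = ρ m * ρ (g * h)
        rw [map_mul, mul_assoc, show ρ h * ρ m = ρ m * ρ h from hh, ← mul_assoc,
          show ρ g * ρ m = ρ m * ρ g from hg, mul_assoc]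
      inv_mem' := fun {g} hg => by
        change ρ g⁻¹ * ρ m = ρ m * ρ g⁻¹
        calc ρ g⁻¹ * ρ m = ρ g⁻¹ * (ρ m * ρ g) * ρ g⁻¹ := by
              rw [mul_assoc, mul_assoc, hinv, mul_one]
          _ = ρ m * ρ g⁻¹ := by
              rw [← show ρ g * ρ m = ρ m * ρ g from hg, ← mul_assoc, hinv', one_mul] }
  have hgM : ∀ g, g * m * g⁻¹ ∈ M := fun g => hM.conj_mem m hm g
  -- the conjugates of `ρ m` are eigenvectors of conjugation by `M`
  have hchar : ∀ g, ∃ χ : M → k, ∀ b : M, ρ b * ρ (g * m * g⁻¹) = χ b • (ρ (g * m * g⁻¹) * ρ b) := by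
    intro g
    have : ∀ b : M, ∃ c : k, ρ b * ρ (g * m * g⁻¹) = c • (ρ (g * m * g⁻¹) * ρ b) := by
      intro b
      obtain ⟨c, hc⟩ := hcomm b b.2 _ (hgM g)
      refine ⟨c, ?_⟩
      rw [← one_mul (ρ (g * m * g⁻¹) * ρ b), ← smul_mul_assoc c, ← hc, ← map_mul, ← map_mul, ← map_mul]
      congr 1
      rw [commutatorElement_def]
      group
    choose χ hχ using this
    exact ⟨χ, hχ⟩
  choose χ hχ using hchar
  have hne : ∀ g, ρ g ≠ 0 := fun g h => by
    have := hinv g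
    rw [h, zero_mul] at this
    exact zero_ne_one this
  have hC : (Set.range χ).Finite := by
    refine (finite_setOf_joint_eigenvalues (fun b : M =>
      (LinearMap.mulLeft k (ρ b)) ∘ₗ (LinearMap.mulRight k (ρ (b : Γ)⁻¹)))).subset ?_
    rintro _ ⟨g, rfl⟩
    refine ⟨ρ (g * m * g⁻¹), hne _, fun b => ?_⟩
    rw [LinearMap.comp_apply, LinearMap.mulRight_apply, LinearMap.mulLeft_apply, ← mul_assoc, hχ,
      smul_mul_assoc, mul_assoc, hinv, mul_one]
  have hdet : ∀ g, LinearMap.det (ρ (g * m * g⁻¹)) = LinearMap.det (ρ m) := by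
    intro g
    have h1 : LinearMap.det (ρ g) * LinearMap.det (ρ g⁻¹) = 1 := by
      rw [← map_mul, hinv, map_one]
    rw [map_mul, map_mul, map_mul, map_mul]
    linear_combination LinearMap.det (ρ m) * h1
  have hdet0 : LinearMap.det (ρ m) ≠ 0 := by
    intro h
    have h1 : LinearMap.det (ρ m) * LinearMap.det (ρ m⁻¹) = 1 := by
      rw [← map_mul, hinv, map_one]
    rw [h, zero_mul] at h1
    exact zero_ne_one h1
  have hfib : ∀ c : M → k, {X | ∃ g, χ g = c ∧ ρ (g * m * g⁻¹) = X}.Finite := by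
    intro c
    by_cases hc : ∃ g, χ g = c
    swap
    · refine (Set.finite_empty).subset ?_
      rintro X ⟨g, hg, -⟩
      exact hc ⟨g, hg⟩
    obtain ⟨g₀, hg₀⟩ := hc
    have hroots : {ζ : k | ζ ^ Module.finrank k V = 1}.Finite := by
      classical
      refine ((Polynomial.nthRoots (Module.finrank k V) (1 : k)).toFinset.finite_toSet).subset ?_
      intro ζ hζ
      rw [Finset.mem_coe, Multiset.mem_toFinset, Polynomial.mem_nthRoots Module.finrank_pos]
      exact hζ
    refine (hroots.image (fun ζ => ζ • ρ (g₀ * m * g₀⁻¹))).subset ?_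
    rintro X ⟨g, hg, rfl⟩
    have hz : (g * m * g⁻¹) * (g₀ * m * g₀⁻¹)⁻¹ ∈ Z := by
      refine ⟨M.mul_mem (hgM g) (M.inv_mem (hgM g₀)), fun b hb => ?_⟩
      set x := g * m * g⁻¹ with hx
      set y := g₀ * m * g₀⁻¹ with hy
      have hb1 : ρ b * ρ x = c ⟨b, hb⟩ • (ρ x * ρ b) := by rw [← hg]; exact hχ g ⟨b, hb⟩
      have hb2 : ρ b * ρ y = c ⟨b, hb⟩ • (ρ y * ρ b) := by rw [← hg₀]; exact hχ g₀ ⟨b, hb⟩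
      have hb3 : c ⟨b, hb⟩ • (ρ b * ρ y⁻¹) = ρ y⁻¹ * ρ b := by
        calc c ⟨b, hb⟩ • (ρ b * ρ y⁻¹) = ρ y⁻¹ * (c ⟨b, hb⟩ • (ρ y * ρ b)) * ρ y⁻¹ := by
              rw [mul_smul_comm, smul_mul_assoc, ← mul_assoc, hinv', one_mul]
          _ = ρ y⁻¹ * ρ b := by rw [← hb2, mul_assoc, mul_assoc, hinv, mul_one]
      rw [map_mul, mul_assoc, ← hb3, mul_smul_comm, ← mul_assoc, ← smul_mul_assoc, ← hb1, mul_assoc]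
    obtain ⟨ζ, hζ⟩ := hZs _ hz
    have hX : ρ (g * m * g⁻¹) = ζ • ρ (g₀ * m * g₀⁻¹) := by
      calc ρ (g * m * g⁻¹) = ρ ((g * m * g⁻¹) * (g₀ * m * g₀⁻¹)⁻¹) * ρ (g₀ * m * g₀⁻¹) := by
            rw [← map_mul]; congr 1; group
        _ = _ := by rw [hζ, smul_mul_assoc, one_mul]
    refine ⟨ζ, ?_, hX.symm⟩
    have h1 := congrArg LinearMap.det hX
    rw [LinearMap.det_smul, hdet, hdet] at h1
    exact mul_right_cancel₀ hdet0 (by rw [← h1, one_mul])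
  have hK : K.FiniteIndex := by
    refine finiteIndex_of_finite_range K (fun g => ρ (g * m * g⁻¹)) ?_ ?_
    · refine (hC.biUnion fun c _ => hfib c).subset ?_
      rintro _ ⟨g, rfl⟩
      simp only [Set.mem_iUnion]
      exact ⟨χ g, ⟨g, rfl⟩, g, rfl, rfl⟩
    · intro g h hgh
      change ρ (g⁻¹ * h) * ρ m = ρ m * ρ (g⁻¹ * h)
      calc ρ (g⁻¹ * h) * ρ m = ρ g⁻¹ * ρ (h * m * h⁻¹) * ρ h := by
            rw [← map_mul, ← map_mul, ← map_mul]; congr 1; group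
        _ = ρ m * ρ (g⁻¹ * h) := by
            rw [← hgh, ← map_mul, ← map_mul, ← map_mul]; congr 1; group
  exact exists_eq_smul_one_of_commute ρ hirr (ρ m) fun g =>
    hR.mul_comm_of_centralizer hρ (ρ m) K hK (fun _ => Iff.rfl) g

theorem exists_eq_smul_one_of_isSolvable [IsAlgClosed k] [FiniteDimensional k V] [Nontrivial V]
    [hΓ : Group.IsSolvable Γ] {R : Submodule k (Γ → k)} (hR : NoClosedFiniteIndex R)
    {ρ : Γ →* Module.End k V} (hρ : HasCoefficientsIn R ρ)
    (hirr : ∀ W : Submodule k V, (∀ g, ∀ w ∈ W, ρ g w ∈ W) → W = ⊥ ∨ W = ⊤) (g : Γ) :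
    ∃ c : k, ρ g = c • 1 := by
  obtain ⟨n, hn⟩ := hΓ.solvable
  have hstep : ∀ n, (∀ g ∈ derivedSeries Γ n, ∃ c : k, ρ g = c • 1) →
      ∀ g ∈ derivedSeries Γ 0, ∃ c : k, ρ g = c • 1 := by
    intro n
    induction n with
    | zero => exact fun h => h
    | succ n ih =>
      intro h
      refine ih fun g hg => ?_
      have := derivedSeries_normal Γ n
      refine exists_eq_smul_one_of_commutator hR hρ hirr (derivedSeries Γ n) (fun a ha b hb => ?_) hg
      exact h _ (by rw [derivedSeries_succ]; exact Subgroup.commutator_mem_commutator ha hb)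
  refine hstep n (fun g hg => ?_) g (by simp)
  rw [hn, Subgroup.mem_bot] at hg
  exact ⟨1, by rw [hg, map_one, one_smul]⟩

/-- The restriction of a representation to an invariant subspace. -/
def restrictRep (ρ : Γ →* Module.End k V) (W : Submodule k V) (h : ∀ g, ∀ w ∈ W, ρ g w ∈ W) :
    Γ →* Module.End k W where
  toFun g := (ρ g).restrict (h g)
  map_one' := by ext; simp
  map_mul' g h := by ext; simp

/-- The quotient of a representation by an invariant subspace. -/
def quotientRep (ρ : Γ →* Module.End k V) (W : Submodule k V) (h : ∀ g, ∀ w ∈ W, ρ g w ∈ W) :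
    Γ →* Module.End k (V ⧸ W) where
  toFun g := W.mapQ W (ρ g) (h g)
  map_one' := by ext; simp
  map_mul' g h := by ext; simp

/-- The Lie–Kolchin theorem: a connected solvable group has an eigenvector in every non-zero
invariant subspace. -/
theorem exists_eigenvector_of_isSolvable [IsAlgClosed k] [FiniteDimensional k V]
    [hΓ : Group.IsSolvable Γ] {R : Submodule k (Γ → k)} (hR : NoClosedFiniteIndex R)
    {ρ : Γ →* Module.End k V} (hρ : HasCoefficientsIn R ρ) (X : Submodule k V) (hX : X ≠ ⊥)
    (hstab : ∀ g, ∀ v ∈ X, ρ g v ∈ X) : ∃ v ∈ X, v ≠ 0 ∧ ∀ g, ∃ c : k, ρ g v = c • v := by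
  obtain ⟨Y, hYX, hY⟩ := exists_minimal_le_of_wellFoundedLT
    (fun Y : Submodule k V => Y ≠ ⊥ ∧ ∀ g, ∀ v ∈ Y, ρ g v ∈ Y) X ⟨hX, hstab⟩
  have hY2 := hY.prop.2
  have : Nontrivial Y := Submodule.nontrivial_iff_ne_bot.2 hY.prop.1
  have hco : HasCoefficientsIn R (restrictRep ρ Y hY2) := by
    intro v φ
    obtain ⟨ψ, hψ⟩ := φ.exists_extend
    have := hρ v ψ
    convert this using 2 with g
    rw [← hψ]
    rfl
  have hirr : ∀ W : Submodule k Y, (∀ g, ∀ w ∈ W, restrictRep ρ Y hY2 g w ∈ W) →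
      W = ⊥ ∨ W = ⊤ := by
    intro W hW
    by_cases h0 : W = ⊥
    · exact Or.inl h0
    refine Or.inr ?_
    have hle : Y ≤ W.map Y.subtype := by
      refine hY.le_of_le ⟨?_, ?_⟩ (Submodule.map_subtype_le Y W)
      · refine fun h => h0 ((Submodule.eq_bot_iff W).2 fun w hw => Subtype.ext ?_)
        have hw' : (w : V) ∈ W.map Y.subtype := ⟨w, hw, rfl⟩
        rwa [h] at hw'
      · rintro g _ ⟨w, hw, rfl⟩
        exact ⟨_, hW g w hw, rfl⟩
    rw [eq_top_iff]
    intro y _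
    obtain ⟨w, hw, hwy⟩ := hle y.2
    rwa [← Subtype.ext hwy]
  obtain ⟨v, hvY, hv0⟩ := Submodule.exists_mem_ne_zero_of_ne_bot hY.prop.1
  refine ⟨v, hYX hvY, hv0, fun g => ?_⟩
  obtain ⟨c, hc⟩ := exists_eq_smul_one_of_isSolvable hR hco hirr g
  refine ⟨c, ?_⟩
  have h := congrArg Subtype.val (LinearMap.congr_fun hc ⟨v, hvY⟩)
  simpa [restrictRep] using h

/-- The Lie–Kolchin theorem for a subquotient `X / W`. -/
theorem exists_eigenvector_mod_of_isSolvable [IsAlgClosed k] [FiniteDimensional k V]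
    [hΓ : Group.IsSolvable Γ] {R : Submodule k (Γ → k)} (hR : NoClosedFiniteIndex R)
    {ρ : Γ →* Module.End k V} (hρ : HasCoefficientsIn R ρ) (W X : Submodule k V) (hWX : ¬ X ≤ W)
    (hW : ∀ g, ∀ v ∈ W, ρ g v ∈ W) (hX : ∀ g, ∀ v ∈ X, ρ g v ∈ X) :
    ∃ v ∈ X, v ∉ W ∧ ∀ g, ∃ c : k, ρ g v - c • v ∈ W := by
  have hco : HasCoefficientsIn R (quotientRep ρ W hW) := by
    intro v φ
    obtain ⟨v, rfl⟩ := W.mkQ_surjective v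
    exact hρ v (φ ∘ₗ W.mkQ)
  obtain ⟨v, hvX, hv0, hv⟩ := exists_eigenvector_of_isSolvable hR hco (X.map W.mkQ)
    (by
      intro h
      refine hWX fun x hx => (Submodule.Quotient.mk_eq_zero W).1 ?_
      have : W.mkQ x ∈ X.map W.mkQ := ⟨x, hx, rfl⟩
      rwa [h] at this)
    (by
      rintro g _ ⟨v, hv, rfl⟩
      exact ⟨_, hX g v hv, rfl⟩)
  obtain ⟨u, hu, rfl⟩ := hvX
  refine ⟨u, hu, fun h => hv0 ((Submodule.Quotient.mk_eq_zero W).2 h), fun g => ?_⟩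
  obtain ⟨c, hc⟩ := hv g
  refine ⟨c, ?_⟩
  rw [← Submodule.Quotient.mk_eq_zero, Submodule.Quotient.mk_sub, Submodule.Quotient.mk_smul,
    sub_eq_zero]
  exact hc

end LieKolchin

/-! ### Groups that stabilize a flag -/

section Flags

variable {k V Γ : Type*} [Field k] [AddCommGroup V] [Module k V] [Group Γ]

/-- The subgroup of all `g` that fix every vector of `Y` modulo `X`, for invariant `X`. -/
def fixModSubgroup (ρ : Γ →* Module.End k V) (X Y : Submodule k V)
    (hX : ∀ g, ∀ x ∈ X, ρ g x ∈ X) (hY : ∀ g, ∀ y ∈ Y, ρ g y ∈ Y) : Subgroup Γ where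
  carrier := {g | ∀ y ∈ Y, ρ g y - y ∈ X}
  one_mem' := fun y _ => by simp
  mul_mem' := fun {g h} hg hh y hy => by
    rw [map_mul, Module.End.mul_apply, ← sub_add_sub_cancel _ (ρ h y)]
    exact X.add_mem (hg _ (hY h y hy)) (hh y hy)
  inv_mem' := fun {g} hg y hy => by
    have h1 := hX g⁻¹ _ (hg y hy)
    rw [map_sub, ← Module.End.mul_apply, ← map_mul, inv_mul_cancel, map_one,
      Module.End.one_apply] at h1
    rw [← neg_sub]
    exact X.neg_mem h1

/-- If a term of the derived series acts trivially on `X` and the group acts by scalars on `Y / X`,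
then a later term acts trivially on `Y`. -/
theorem exists_derivedSeries_trivial_step (ρ : Γ →* Module.End k V) (X Y : Submodule k V)
    (hXY : X ≤ Y) (hX : ∀ g, ∀ x ∈ X, ρ g x ∈ X)
    (hs : ∀ g, ∃ c : k, ∀ y ∈ Y, ρ g y - c • y ∈ X)
    (h : ∃ n, ∀ g ∈ derivedSeries Γ n, ∀ x ∈ X, ρ g x = x) :
    ∃ n, ∀ g ∈ derivedSeries Γ n, ∀ y ∈ Y, ρ g y = y := by
  obtain ⟨n, hn⟩ := h
  have hY : ∀ g, ∀ y ∈ Y, ρ g y ∈ Y := by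
    intro g y hy
    obtain ⟨c, hc⟩ := hs g
    rw [← sub_add_cancel (ρ g y) (c • y)]
    exact Y.add_mem (hXY (hc y hy)) (Y.smul_mem c hy)
  have hcomm : ∀ a b : Γ, ∀ y, ρ ⁅a, b⁆ y - y =
      ρ a (ρ b (ρ (a⁻¹ * b⁻¹) y)) - ρ b (ρ a (ρ (a⁻¹ * b⁻¹) y)) := by
    intro a b y
    simp only [← Module.End.mul_apply, ← map_mul]
    rw [show b * (a * (a⁻¹ * b⁻¹)) = 1 by group, map_one, Module.End.one_apply,
      commutatorElement_def]
    congr 3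
    group
  have h1 : derivedSeries Γ 1 ≤ fixModSubgroup ρ X Y hX hY := by
    rw [derivedSeries_succ, Subgroup.commutator_le]
    intro a _ b _ y hy
    rw [hcomm]
    obtain ⟨c, hc⟩ := hs a
    obtain ⟨d, hd⟩ := hs b
    have hu := hY (a⁻¹ * b⁻¹) y hy
    set u := ρ (a⁻¹ * b⁻¹) y
    have e : ρ a (ρ b u) - ρ b (ρ a u) =
        (ρ a (ρ b u) - c • ρ b u) + c • (ρ b u - d • u) - (ρ b (ρ a u) - d • ρ a u) -
          d • (ρ a u - c • u) := by module
    rw [e]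
    exact X.sub_mem (X.sub_mem (X.add_mem (hc _ (hY b u hu)) (X.smul_mem c (hd u hu)))
      (hd _ (hY a u hu))) (X.smul_mem d (hc u hu))
  have hle1 : derivedSeries Γ (n + 1) ≤ derivedSeries Γ 1 := derivedSeries_antitone Γ (by omega)
  have hle2 : derivedSeries Γ (n + 1) ≤ derivedSeries Γ n := derivedSeries_antitone Γ (by omega)
  have h2 : derivedSeries Γ (n + 2) ≤
      fixModSubgroup ρ ⊥ Y (fun g x hx => by
        rw [(Submodule.mem_bot k).1 hx, map_zero]; exact Submodule.zero_mem _) hY := by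
    rw [derivedSeries_succ, Subgroup.commutator_le]
    intro a ha b hb y hy
    rw [hcomm, Submodule.mem_bot]
    have hu := hY (a⁻¹ * b⁻¹) y hy
    set u := ρ (a⁻¹ * b⁻¹) y
    have ea := hn a (hle2 ha) _ (h1 (hle1 hb) u hu)
    have eb := hn b (hle2 hb) _ (h1 (hle1 ha) u hu)
    rw [map_sub] at ea eb
    rw [sub_eq_iff_eq_add.1 ea, sub_eq_iff_eq_add.1 eb]
    abel
  exact ⟨n + 2, fun g hg y hy => sub_eq_zero.1 ((Submodule.mem_bot k).1 (h2 hg y hy))⟩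

theorem isSolvable_of_derivedSeries_trivial (ρ : Γ →* Module.End k V)
    (hker : ∀ g h, ρ g = 1 → ρ h = 1 → g * h = h * g)
    (h : ∃ n, ∀ g ∈ derivedSeries Γ n, ∀ x ∈ (⊤ : Submodule k V), ρ g x = x) :
    Group.IsSolvable Γ := by
  obtain ⟨n, hn⟩ := h
  refine ⟨n + 1, ?_⟩
  rw [derivedSeries_succ, eq_bot_iff, Subgroup.commutator_le]
  have h1 : ∀ g ∈ derivedSeries Γ n, ρ g = 1 := fun g hg => by
    ext v
    exact hn g hg v trivial
  intro a ha b hb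
  rw [Subgroup.mem_bot, commutatorElement_eq_one_iff_mul_comm]
  exact hker a b (h1 a ha) (h1 b hb)

/-- The stabilizer of a family of subspaces. -/
def flagStabilizer [FiniteDimensional k V] {ι : Type*} (ρ : Γ →* Module.End k V)
    (F : ι → Submodule k V) : Subgroup Γ where
  carrier := {g | ∀ i, ∀ v ∈ F i, ρ g v ∈ F i}
  one_mem' := fun i v hv => by simpa using hv
  mul_mem' := fun {g h} hg hh i v hv => by
    rw [map_mul, Module.End.mul_apply]
    exact hg i _ (hh i v hv)
  inv_mem' := fun {g} hg i v hv => by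
    have hinv : ∀ v, ρ g⁻¹ (ρ g v) = v := fun v => by
      rw [← Module.End.mul_apply, ← map_mul, inv_mul_cancel, map_one, Module.End.one_apply]
    have hinj : Function.Injective (ρ g) := Function.LeftInverse.injective hinv
    have hmap : (F i).map (ρ g) = F i := by
      refine Submodule.eq_of_le_of_finrank_eq ?_
        (Submodule.equivMapOfInjective (ρ g) hinj (F i)).finrank_eq.symm
      rintro _ ⟨w, hw, rfl⟩
      exact hg i w hw
    rw [← hmap] at hv
    obtain ⟨w, hw, rfl⟩ := hv
    rw [hinv]
    exact hw

/-- Nested subspaces `W ≤ M` are members of a chain of subspaces that starts at zero, ends at `M`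
and grows by at most one dimension in each step. -/
theorem exists_flag [FiniteDimensional k V] (W M : Submodule k V) (hWM : W ≤ M) :
    ∃ (F : ℕ → Submodule k V) (s : ℕ → V) (a n : ℕ), F 0 = ⊥ ∧
      (∀ i, F (i + 1) = F i ⊔ Submodule.span k {s i}) ∧ F a = W ∧ F n = M ∧ ∀ i, F i ≤ M := by
  let bW := Module.finBasis k W
  let bM := Module.finBasis k M
  set a := Module.finrank k W
  set m := Module.finrank k M
  let s : ℕ → V := fun j => if h : j < a then (bW ⟨j, h⟩ : V) else
    if h : j - a < m then (bM ⟨j - a, h⟩ : V) else 0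
  have hsM : ∀ j, s j ∈ M := by
    intro j
    by_cases h : j < a
    · simp only [s, h, dif_pos]
      exact hWM (bW ⟨j, h⟩).2
    · by_cases h' : j - a < m
      · simp only [s, h, h', dif_pos, dif_neg, not_false_eq_true]
        exact (bM _).2
      · simp only [s, h, h', dif_neg, not_false_eq_true]
        exact M.zero_mem
  have hspan : ∀ {X : Submodule k V} {r : ℕ} (b : Module.Basis (Fin r) k X) (Y : Submodule k V),
      (∀ j, (b j : V) ∈ Y) → X ≤ Y := by
    intro X r b Y h x hx
    have h1 := congrArg X.subtype (b.sum_repr ⟨x, hx⟩)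
    rw [map_sum] at h1
    change _ = x at h1
    rw [← h1]
    exact Y.sum_mem fun j _ => by rw [map_smul]; exact Y.smul_mem _ (h j)
  let F : ℕ → Submodule k V := fun i => Submodule.span k (s '' Set.Iio i)
  have hFM : ∀ i, F i ≤ M := fun i => Submodule.span_le.2 (by rintro _ ⟨j, -, rfl⟩; exact hsM j)
  refine ⟨F, s, a, a + m, by simp [F], fun i => ?_, le_antisymm ?_ ?_, le_antisymm (hFM _) ?_, hFM⟩
  · simp only [F]
    rw [← Submodule.span_union, ← Set.image_singleton, ← Set.image_union]
    congr 2
    ext j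
    simp only [Set.mem_Iio, Set.mem_union, Set.mem_singleton_iff]
    omega
  · refine Submodule.span_le.2 ?_
    rintro _ ⟨j, hj, rfl⟩
    simp only [s, Set.mem_Iio.1 hj, dif_pos]
    exact (bW ⟨j, hj⟩).2
  · refine hspan bW _ fun j => Submodule.subset_span ⟨j, j.2, ?_⟩
    simp [s]
  · refine hspan bM _ fun j => Submodule.subset_span ⟨a + j, ?_, ?_⟩
    · simp
    · simp [s]

theorem monotone_of_flag {F : ℕ → Submodule k V} {s : ℕ → V}
    (hF : ∀ i, F (i + 1) = F i ⊔ Submodule.span k {s i}) : Monotone F :=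
  monotone_nat_of_le_succ fun i => by rw [hF]; exact le_sup_left

/-- A group that stabilizes the members of a flag acts by scalars on its successive quotients. -/
theorem exists_scalar_of_sup_span (f : Module.End k V) {X Y : Submodule k V} {s : V}
    (hY : Y = X ⊔ Submodule.span k {s}) (hX : ∀ x ∈ X, f x ∈ X) (hYs : ∀ y ∈ Y, f y ∈ Y) :
    ∃ c : k, ∀ y ∈ Y, f y - c • y ∈ X := by
  have hs : s ∈ Y := by rw [hY]; exact Submodule.mem_sup_right (Submodule.mem_span_singleton_self s)
  have h1 := hYs s hs
  rw [hY] at h1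
  obtain ⟨x, hx, z, hz, hxz⟩ := Submodule.mem_sup.1 h1
  obtain ⟨c, rfl⟩ := Submodule.mem_span_singleton.1 hz
  refine ⟨c, fun y hy => ?_⟩
  rw [hY] at hy
  obtain ⟨x', hx', z', hz', rfl⟩ := Submodule.mem_sup.1 hy
  obtain ⟨d, rfl⟩ := Submodule.mem_span_singleton.1 hz'
  have e : f (x' + d • s) - c • (x' + d • s) = f x' - c • x' + d • x := by
    rw [map_add, map_smul, ← hxz]
    module
  rw [e]
  exact X.add_mem (X.sub_mem (hX _ hx') (X.smul_mem _ hx')) (X.smul_mem _ hx)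

end Flags

/-! ### Borel subgroups and parabolic subalgebras -/

section Borel

variable {k V A : Type*} [Field k] [AddCommGroup V] [Module k V] [Ring A] [Algebra k A]

attribute [local instance 100] LieRing.ofAssociativeRing

theorem noClosedFiniteIndex_of_isConnected {H : Subgroup Aˣ}
    (hH : @IsConnected Aˣ (zariski k A) (H : Set Aˣ)) :
    NoClosedFiniteIndex (regularFunctions k H) := by
  intro K hK S hS h
  refine eq_top_of_finiteIndex_of_isConnected hH K
    {f : PolyFun k A | ∃ F ∈ S, ∀ h : H, PolyFun.evalAt ((h : Aˣ) : A) f = F h} fun g => ?_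
  rw [h]
  constructor
  · rintro hg f ⟨F, hF, hfF⟩
    rw [hfF, hg F hF]
  · intro hg F hF
    obtain ⟨f, hf⟩ := mem_regularFunctions.1 (hS hF)
    rw [← hf]
    exact hg f ⟨F, hF, hf⟩

theorem HasCoefficientsIn.comp_inclusion {G H : Subgroup Aˣ} (hHG : H ≤ G)
    {ρ : G →* Module.End k V} (hρ : HasCoefficientsIn (regularFunctions k G) ρ) :
    HasCoefficientsIn (regularFunctions k H) (ρ.comp (Subgroup.inclusion hHG)) := by
  intro v φ
  obtain ⟨f, hf⟩ := mem_regularFunctions.1 (hρ v φ)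
  exact mem_regularFunctions.2 ⟨f, fun h => hf (Subgroup.inclusion hHG h)⟩

/-- The stabilizer of a family of subspaces under a representation of `G` with polynomial
coefficients is closed. -/
theorem isClosed_map_flagStabilizer [FiniteDimensional k V] {G : Subgroup Aˣ}
    (hG : @IsClosed Aˣ (zariski k A) (G : Set Aˣ)) {ρ : G →* Module.End k V}
    (hρ : HasCoefficientsIn (regularFunctions k G) ρ) {ι : Type*} (F : ι → Submodule k V) :
    @IsClosed Aˣ (zariski k A) ((flagStabilizer ρ F).map G.subtype : Set Aˣ) := by
  let : TopologicalSpace Aˣ := zariski k A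
  let S : Set (PolyFun k A) := {f | ∃ i, ∃ v ∈ F i, ∃ φ : Module.Dual k V, F i ≤ LinearMap.ker φ ∧
    ∀ g : G, PolyFun.evalAt ((g : Aˣ) : A) f = φ (ρ g v)}
  have h : ((flagStabilizer ρ F).map G.subtype : Set Aˣ) =
      (G : Set Aˣ) ∩ {x : Aˣ | ∀ f ∈ S, PolyFun.evalAt (x : A) f = 0} := by
    ext x
    constructor
    · rintro ⟨g, hg, rfl⟩
      refine ⟨g.2, ?_⟩
      rintro f ⟨i, v, hv, φ, hφ, hf⟩
      exact (hf g).trans (hφ (hg i v hv))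
    · rintro ⟨hxG, hx⟩
      refine ⟨⟨x, hxG⟩, fun i v hv => ?_, rfl⟩
      by_contra hn
      obtain ⟨φ, hφ, hle⟩ := Submodule.exists_le_ker_of_notMem hn
      obtain ⟨f, hf⟩ := mem_regularFunctions.1 (hρ v φ)
      exact hφ ((hf ⟨x, hxG⟩).symm.trans (hx f ⟨i, v, hv, φ, hle, hf⟩))
  rw [h]
  exact hG.inter (isClosed_vanishing_set S)

/-- The Lie–Kolchin theorem for connected solvable subgroups of a group of units. -/
theorem exists_eigenvector_mod_of_isConnected [IsAlgClosed k] [FiniteDimensional k V]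
    {G H : Subgroup Aˣ} (hHG : H ≤ G) (hH : @IsConnected Aˣ (zariski k A) (H : Set Aˣ))
    (hsol : Group.IsSolvable H) {ρ : G →* Module.End k V}
    (hρ : HasCoefficientsIn (regularFunctions k G) ρ) (W X : Submodule k V) (hWX : ¬ X ≤ W)
    (hW : ∀ (g : Aˣ) (hg : g ∈ H), ∀ v ∈ W, ρ ⟨g, hHG hg⟩ v ∈ W)
    (hX : ∀ (g : Aˣ) (hg : g ∈ H), ∀ v ∈ X, ρ ⟨g, hHG hg⟩ v ∈ X) :
    ∃ v ∈ X, v ∉ W ∧ ∀ (g : Aˣ) (hg : g ∈ H), ∃ c : k, ρ ⟨g, hHG hg⟩ v - c • v ∈ W := by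
  obtain ⟨v, hvX, hvW, hv⟩ := exists_eigenvector_mod_of_isSolvable
    (noClosedFiniteIndex_of_isConnected hH) (hρ.comp_inclusion hHG) W X hWX
    (fun g => hW g g.2) (fun g => hX g g.2)
  exact ⟨v, hvX, hvW, fun g hg => hv ⟨g, hg⟩⟩

/-- If `T` is closed and solvable and contains every connected solvable subgroup of `G` that
contains its identity component, then this identity component is a Borel subgroup. -/
theorem isBorel_identityComponent {G T : Subgroup Aˣ} (hTG : T ≤ G)
    (hT : @IsClosed Aˣ (zariski k A) (T : Set Aˣ)) (hsol : Group.IsSolvable T)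
    (hmax : ∀ H ≤ G, @IsConnected Aˣ (zariski k A) (H : Set Aˣ) → Group.IsSolvable H →
      identityComponent k T ≤ H → H ≤ T) : IsBorel k G (identityComponent k T) := by
  refine ⟨⟨(identityComponent_le T).trans hTG, isClosed_identityComponent hT,
    isConnected_identityComponent T, ?_⟩, ?_⟩
  · exact Group.isSolvable_of_isSolvable_injective
      (Subgroup.inclusion_injective (identityComponent_le (k := k) T))
  · rintro H ⟨hHG, -, hconn, hHsol⟩ hle
    let : TopologicalSpace Aˣ := zariski k A
    exact subset_identityComponent hconn.isPreconnected H.one_mem (hmax H hHG hconn hHsol hle)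

/-- The representation `σ` of the Lie algebra of `G` is the differential of the representation `ρ`
of `G`, which has polynomial coefficients. -/
def IsDifferential {G : Subgroup Aˣ} (ρ : G →* Module.End k V)
    (σ : lieAlg k G →ₗ⁅k⁆ Module.End k V) : Prop :=
  ∀ (v : V) (φ : Module.Dual k V), ∃ f : PolyFun k A,
    (∀ g : G, PolyFun.evalAt ((g : Aˣ) : A) f = φ (ρ g v)) ∧
    ∀ x : lieAlg k G, PolyFun.evalDual 1 (x : A) f =
      TrivSqZeroExt.inl (φ v) + TrivSqZeroExt.inr (φ (σ x v))

theorem IsDifferential.hasCoefficientsIn {G : Subgroup Aˣ} {ρ : G →* Module.End k V}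
    {σ : lieAlg k G →ₗ⁅k⁆ Module.End k V} (h : IsDifferential ρ σ) :
    HasCoefficientsIn (regularFunctions k G) ρ := fun v φ => by
  obtain ⟨f, hf, -⟩ := h v φ
  exact mem_regularFunctions.2 ⟨f, hf⟩

theorem IsDifferential.mem_of_mem_lieAlg {G P : Subgroup Aˣ} {ρ : G →* Module.End k V}
    {σ : lieAlg k G →ₗ⁅k⁆ Module.End k V} (h : IsDifferential ρ σ) (hPG : P ≤ G)
    (W : Submodule k V) (hP : ∀ (g : Aˣ) (hg : g ∈ P), ∀ v ∈ W, ρ ⟨g, hPG hg⟩ v ∈ W)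
    (x : lieAlg k G) (hx : (x : A) ∈ lieAlg k P) {v : V} (hv : v ∈ W) : σ x v ∈ W := by
  by_contra hn
  obtain ⟨φ, hφ, hle⟩ := Submodule.exists_le_ker_of_notMem hn
  obtain ⟨f, hf, hfd⟩ := h v φ
  have h1 := hx f fun g hg => (hf ⟨g, hPG hg⟩).trans (hle (hP g hg v hv))
  rw [hfd] at h1
  exact hφ (by simpa using congrArg TrivSqZeroExt.snd h1)

/-- A maximal non-semisimple subalgebra that stabilizes `W` is parabolic if the stabilizer of `W` in
`Lie G` is the Lie algebra of a parabolic subgroup `P` and contains a non-zero nilpotent element of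
the kind that witnesses the presence of an abelian ideal. -/
theorem isParabolicSubalgebra_of_stabilizer {G P : Subgroup Aˣ} (hP : IsParabolic k G P)
    (σ : lieAlg k G →ₗ⁅k⁆ Module.End k V) (hinj : Function.Injective σ)
    (W W' : Submodule k V) (hWW' : W ≤ W')
    (hstab : ∀ x : lieAlg k G, (∀ u ∈ W, σ x u ∈ W) → (x : A) ∈ lieAlg k P)
    (hstab' : ∀ x : lieAlg k G, (x : A) ∈ lieAlg k P → ∀ u ∈ W, σ x u ∈ W)
    (hW' : ∀ x : lieAlg k G, (∀ u ∈ W, σ x u ∈ W) → ∀ u ∈ W', σ x u ∈ W')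
    (y : lieAlg k G) (hy0 : y ≠ 0) (hyW : ∀ u ∈ W, σ y u = 0) (hyW' : ∀ u ∈ W', σ y u ∈ W)
    (hyV : ∀ u, σ y u ∈ W') (h : LieSubalgebra k (lieAlg k G)) (hh : IsMaximalNonSemisimple h)
    (hhW : ∀ x ∈ h, ∀ u ∈ W, σ x u ∈ W) : IsParabolicSubalgebra h := by
  let q : LieSubalgebra k (lieAlg k G) := (lieAlg k P).comap (lieAlg k G).incl
  have hq : ∀ x : lieAlg k G, x ∈ q ↔ (x : A) ∈ lieAlg k P := fun x => Iff.rfl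
  have hyq : y ∈ q := (hq y).2 (hstab y fun u hu => by rw [hyW u hu]; exact W.zero_mem)
  have hnon : ¬ LieAlgebra.HasTrivialRadical k q :=
    not_hasTrivialRadical_of_nilpotent (σ.comp q.incl)
      (hinj.comp Subtype.val_injective) W W' hWW' (fun x => hstab' x ((hq x).1 x.2))
      (fun x => hW' x (hstab' x ((hq x).1 x.2))) ⟨y, hyq⟩
      (fun h => hy0 (congrArg Subtype.val h)) hyW hyW' hyV
  have hle : h ≤ q := fun x hx => hstab x (hhW x hx)
  have heq : h = q := le_antisymm hle (hh.le_of_ge hnon hle)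
  refine ⟨P, hP, ?_⟩
  rw [heq]
  ext x
  constructor
  · rintro ⟨z, hz, rfl⟩
    exact hz
  · intro hx
    exact ⟨⟨x, lieAlg_mono hP.1 hx⟩, hx, rfl⟩

end Borel

/-! ### The special linear group -/

section Flags

variable {k V : Type*} [Field k] [AddCommGroup V] [Module k V]

/-- If `f` preserves `X` and the line spanned by `u` modulo `X`, then it preserves `X + k s` for
every `s` in `X + k u`. -/
theorem mem_of_mem_sup_span (f : Module.End k V) {X : Submodule k V} {u s : V} {c : k}
    (hX : ∀ x ∈ X, f x ∈ X) (hu : f u - c • u ∈ X) (hs : s ∈ X ⊔ Submodule.span k {u}) {y : V}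
    (hy : y ∈ X ⊔ Submodule.span k {s}) : f y ∈ X ⊔ Submodule.span k {s} := by
  obtain ⟨x, hx, z, hz, rfl⟩ := Submodule.mem_sup.1 hs
  obtain ⟨d, rfl⟩ := Submodule.mem_span_singleton.1 hz
  obtain ⟨x', hx', z', hz', rfl⟩ := Submodule.mem_sup.1 hy
  obtain ⟨e, rfl⟩ := Submodule.mem_span_singleton.1 hz'
  have h : f (x' + e • (x + d • u)) =
      (f x' + e • (f x - c • x) + (e * d) • (f u - c • u)) + (e * c) • (x + d • u) := by
    simp only [map_add, map_smul]
    module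
  rw [h]
  exact Submodule.add_mem_sup (X.add_mem (X.add_mem (hX _ hx')
    (X.smul_mem _ (X.sub_mem (hX _ hx) (X.smul_mem _ hx)))) (X.smul_mem _ hu))
    (Submodule.smul_mem _ _ (Submodule.mem_span_singleton_self _))

theorem mem_sup_span_of_mem_sup_span {X : Submodule k V} {u s : V} (hu : u ∉ X)
    (h : u ∈ X ⊔ Submodule.span k {s}) : s ∈ X ⊔ Submodule.span k {u} := by
  obtain ⟨x, hx, z, hz, rfl⟩ := Submodule.mem_sup.1 h
  obtain ⟨d, rfl⟩ := Submodule.mem_span_singleton.1 hz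
  have hd : d ≠ 0 := by
    rintro rfl
    exact hu (by simpa using hx)
  have e : s = -(d⁻¹ • x) + d⁻¹ • (x + d • s) := by
    rw [smul_add, smul_smul, inv_mul_cancel₀ hd, one_smul]
    abel
  rw [e]
  exact Submodule.add_mem_sup (X.neg_mem (X.smul_mem _ hx))
    (Submodule.smul_mem _ _ (by rw [← e]; exact Submodule.mem_span_singleton_self _))

end Flags

section Units

variable {k A : Type*} [Field k] [Ring A] [Algebra k A]

/-- The unit `1 + t N`, for an element `N` of square zero. -/
def oneAddUnit (N : A) (hN : N * N = 0) (t : k) : Aˣ where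
  val := 1 + t • N
  inv := 1 - t • N
  val_inv := by
    rw [add_mul, one_mul, mul_sub, mul_one, smul_mul_smul_comm, hN, smul_zero, sub_zero]
    abel
  inv_val := by
    rw [sub_mul, one_mul, mul_add, mul_one, smul_mul_smul_comm, hN, smul_zero, add_zero]
    abel

end Units

section Tautological

variable {k V : Type*} [Field k] [AddCommGroup V] [Module k V]

attribute [local instance 100] LieRing.ofAssociativeRing

variable (k V) in
/-- The tautological representation of a group of automorphisms of `V`. -/
def tautologicalRep (G : Subgroup (Module.End k V)ˣ) : G →* Module.End k V :=
  (Units.coeHom (Module.End k V)).comp G.subtype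

@[simp]
theorem tautologicalRep_apply (G : Subgroup (Module.End k V)ˣ) (g : G) :
    tautologicalRep k V G g = ((g : (Module.End k V)ˣ) : Module.End k V) := rfl

theorem isDifferential_tautologicalRep (G : Subgroup (Module.End k V)ˣ) :
    IsDifferential (tautologicalRep k V G) (lieAlg k G).incl := by
  intro v φ
  exact ⟨MvPolynomial.X (φ ∘ₗ LinearMap.applyₗ v), fun g => by simp, fun x => by simp⟩

end Tautological

section SpecialLinear

variable {k V : Type*} [Field k] [AddCommGroup V] [Module k V]

attribute [local instance 100] LieRing.ofAssociativeRing

theorem mem_SL_iff (g : (Module.End k V)ˣ) :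
    g ∈ SL k V ↔ LinearMap.det (g : Module.End k V) = 1 := by
  rw [SL, MonoidHom.mem_ker, Units.ext_iff]
  rfl

/-- The determinant is a polynomial function. -/
theorem exists_polyFun_det [FiniteDimensional k V] : ∃ f : PolyFun k (Module.End k V),
    (∀ a, PolyFun.evalAt a f = LinearMap.det a) ∧
    ∀ x, PolyFun.evalDual 1 x f =
      TrivSqZeroExt.inl 1 + TrivSqZeroExt.inr (LinearMap.trace k V x) := by
  let b := Module.finBasis k V
  let M : Matrix (Fin (Module.finrank k V)) (Fin (Module.finrank k V))
      (PolyFun k (Module.End k V)) :=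
    Matrix.of fun i j => MvPolynomial.X (b.coord i ∘ₗ LinearMap.applyₗ (b j))
  refine ⟨M.det, fun a => ?_, fun x => ?_⟩
  · rw [AlgHom.map_det, ← LinearMap.det_toMatrix b]
    congr 1
    ext i j
    simp [M, LinearMap.toMatrix_apply]
  · have h : (PolyFun.evalDual 1 x).mapMatrix M =
        1 + (DualNumber.eps : k[ε]) • (LinearMap.toMatrix b b x).map (algebraMap k k[ε]) := by
      ext i j
      · simp [M, LinearMap.toMatrix_apply, Matrix.one_apply, Finsupp.single_apply, eq_comm,
          TrivSqZeroExt.algebraMap_eq_inl, apply_ite TrivSqZeroExt.fst]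
      · simp [M, LinearMap.toMatrix_apply, Matrix.one_apply,
          TrivSqZeroExt.algebraMap_eq_inl, apply_ite TrivSqZeroExt.snd]
    rw [AlgHom.map_det, h, Matrix.det_one_add_smul]
    have htr : Matrix.trace ((LinearMap.toMatrix b b x).map (algebraMap k k[ε])) =
        algebraMap k k[ε] (LinearMap.trace k V x) := by
      rw [LinearMap.trace_eq_matrix_trace k b, Matrix.trace, Matrix.trace, map_sum]
      rfl
    rw [htr, pow_two, DualNumber.eps_mul_eps, mul_zero, add_zero]
    ext <;> simp [TrivSqZeroExt.algebraMap_eq_inl]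

theorem isClosed_SL [FiniteDimensional k V] :
    @IsClosed (Module.End k V)ˣ (zariski k (Module.End k V)) (SL k V : Set (Module.End k V)ˣ) := by
  obtain ⟨f, hf, -⟩ := exists_polyFun_det (k := k) (V := V)
  convert isClosed_vanishing (f - 1) using 1
  ext g
  rw [SetLike.mem_coe, mem_SL_iff, ← hf]
  simp [sub_eq_zero]

theorem trace_eq_zero_of_mem_lieAlg_SL [FiniteDimensional k V] {x : Module.End k V}
    (hx : x ∈ lieAlg k (SL k V)) : LinearMap.trace k V x = 0 := by
  obtain ⟨f, hf, hfd⟩ := exists_polyFun_det (k := k) (V := V)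
  have h := hx (f - 1) fun g hg => by rw [map_sub, hf, (mem_SL_iff g).1 hg, map_one, sub_self]
  rw [map_sub, hfd, map_one] at h
  simpa using congrArg TrivSqZeroExt.snd h

theorem smulRight_mul_self {φ : Module.Dual k V} {v : V} (h : φ v = 0) :
    (φ.smulRight v : Module.End k V) * φ.smulRight v = 0 := by
  ext u
  simp [h]

theorem det_one_add_smulRight [FiniteDimensional k V] (φ : Module.Dual k V) (v : V) :
    LinearMap.det (1 + φ.smulRight v : Module.End k V) = 1 + φ v :=
  LinearMap.transvection.det φ v

theorem oneAddUnit_smulRight_mem_SL [FiniteDimensional k V] {φ : Module.Dual k V} {v : V}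
    (h : φ v = 0) (t : k) : oneAddUnit (φ.smulRight v) (smulRight_mul_self h) t ∈ SL k V := by
  rw [mem_SL_iff]
  have e : ((oneAddUnit (φ.smulRight v) (smulRight_mul_self h) t : (Module.End k V)ˣ) :
      Module.End k V) = 1 + (t • φ).smulRight v := by
    ext u
    simp [oneAddUnit, smul_smul]
  rw [e, det_one_add_smulRight, LinearMap.smul_apply, h, smul_zero, add_zero]

variable (k V) in
/-- The stabilizer of a subspace in the special linear group. -/
noncomputable def stabSL [FiniteDimensional k V] {ι : Type*} (F : ι → Submodule k V) :
    Subgroup (Module.End k V)ˣ :=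
  (flagStabilizer (tautologicalRep k V (SL k V)) F).map (SL k V).subtype

theorem mem_stabSL [FiniteDimensional k V] {ι : Type*} (F : ι → Submodule k V)
    (g : (Module.End k V)ˣ) :
    g ∈ stabSL k V F ↔ g ∈ SL k V ∧ ∀ i, ∀ v ∈ F i, (g : Module.End k V) v ∈ F i := by
  constructor
  · rintro ⟨g, hg, rfl⟩
    exact ⟨g.2, hg⟩
  · rintro ⟨h1, h2⟩
    exact ⟨⟨g, h1⟩, h2, rfl⟩

/-- The stabilizer of a proper non-zero subspace in `SL(V)` is parabolic: it contains the Borel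
subgroup attached to a full flag through the subspace. -/
theorem isParabolic_stabSL [IsAlgClosed k] [FiniteDimensional k V] (W : Submodule k V) :
    IsParabolic k (SL k V) (stabSL k V fun _ : Unit => W) := by
  have hcoef := (isDifferential_tautologicalRep (SL k V)).hasCoefficientsIn
  obtain ⟨F, s, a, n, hF0, hFs, hFa, hFn, -⟩ := exists_flag W ⊤ le_top
  have hmono := monotone_of_flag hFs
  refine ⟨fun g hg => ((mem_stabSL _ g).1 hg).1, isClosed_map_flagStabilizer isClosed_SL hcoef _,
    identityComponent k (stabSL k V F), ?_, ?_⟩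
  swap
  · refine (identityComponent_le _).trans fun g hg => ?_
    rw [mem_stabSL] at hg ⊢
    refine ⟨hg.1, fun _ => ?_⟩
    rw [← hFa]
    exact hg.2 a
  refine isBorel_identityComponent (fun g hg => ((mem_stabSL _ g).1 hg).1)
    (isClosed_map_flagStabilizer isClosed_SL hcoef _) ?_ ?_
  · refine isSolvable_of_derivedSeries_trivial
      ((Units.coeHom (Module.End k V)).comp (stabSL k V F).subtype) (fun g h hg hh => ?_) ?_
    · have hg' : g = 1 := Subtype.ext (Units.ext hg)
      rw [hg', one_mul, mul_one]
    · have hstep : ∀ i, ∃ n, ∀ g ∈ derivedSeries (stabSL k V F) n, ∀ x ∈ F i,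
          ((Units.coeHom (Module.End k V)).comp (stabSL k V F).subtype) g x = x := by
        intro i
        induction i with
        | zero =>
          refine ⟨0, fun g _ x hx => ?_⟩
          rw [hF0, Submodule.mem_bot] at hx
          rw [hx, map_zero]
        | succ i ih =>
          have hst : ∀ (g : stabSL k V F) j, ∀ x ∈ F j,
              ((Units.coeHom (Module.End k V)).comp (stabSL k V F).subtype) g x ∈ F j :=
            fun g => ((mem_stabSL _ (g : (Module.End k V)ˣ)).1 g.2).2
          exact exists_derivedSeries_trivial_step _ (F i) (F (i + 1)) (hmono i.le_succ)
            (fun g => hst g i)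
            (fun g => exists_scalar_of_sup_span _ (hFs i) (hst g i) (hst g (i + 1))) ih
      have := hstep n
      rwa [hFn] at this
  · intro H hHG hH hsol hle g hg
    refine (mem_stabSL _ g).2 ⟨hHG hg, fun i => ?_⟩
    have key : ∀ i, ∀ g ∈ H, ∀ v ∈ F i, (g : Module.End k V) v ∈ F i := by
      intro i
      induction i with
      | zero =>
        intro g _ v hv
        rw [hF0, Submodule.mem_bot] at hv
        rw [hv, map_zero]
        exact Submodule.zero_mem _
      | succ i ih =>
        by_cases hs : s i ∈ F i
        · have : F (i + 1) = F i := by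
            rw [hFs, sup_eq_left, Submodule.span_singleton_le_iff_mem]
            exact hs
          rwa [this]
        obtain ⟨u, -, hu, hgu⟩ := exists_eigenvector_mod_of_isConnected hHG hH hsol hcoef (F i) ⊤
          (fun h => hs (h trivial)) ih (fun _ _ _ _ => trivial)
        have hsu : s i ∈ F i ⊔ Submodule.span k {u} := by
          by_cases hu1 : u ∈ F (i + 1)
          · rw [hFs] at hu1
            exact mem_sup_span_of_mem_sup_span hu hu1
          -- an element of the Borel subgroup moves `u` by a multiple of `s i`
          obtain ⟨φ, hφu, hφ⟩ := Submodule.exists_le_ker_of_notMem hu1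
          have hsF : s i ∈ F (i + 1) := by
            rw [hFs]
            exact Submodule.mem_sup_right (Submodule.mem_span_singleton_self _)
          have hφs : φ (s i) = 0 := hφ hsF
          have hB : ∀ t : k, oneAddUnit (φ.smulRight (s i)) (smulRight_mul_self hφs) t ∈
              stabSL k V F := by
            intro t
            refine (mem_stabSL _ _).2 ⟨oneAddUnit_smulRight_mem_SL hφs t, fun j v hv => ?_⟩
            have e : ((oneAddUnit (φ.smulRight (s i)) (smulRight_mul_self hφs) t :
                (Module.End k V)ˣ) : Module.End k V) v = v + t • φ v • s i := by
              simp [oneAddUnit]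
            rw [e]
            refine (F j).add_mem hv ((F j).smul_mem _ ?_)
            by_cases hj : j ≤ i + 1
            · rw [show φ v = 0 from hφ (hmono hj hv), zero_smul]
              exact (F j).zero_mem
            · exact (F j).smul_mem _ (hmono (by omega) hsF)
          have hmem := hle (mem_identityComponent_of_line (φ.smulRight (s i)) _
            (fun t => rfl) hB 1)
          obtain ⟨c, hc⟩ := hgu _ hmem
          have e : tautologicalRep k V (SL k V) ⟨_, hHG hmem⟩ u = u + φ u • s i := by
            simp [oneAddUnit]
          rw [e] at hc
          have e2 : s i = (φ u)⁻¹ • (u + φ u • s i - c • u) + ((φ u)⁻¹ * (c - 1)) • u := by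
            have h3 : (φ u)⁻¹ • (u + φ u • s i - c • u) =
                ((φ u)⁻¹ * φ u) • s i + ((φ u)⁻¹ * (1 - c)) • u := by module
            rw [h3, inv_mul_cancel₀ hφu]
            module
          rw [e2]
          exact Submodule.add_mem_sup (Submodule.smul_mem _ _ hc)
            (Submodule.smul_mem _ _ (Submodule.mem_span_singleton_self _))
        intro g hg v hv
        obtain ⟨c, hc⟩ := hgu g hg
        rw [hFs] at hv ⊢
        exact mem_of_mem_sup_span (g : Module.End k V) (ih g hg) hc hsu hv
    exact key i g hg

/-- Operators of rank one that preserve `W` are tangent to its stabilizer in `SL(V)`, up to a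
scalar. -/
theorem smulRight_mem_lieAlg_stabSL [IsAlgClosed k] [FiniteDimensional k V] (W : Submodule k V)
    (hn : (Module.finrank k V : k) ≠ 0) (φ : Module.Dual k V) (v : V)
    (h : ∀ w ∈ W, φ w • v ∈ W) :
    ∃ c : k, φ.smulRight v - c • 1 ∈ lieAlg k (stabSL k V fun _ : Unit => W) := by
  by_cases hφ : φ v = 0
  · refine ⟨0, ?_⟩
    rw [zero_smul, sub_zero]
    refine mem_lieAlg_of_line _ _ fun t =>
      ⟨oneAddUnit (φ.smulRight v) (smulRight_mul_self hφ) t, (mem_stabSL _ _).2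
        ⟨oneAddUnit_smulRight_mem_SL hφ t, fun _ w hw => ?_⟩, rfl⟩
    have e : ((oneAddUnit (φ.smulRight v) (smulRight_mul_self hφ) t :
        (Module.End k V)ˣ) : Module.End k V) w = w + t • φ w • v := by
      simp [oneAddUnit]
    rw [e]
    exact W.add_mem hw (W.smul_mem _ (h w hw))
  -- a torus that acts with weight `n - 1` on `v` and with weight `-1` on the kernel of `φ`
  set n := Module.finrank k V with hn'
  obtain ⟨E, hE⟩ : ∃ E : Module.End k V, E = (φ v)⁻¹ • φ.smulRight v := ⟨_, rfl⟩
  have hEE : E * E = E := by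
    ext u
    simp only [hE, Module.End.mul_apply, LinearMap.smul_apply, LinearMap.smulRight_apply, map_smul,
      smul_smul]
    congr 1
    field_simp
  have hmem : ((n - 1 : ℤ) : k) • E + ((-1 : ℤ) : k) • (1 - E) + ((0 : ℤ) : k) • (0 : Module.End k V) ∈
      lieAlg k (stabSL k V fun _ : Unit => W) := by
    refine mem_lieAlg_of_curve _ E (1 - E) 0 _ _ _ (by abel) fun t => ?_
    have hinv : ∀ x y : k, x * y = 1 → ∀ r : k,
        (x • E + r • (1 - E)) * (y • E) = E := by
      intro x y hxy r
      rw [add_mul, smul_mul_smul_comm, smul_mul_smul_comm, sub_mul, one_mul, hEE, sub_self, smul_zero,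
        add_zero, hxy, one_smul]
    have hinv2 : ∀ x y : k, x * y = 1 → ∀ r : k,
        (r • E + x • (1 - E)) * (y • (1 - E)) = 1 - E := by
      intro x y hxy r
      have h1 : E * (1 - E) = 0 := by rw [mul_sub, mul_one, hEE, sub_self]
      have h2 : (1 - E) * (1 - E) = 1 - E := by rw [sub_mul, one_mul, h1, sub_zero]
      rw [add_mul, smul_mul_smul_comm, smul_mul_smul_comm, h1, h2, smul_zero, zero_add, hxy, one_smul]
    let g : (Module.End k V)ˣ :=
      { val := ((t ^ ((n : ℤ) - 1) : kˣ) : k) • E + ((t ^ (-1 : ℤ) : kˣ) : k) • (1 - E)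
        inv := (((t ^ ((n : ℤ) - 1))⁻¹ : kˣ) : k) • E + (((t ^ (-1 : ℤ))⁻¹ : kˣ) : k) • (1 - E)
        val_inv := by
          rw [mul_add, hinv _ _ (by rw [← Units.val_mul, mul_inv_cancel, Units.val_one]),
            hinv2 _ _ (by rw [← Units.val_mul, mul_inv_cancel, Units.val_one])]
          abel
        inv_val := by
          rw [mul_add, hinv _ _ (by rw [← Units.val_mul, inv_mul_cancel, Units.val_one]),
            hinv2 _ _ (by rw [← Units.val_mul, inv_mul_cancel, Units.val_one])]
          abel }
    have hg : (g : Module.End k V) = ((t⁻¹ : kˣ) : k) •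
        (1 + ((((t : k) ^ n - 1) * (φ v)⁻¹) • φ).smulRight v) := by
      have h1 : ((t ^ ((n : ℤ) - 1) : kˣ) : k) = ((t⁻¹ : kˣ) : k) * (t : k) ^ n := by
        rw [sub_eq_add_neg, zpow_add, zpow_neg_one, zpow_natCast, mul_comm, Units.val_mul,
          Units.val_pow_eq_pow_val]
      change ((t ^ ((n : ℤ) - 1) : kˣ) : k) • E + ((t ^ (-1 : ℤ) : kˣ) : k) • (1 - E) = _
      rw [h1, zpow_neg_one]
      ext u
      simp only [hE, LinearMap.add_apply, LinearMap.smul_apply, LinearMap.sub_apply,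
        Module.End.one_apply, LinearMap.smulRight_apply, smul_eq_mul]
      module
    refine ⟨g, (mem_stabSL _ _).2 ⟨(mem_SL_iff _).2 ?_, fun _ w hw => ?_⟩, ?_⟩
    · rw [hg, LinearMap.det_smul, det_one_add_smulRight, LinearMap.smul_apply, smul_eq_mul, mul_assoc,
        inv_mul_cancel₀ hφ, mul_one, add_sub_cancel, ← mul_pow, ← Units.val_mul, inv_mul_cancel,
        Units.val_one, one_pow]
    · rw [hg]
      simp only [LinearMap.smul_apply, LinearMap.add_apply, Module.End.one_apply,
        LinearMap.smulRight_apply, smul_eq_mul, mul_smul]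
      exact W.smul_mem _ (W.add_mem hw (by
        rw [sub_smul]
        exact W.sub_mem (W.smul_mem _ (W.smul_mem _ (h w hw)))
          (W.smul_mem _ (W.smul_mem _ (h w hw)))))
    · change _ = _ + _ + _ • (0 : Module.End k V)
      rw [smul_zero, add_zero]
  refine ⟨φ v * (n : k)⁻¹, ?_⟩
  have e : φ.smulRight v - (φ v * (n : k)⁻¹) • (1 : Module.End k V) =
      (φ v * (n : k)⁻¹) • (((n - 1 : ℤ) : k) • E + ((-1 : ℤ) : k) • (1 - E) +
        ((0 : ℤ) : k) • (0 : Module.End k V)) := by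
    have h1 : (φ.smulRight v : Module.End k V) = φ v • E := by
      rw [hE, smul_smul, mul_inv_cancel₀ hφ, one_smul]
    have h2 : (φ v * (n : k)⁻¹) • (((n - 1 : ℤ) : k) • E + ((-1 : ℤ) : k) • (1 - E) +
        ((0 : ℤ) : k) • (0 : Module.End k V)) =
        (φ v * ((n : k)⁻¹ * n)) • E - (φ v * (n : k)⁻¹) • (1 : Module.End k V) := by
      push_cast
      module
    rw [h1, h2, inv_mul_cancel₀ hn, mul_one]
  rw [e]
  exact (lieAlg k _).smul_mem _ hmem

/-- An endomorphism that preserves `W` is a sum of operators of rank one that preserve `W`. -/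
theorem exists_eq_sum_smulRight [FiniteDimensional k V] (W : Submodule k V) (x : Module.End k V)
    (hx : ∀ w ∈ W, x w ∈ W) : ∃ (ι : Type) (_ : Fintype ι) (φ : ι → Module.Dual k V) (v : ι → V),
      x = ∑ i, (φ i).smulRight (v i) ∧ ∀ i, ∀ w ∈ W, φ i w • v i ∈ W := by
  obtain ⟨p, hp⟩ := W.subtype.exists_leftInverse_of_injective W.ker_subtype
  have hpW : ∀ w (hw : w ∈ W), p w = ⟨w, hw⟩ := fun w hw => LinearMap.congr_fun hp ⟨w, hw⟩
  let b := Module.finBasis k V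
  let P : Module.End k V := W.subtype ∘ₗ p
  have hPW : ∀ w ∈ W, P w = w := fun w hw => by simp [P, hpW w hw]
  have hPm : ∀ w, P w ∈ W := fun w => (p w).2
  refine ⟨Fin (Module.finrank k V) ⊕ Fin (Module.finrank k V), inferInstance,
    Sum.elim (fun i => b.coord i ∘ₗ x ∘ₗ P) (fun i => b.coord i ∘ₗ (1 - P)),
    Sum.elim (fun i => P (b i)) (fun i => x (b i)), ?_, ?_⟩
  · ext u
    have h1 : ∀ (f : Module.End k V) w, ∑ i, b.coord i w • f (b i) = f w := by
      intro f w
      conv_rhs => rw [← b.sum_repr w]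
      rw [map_sum]
      simp only [map_smul, Module.Basis.coord_apply]
    rw [Fintype.sum_sum_type]
    simp only [Sum.elim_inl, Sum.elim_inr, LinearMap.add_apply, LinearMap.sum_apply,
      LinearMap.smulRight_apply, LinearMap.comp_apply, h1]
    rw [hPW _ (hx _ (hPm u))]
    simp
  · rintro (i | i) w hw
    · exact W.smul_mem _ (hPm _)
    · simp [hPW w hw]

theorem mem_lieAlg_stabSL [IsAlgClosed k] [FiniteDimensional k V] (W : Submodule k V)
    (hn : (Module.finrank k V : k) ≠ 0) {x : Module.End k V} (hx : x ∈ lieAlg k (SL k V))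
    (hxW : ∀ w ∈ W, x w ∈ W) : x ∈ lieAlg k (stabSL k V fun _ : Unit => W) := by
  obtain ⟨ι, _, φ, v, hsum, hW⟩ := exists_eq_sum_smulRight W x hxW
  choose c hc using fun i => smulRight_mem_lieAlg_stabSL W hn (φ i) (v i) (hW i)
  have h1 : x - (∑ i, c i) • 1 ∈ lieAlg k (stabSL k V fun _ : Unit => W) := by
    have e : x - (∑ i, c i) • (1 : Module.End k V) =
        ∑ i, ((φ i).smulRight (v i) - c i • (1 : Module.End k V)) := by
      rw [Finset.sum_sub_distrib, ← Finset.sum_smul, ← hsum]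
    rw [e]
    exact (lieAlg k _).toSubmodule.sum_mem fun i _ => hc i
  have hle : stabSL k V (fun _ : Unit => W) ≤ SL k V := fun g hg => ((mem_stabSL _ g).1 hg).1
  have h2 := trace_eq_zero_of_mem_lieAlg_SL (lieAlg_mono hle h1)
  rw [map_sub, trace_eq_zero_of_mem_lieAlg_SL hx, map_smul, LinearMap.trace_one, zero_sub,
    neg_eq_zero, smul_eq_mul, mul_eq_zero] at h2
  rwa [h2.resolve_right hn, zero_smul, sub_zero] at h1

theorem isParabolicSubalgebra_SL [IsAlgClosed k] [FiniteDimensional k V]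
    (hn : (Module.finrank k V : k) ≠ 0) (h : LieSubalgebra k (lieAlg k (SL k V)))
    (hh : IsMaximalNonSemisimple h) : IsParabolicSubalgebra h := by
  obtain ⟨W, hW0, hW1, hW⟩ := exists_invariant_of_trace_eq_zero hn
    ((lieAlg k (SL k V)).incl.comp h.incl)
    (Subtype.val_injective.comp Subtype.val_injective) hh.prop
    (fun x => trace_eq_zero_of_mem_lieAlg_SL x.1.2)
  have hpar := isParabolic_stabSL W
  obtain ⟨v, hv, hv0⟩ := Submodule.exists_mem_ne_zero_of_ne_bot hW0
  obtain ⟨z, -, hz⟩ := SetLike.exists_of_lt (lt_top_iff_ne_top.2 hW1)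
  obtain ⟨φ, hφz, hφ⟩ := Submodule.exists_le_ker_of_notMem hz
  have hφv : φ v = 0 := hφ hv
  have hy : φ.smulRight v ∈ lieAlg k (SL k V) := mem_lieAlg_of_line _ _ fun t =>
    ⟨_, oneAddUnit_smulRight_mem_SL hφv t, rfl⟩
  refine isParabolicSubalgebra_of_stabilizer hpar (lieAlg k (SL k V)).incl
    Subtype.val_injective W W le_rfl (fun x hx => mem_lieAlg_stabSL W hn x.2 hx)
    (fun x hx u hu => (isDifferential_tautologicalRep (SL k V)).mem_of_mem_lieAlg hpar.1 W
      (fun g hg => ((mem_stabSL _ g).1 hg).2 ()) x hx hu) (fun x hx => hx) ⟨_, hy⟩ ?_ ?_ ?_ ?_ h hh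
    (fun x hx => hW ⟨x, hx⟩)
  · intro h0
    have := LinearMap.congr_fun (congrArg Subtype.val h0) z
    simp [hφz, hv0] at this
  · intro u hu
    have : φ u = 0 := hφ hu
    simp [this]
  · intro u _
    exact W.smul_mem _ hv
  · intro u
    exact W.smul_mem _ hv

end SpecialLinear

/-! ### Isotropic subspaces and isotropic flags -/

section Isotropic

variable {k V Γ : Type*} [Field k] [AddCommGroup V] [Module k V] [Group Γ]
  {B : LinearMap.BilinForm k V} {η : k}

theorem isRefl_of_symm (hs : ∀ u v, B u v = η * B v u) : B.IsRefl := fun u v h => by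
  rw [hs, h, mul_zero]

/-- If `v` is not isotropic for a symmetric form, then every line parallel to `v` contains an
isotropic vector. -/
theorem exists_add_smul_isotropic [IsAlgClosed k] (h2 : (2 : k) ≠ 0) (hs : ∀ u v, B u v = B v u)
    {v : V} (hv : B v v ≠ 0) (u : V) : ∃ c : k, B (u + c • v) (u + c • v) = 0 := by
  have : NeZero (2 : k) := ⟨h2⟩
  obtain ⟨c, hc⟩ := exists_quadratic_eq_zero (a := B v v) (b := 2 * B u v) (c := B u u) hv
    (IsAlgClosed.exists_eq_mul_self _)
  refine ⟨c, ?_⟩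
  simp only [map_add, map_smul, LinearMap.add_apply, LinearMap.smul_apply, smul_eq_mul, hs v u]
  linear_combination hc

/-- An isotropic subspace is contained in an isotropic subspace `M` such that the orthogonal
complement of `M` contains no further isotropic vectors. -/
theorem exists_maximal_isotropic [FiniteDimensional k V] (hs : ∀ u v, B u v = η * B v u)
    (W : Submodule k V) (hW : W ≤ B.orthogonal W) :
    ∃ M, W ≤ M ∧ M ≤ B.orthogonal M ∧ ∀ u ∈ B.orthogonal M, B u u = 0 → u ∈ M := by
  obtain ⟨M, hWM, hM⟩ := exists_maximal_ge_of_wellFoundedGT (fun M => M ≤ B.orthogonal M) W hW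
  refine ⟨M, hWM, hM.prop, fun u hu huu => ?_⟩
  have h : M ⊔ Submodule.span k {u} ≤ B.orthogonal (M ⊔ Submodule.span k {u}) := by
    intro x' hx' y' hy'
    obtain ⟨x, hx, _, hz, rfl⟩ := Submodule.mem_sup.1 hx'
    obtain ⟨c, rfl⟩ := Submodule.mem_span_singleton.1 hz
    obtain ⟨y, hy, _, hz, rfl⟩ := Submodule.mem_sup.1 hy'
    obtain ⟨d, rfl⟩ := Submodule.mem_span_singleton.1 hz
    have h1 : B y x = 0 := hM.prop hx y hy
    have h2 : B y u = 0 := hu y hy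
    have h3 : B u x = 0 := isRefl_of_symm hs _ _ (hu x hx)
    simp [h1, h2, h3, huu]
  exact hM.le_of_ge h le_sup_left (Submodule.mem_sup_right (Submodule.mem_span_singleton_self u))

/-- A maximal isotropic subspace has codimension at most one in its orthogonal complement. -/
theorem exists_orthogonal_eq_sup_span [IsAlgClosed k] (h2 : (2 : k) ≠ 0)
    (hs : ∀ u v, B u v = η * B v u) (hη : η = 1 ∨ η = -1) (M : Submodule k V)
    (hM : M ≤ B.orthogonal M) (hmax : ∀ u ∈ B.orthogonal M, B u u = 0 → u ∈ M) :
    ∃ v, B.orthogonal M = M ⊔ Submodule.span k {v} := by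
  by_cases h : B.orthogonal M ≤ M
  · exact ⟨0, by simpa using le_antisymm h hM⟩
  obtain ⟨v, hv, hvM⟩ := Set.not_subset.1 h
  have hvv : B v v ≠ 0 := fun h0 => hvM (hmax v hv h0)
  have hη1 : η = 1 := hη.resolve_right fun h0 => by
    have h1 := hs v v
    rw [h0, neg_one_mul, eq_neg_iff_add_eq_zero, ← two_mul] at h1
    exact hvv ((mul_eq_zero.1 h1).resolve_left h2)
  refine ⟨v, le_antisymm (fun u hu => ?_) (sup_le hM ?_)⟩
  · obtain ⟨c, hc⟩ := exists_add_smul_isotropic h2 (fun u v => by rw [hs, hη1, one_mul]) hvv u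
    have h1 := hmax _ (Submodule.add_mem _ hu (Submodule.smul_mem _ c hv)) hc
    rw [← add_sub_cancel_right u (c • v), sub_eq_add_neg, ← neg_smul]
    exact Submodule.add_mem_sup h1
      (Submodule.smul_mem _ _ (Submodule.mem_span_singleton_self v))
  · rwa [Submodule.span_singleton_le_iff_mem]

theorem mem_orthogonal_of_isometry (ρ : Γ →* Module.End k V)
    (hiso : ∀ g u v, B (ρ g u) (ρ g v) = B u v) (W : Submodule k V)
    (hW : ∀ g, ∀ w ∈ W, ρ g w ∈ W) (g : Γ) {x : V} (hx : x ∈ B.orthogonal W) :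
    ρ g x ∈ B.orthogonal W := by
  intro y hy
  have h := hx _ (hW g⁻¹ y hy)
  rw [← hiso g, ← Module.End.mul_apply, ← map_mul,
    mul_inv_cancel, map_one, Module.End.one_apply] at h
  exact h

/-- If a group of isometries acts by scalars on `Y / X`, then it acts by scalars on the dual
quotient of the orthogonal complements. -/
theorem exists_scalar_orthogonal (ρ : Γ →* Module.End k V)
    (hiso : ∀ g u v, B (ρ g u) (ρ g v) = B u v) (X Y : Submodule k V)
    (hs : ∀ g, ∃ c : k, ∀ y ∈ Y, ρ g y - c • y ∈ X) (g : Γ) :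
    ∃ c : k, ∀ x ∈ B.orthogonal X, ρ g x - c • x ∈ B.orthogonal Y := by
  obtain ⟨c, hc⟩ := hs g⁻¹
  refine ⟨c, fun x hx y hy => ?_⟩
  have h := hx _ (hc y hy)
  rw [map_sub, LinearMap.sub_apply, ← hiso g,
    ← Module.End.mul_apply, ← map_mul, mul_inv_cancel, map_one, Module.End.one_apply, map_smul,
    LinearMap.smul_apply] at h
  rw [map_sub, map_smul, h]

/-- A group of isometries that stabilizes an isotropic flag ending in a maximal isotropic subspace
is solvable, as soon as the kernel of the action is commutative. -/
theorem isSolvable_of_isotropic_flag (ρ : Γ →* Module.End k V)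
    (hiso : ∀ g u v, B (ρ g u) (ρ g v) = B u v)
    (hker : ∀ g h, ρ g = 1 → ρ h = 1 → g * h = h * g) {F : ℕ → Submodule k V} {s : ℕ → V} {n : ℕ}
    (hF0 : F 0 = ⊥) (hFs : ∀ i, F (i + 1) = F i ⊔ Submodule.span k {s i}) {v : V}
    (hv : B.orthogonal (F n) = F n ⊔ Submodule.span k {v})
    (hst : ∀ g i, ∀ x ∈ F i, ρ g x ∈ F i) : Group.IsSolvable Γ := by
  have hmono := monotone_of_flag hFs
  have hsc : ∀ i g, ∃ c : k, ∀ y ∈ F (i + 1), ρ g y - c • y ∈ F i := fun i g =>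
    exists_scalar_of_sup_span _ (hFs i) (hst g i) (hst g (i + 1))
  have hort : ∀ i g, ∀ x ∈ B.orthogonal (F i), ρ g x ∈ B.orthogonal (F i) := fun i g x hx =>
    mem_orthogonal_of_isometry ρ hiso _ (fun g => hst g i) g hx
  have hstep : ∀ i, ∃ n, ∀ g ∈ derivedSeries Γ n, ∀ x ∈ F i, ρ g x = x := by
    intro i
    induction i with
    | zero =>
      refine ⟨0, fun g _ x hx => ?_⟩
      rw [hF0, Submodule.mem_bot] at hx
      rw [hx, map_zero]
    | succ i ih =>
      exact exists_derivedSeries_trivial_step _ (F i) (F (i + 1)) (hmono i.le_succ)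
        (fun g => hst g i) (hsc i) ih
  have hstep' : ∀ j ≤ n, ∃ m, ∀ g ∈ derivedSeries Γ m, ∀ x ∈ B.orthogonal (F (n - j)),
      ρ g x = x := by
    intro j
    induction j with
    | zero =>
      intro _
      exact exists_derivedSeries_trivial_step _ (F n) _ (by rw [Nat.sub_zero, hv]; exact le_sup_left)
        (fun g => hst g n)
        (fun g => exists_scalar_of_sup_span _ hv (hst g n) (hort n g)) (hstep n)
    | succ j ih =>
      intro hj
      have e : n - j = n - (j + 1) + 1 := by omega
      refine exists_derivedSeries_trivial_step _ (B.orthogonal (F (n - j))) _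
        (B.orthogonal_le (hmono (by omega))) (hort _) (exists_scalar_orthogonal ρ hiso _ _ ?_)
        (ih (by omega))
      rw [e]
      exact hsc _
  obtain ⟨m, hm⟩ := hstep' n le_rfl
  refine isSolvable_of_derivedSeries_trivial ρ hker ⟨m, fun g hg x _ => hm g hg x ?_⟩
  rw [Nat.sub_self, hF0]
  intro y hy
  rw [(Submodule.mem_bot k).1 hy]
  simp

end Isotropic

/-! ### Groups of isometries with enough root subgroups -/

section FormGroup

variable {k V A : Type*} [Field k] [AddCommGroup V] [Module k V] [Ring A] [Algebra k A]

attribute [local instance 100] LieRing.ofAssociativeRing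

/-- What symplectic groups (`η = -1`, `q = 0`) and spin groups (`η = 1`, `q` the quadratic form)
have in common: `ρ` is a representation of `G` by isometries of a non-degenerate form `B` with
differential `σ`, and `m v w`, for `v` and `w` in `V`, is an element of the ambient algebra that
acts on `V` like `u ↦ B w u • v - η * B v u • w`. For orthogonal `v`, `w` with `v` isotropic it
generates a one-parameter unipotent subgroup of `G`, for a hyperbolic pair it is, up to a scalar,
tangent to a torus, and up to scalars these elements span the Lie algebra of `G`. -/
structure IsFormGroup (G : Subgroup Aˣ) (B : LinearMap.BilinForm k V) (η : k) (q : V → k)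
    (ρ : G →* Module.End k V) (σ : lieAlg k G →ₗ⁅k⁆ Module.End k V)
    (m : V →ₗ[k] V →ₗ[k] A) : Prop where
  two_ne_zero : (2 : k) ≠ 0
  isClosed : @IsClosed Aˣ (zariski k A) (G : Set Aˣ)
  isDifferential : IsDifferential ρ σ
  injective : Function.Injective σ
  isometry : ∀ g u v, B (ρ g u) (ρ g v) = B u v
  skew : ∀ x u v, B (σ x u) v + B u (σ x v) = 0
  nondegenerate : B.Nondegenerate
  symm : ∀ u v, B u v = η * B v u
  apply_self : ∀ v, B v v = 2 * q v
  sign : (η = 1 ∧ 3 ≤ Module.finrank k V) ∨ η = -1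
  comm_of_ker : ∀ g h, ρ g = 1 → ρ h = 1 → g * h = h * g
  unipotent : ∀ v w, B v v = 0 → B v w = 0 → ∀ t : k, ∃ g : G, ((g : Aˣ) : A) = 1 + t • m v w ∧
    ∀ u, ρ g u = u + t • (B w u • v - (η * B v u) • w) - (t ^ 2 * q w * B v u) • v
  torus : ∀ v w, B v v = 0 → B w w = 0 → B v w = 1 → ∀ P : Subgroup Aˣ,
    (∀ g : G, (∃ a b : k, ∀ u, ρ g u = u + (a * B w u) • v + (b * B v u) • w) → (g : Aˣ) ∈ P) →
    ∃ c : k, m v w - c • 1 ∈ lieAlg k P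
  differential_apply : ∀ v w (h : m v w ∈ lieAlg k G) u,
    σ ⟨m v w, h⟩ u = B w u • v - (η * B v u) • w
  swap : ∀ v w, ∃ c : k, m v w + η • m w v = c • 1
  expand : ∀ (x : lieAlg k G) {ι : Type} [Fintype ι] (v w : ι → V),
    (∀ u, (2 : k) • σ x u = ∑ i, (B (w i) u • v i - (η * B (v i) u) • w i)) →
    ∃ c : k, (2 : k) • (x : A) = ∑ i, m (v i) (w i) + c • 1
  eq_zero_of_smul_one_mem : ∀ c : k, c • (1 : A) ∈ lieAlg k G → c = 0

omit [Algebra k A] in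
theorem mem_map_flagStabilizer [FiniteDimensional k V] {G : Subgroup Aˣ}
    {ρ : G →* Module.End k V} {ι : Type*} {F : ι → Submodule k V} {g : Aˣ} :
    g ∈ (flagStabilizer ρ F).map G.subtype ↔
      ∃ hg : g ∈ G, ∀ i, ∀ v ∈ F i, ρ ⟨g, hg⟩ v ∈ F i := by
  constructor
  · rintro ⟨g, hg, rfl⟩
    exact ⟨g.2, hg⟩
  · rintro ⟨h1, h2⟩
    exact ⟨⟨g, h1⟩, h2, rfl⟩

namespace IsFormGroup

variable {G : Subgroup Aˣ} {B : LinearMap.BilinForm k V} {η : k} {q : V → k}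
  {ρ : G →* Module.End k V} {σ : lieAlg k G →ₗ⁅k⁆ Module.End k V} {m : V →ₗ[k] V →ₗ[k] A}

theorem sign' (h : IsFormGroup G B η q ρ σ m) : η = 1 ∨ η = -1 := h.sign.imp And.left id

theorem isRefl (h : IsFormGroup G B η q ρ σ m) : B.IsRefl := isRefl_of_symm h.symm

theorem orthogonal_orthogonal [FiniteDimensional k V] (h : IsFormGroup G B η q ρ σ m)
    (W : Submodule k V) : B.orthogonal (B.orthogonal W) = W :=
  LinearMap.BilinForm.orthogonal_orthogonal h.nondegenerate h.isRefl W

theorem quadratic_eq_zero (h : IsFormGroup G B η q ρ σ m) {v : V} (hv : B v v = 0) : q v = 0 := by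
  rw [h.apply_self] at hv
  exact (mul_eq_zero.1 hv).resolve_left h.two_ne_zero

/-- Let `F` be its own orthogonal complement and `X` a hyperplane in `F`. The isotropic vectors of
the orthogonal complement of `X` that are not in `F` span at most one line modulo `X`. -/
theorem exists_sub_smul_mem_of_isotropic (h2 : (2 : k) ≠ 0) {B : LinearMap.BilinForm k V}
    (hsymm : ∀ a b, B a b = B b a) {X F : Submodule k V} {s u : V}
    (hF : F = X ⊔ Submodule.span k {s}) (hFF : F ≤ B.orthogonal F) (hFF' : B.orthogonal F ≤ F)
    (hu : u ∈ B.orthogonal X) (hsu : B s u ≠ 0) :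
    ∃ w, ∀ y ∈ B.orthogonal X, B y y = 0 → y ∉ F → ∃ d : k, d ≠ 0 ∧ y - d • w ∈ X := by
  have hXF : X ≤ F := by rw [hF]; exact le_sup_left
  have hsF : s ∈ F := by
    rw [hF]; exact Submodule.mem_sup_right (Submodule.mem_span_singleton_self _)
  have hss : B s s = 0 := hFF hsF s hsF
  have hXs : ∀ x ∈ X, B x s = 0 := fun x hx => hFF hsF x (hXF hx)
  -- an isotropic vector that pairs non-trivially with `s`
  obtain ⟨w, hw, hww, hsw⟩ : ∃ w ∈ B.orthogonal X, B w w = 0 ∧ B s w ≠ 0 := by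
    refine ⟨u - (B u u * (2 * B s u)⁻¹) • s,
      Submodule.sub_mem _ hu (Submodule.smul_mem _ _ hXs), ?_, ?_⟩
    · simp only [map_sub, map_smul, LinearMap.sub_apply, LinearMap.smul_apply, smul_eq_mul, hss,
        hsymm u s]
      field_simp
      ring
    · simpa [hss] using hsu
  refine ⟨w, fun y hy hyy hyF => ?_⟩
  obtain ⟨c, hc⟩ : ∃ c, B s y = c * B s w := ⟨B s y * (B s w)⁻¹, by field_simp⟩
  have hmem : y - c • w ∈ B.orthogonal F := by
    intro z' hz'
    rw [hF] at hz'
    obtain ⟨x, hx, z, hz, rfl⟩ := Submodule.mem_sup.1 hz'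
    obtain ⟨d, rfl⟩ := Submodule.mem_span_singleton.1 hz
    have h1 : B x y = 0 := hy x hx
    have h2 : B x w = 0 := hw x hx
    simp [h1, h2, hc]
  replace hmem := hFF' hmem
  have hc0 : c ≠ 0 := by
    rintro rfl
    rw [zero_smul, sub_zero] at hmem
    exact hyF hmem
  rw [hF] at hmem
  obtain ⟨x, hx, z, hz, hxz⟩ := Submodule.mem_sup.1 hmem
  obtain ⟨d, rfl⟩ := Submodule.mem_span_singleton.1 hz
  have hy' : y = x + d • s + c • w := by rw [hxz]; abel
  have h1 : B x s = 0 := hXs x hx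
  have h3 : B x w = 0 := hw x hx
  have h4 : B x x = 0 := hFF (hXF hx) x (hXF hx)
  rw [hy'] at hyy
  simp only [map_add, map_smul, LinearMap.add_apply, LinearMap.smul_apply, smul_eq_mul, hsymm s x,
    hsymm w x, hsymm w s, h1, h3, h4, hss, hww] at hyy
  have hd : d = 0 := by
    have h5 : 2 * (c * B s w) * d = 0 := by linear_combination hyy
    exact (mul_eq_zero.1 h5).resolve_left (mul_ne_zero h2 (mul_ne_zero hc0 hsw))
  refine ⟨c, hc0, ?_⟩
  rw [hy', hd, zero_smul, add_zero, add_sub_cancel_right]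
  exact hx

/-- If `F` is its own orthogonal complement and contains the subspace `X` as a hyperplane, then the
connected isometry groups that stabilize `X` also stabilize `F`: apart from `F` there is at most one
subspace with these properties. -/
theorem mem_of_selfdual [FiniteDimensional k V] (h : IsFormGroup G B η q ρ σ m) (hη : η = 1)
    {H : Subgroup Aˣ} (hHG : H ≤ G) (hH : @IsConnected Aˣ (zariski k A) (H : Set Aˣ))
    {X F : Submodule k V} {s u : V} (hF : F = X ⊔ Submodule.span k {s})
    (hFF : F ≤ B.orthogonal F) (hFF' : B.orthogonal F ≤ F)
    (hu : u ∈ B.orthogonal X) (hsu : B s u ≠ 0)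
    (hX : ∀ (g : Aˣ) (hg : g ∈ H), ∀ v ∈ X, ρ ⟨g, hHG hg⟩ v ∈ X)
    (g : Aˣ) (hg : g ∈ H) {v : V} (hv : v ∈ F) : ρ ⟨g, hHG hg⟩ v ∈ F := by
  obtain ⟨w, key⟩ := exists_sub_smul_mem_of_isotropic h.two_ne_zero
    (fun a b => by rw [h.symm, hη, one_mul]) hF hFF hFF' hu hsu
  have hXF : X ≤ F := by rw [hF]; exact le_sup_left
  have hsF : s ∈ F := by
    rw [hF]; exact Submodule.mem_sup_right (Submodule.mem_span_singleton_self _)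
  have hss : B s s = 0 := hFF hsF s hsF
  have hsXo : s ∈ B.orthogonal X := fun x hx => hFF hsF x (hXF hx)
  let ρ' := ρ.comp (Subgroup.inclusion hHG)
  have hX' : ∀ g, ∀ x ∈ X, ρ' g x ∈ X := fun g => hX g g.2
  have hmem : ∀ g : H, g ∈ flagStabilizer ρ' (fun _ : Unit => F) ↔ ∀ v ∈ F, ρ' g v ∈ F :=
    fun g => ⟨fun h => h (), fun h _ => h⟩
  have hmem_s : ∀ g : H, g ∈ flagStabilizer ρ' (fun _ : Unit => F) ↔ ρ' g s ∈ F := by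
    refine fun g => (hmem g).trans ⟨fun h1 => h1 s hsF, fun h1 v hv => ?_⟩
    rw [hF] at hv
    obtain ⟨x, hx, z, hz, rfl⟩ := Submodule.mem_sup.1 hv
    obtain ⟨d, rfl⟩ := Submodule.mem_span_singleton.1 hz
    rw [map_add, map_smul]
    exact F.add_mem (hXF (hX' g x hx)) (F.smul_mem d h1)
  have hcancel : ∀ (g : H) v, ρ' g⁻¹ (ρ' g v) = v := fun g v => by
    rw [← Module.End.mul_apply, ← map_mul, inv_mul_cancel, map_one, Module.End.one_apply]
  refine (noClosedFiniteIndex_of_isConnected hH).mem_of_stabilizer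
    (h.isDifferential.hasCoefficientsIn.comp_inclusion hHG) F
    (flagStabilizer ρ' (fun _ : Unit => F))
    (finiteIndex_of_finite_range _ (fun g => ρ' g s ∈ F) (Set.toFinite _) ?_) hmem ⟨g, hg⟩ hv
  intro a b hab
  by_cases ha : ρ' a s ∈ F
  · exact Subgroup.mul_mem _ (Subgroup.inv_mem _ ((hmem_s a).2 ha))
      ((hmem_s b).2 ((iff_of_eq hab).1 ha))
  have hb : ρ' b s ∉ F := fun h1 => ha ((iff_of_eq hab).2 h1)
  have hiso : ∀ g u v, B (ρ' g u) (ρ' g v) = B u v := fun g => h.isometry _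
  have hk : ∀ g, ρ' g s ∉ F → ∃ d : k, d ≠ 0 ∧ ρ' g s - d • w ∈ X := fun g hg =>
    key _ (mem_orthogonal_of_isometry ρ' hiso X hX' g hsXo) (by rw [hiso, hss]) hg
  obtain ⟨c, hc, hac⟩ := hk a ha
  obtain ⟨d, hd, hbd⟩ := hk b hb
  rw [hmem_s, map_mul, Module.End.mul_apply]
  have e : ρ' a⁻¹ (ρ' b s) =
      ρ' a⁻¹ ((ρ' b s - d • w) - (d * c⁻¹) • (ρ' a s - c • w)) + (d * c⁻¹) • s := by
    rw [← hcancel a s]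
    simp only [map_sub, map_smul, hcancel, smul_sub, smul_smul]
    rw [mul_assoc, inv_mul_cancel₀ hc, mul_one]
    abel
  rw [e]
  exact F.add_mem (hXF (hX' _ _ (X.sub_mem hbd (X.smul_mem _ hac)))) (F.smul_mem _ hsF)

/-- Connected solvable groups that contain the Borel subgroup attached to an isotropic flag
stabilize the flag. -/
theorem le_stabilizer_flag [IsAlgClosed k] [FiniteDimensional k V]
    (h : IsFormGroup G B η q ρ σ m) {F : ℕ → Submodule k V} {s : ℕ → V} {M : Submodule k V}
    (hM : M ≤ B.orthogonal M) (hF0 : F 0 = ⊥)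
    (hFs : ∀ i, F (i + 1) = F i ⊔ Submodule.span k {s i}) (hFM : ∀ i, F i ≤ M)
    {H : Subgroup Aˣ} (hHG : H ≤ G) (hH : @IsConnected Aˣ (zariski k A) (H : Set Aˣ))
    (hsol : Group.IsSolvable H)
    (hle : identityComponent k ((flagStabilizer ρ F).map G.subtype) ≤ H) (i : ℕ) :
    ∀ (g : Aˣ) (hg : g ∈ H), ∀ v ∈ F i, ρ ⟨g, hHG hg⟩ v ∈ F i := by
  have hcoef := h.isDifferential.hasCoefficientsIn
  have hmono := monotone_of_flag hFs
  induction i with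
  | zero =>
    intro g _ v hv
    rw [hF0, Submodule.mem_bot] at hv
    rw [hv, map_zero]
    exact Submodule.zero_mem _
  | succ i ih =>
    by_cases hs : s i ∈ F i
    · have : F (i + 1) = F i := by
        rw [hFs, sup_eq_left, Submodule.span_singleton_le_iff_mem]
        exact hs
      rwa [this]
    have hsF : s i ∈ F (i + 1) := by
      rw [hFs]
      exact Submodule.mem_sup_right (Submodule.mem_span_singleton_self _)
    have hiso : ∀ i, ∀ x ∈ F i, ∀ j, ∀ y ∈ F j, B x y = 0 := fun i x hx j y hy =>
      hM (hFM j hy) x (hFM i hx)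
    have hso : s i ∈ B.orthogonal (F i) := fun x hx => hiso i x hx (i + 1) _ hsF
    have hort : ∀ (g : Aˣ) (hg : g ∈ H), ∀ v ∈ B.orthogonal (F i),
        ρ ⟨g, hHG hg⟩ v ∈ B.orthogonal (F i) := fun g hg v hv =>
      mem_orthogonal_of_isometry (ρ.comp (Subgroup.inclusion hHG)) (fun g => h.isometry _) (F i)
        (fun g => ih g g.2) ⟨g, hg⟩ hv
    obtain ⟨u, huo, hu, hgu⟩ := exists_eigenvector_mod_of_isConnected hHG hH hsol hcoef (F i)
      (B.orthogonal (F i)) (fun h => hs (h hso)) ih hort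
    have hstable : s i ∈ F i ⊔ Submodule.span k {u} →
        ∀ (g : Aˣ) (hg : g ∈ H), ∀ v ∈ F (i + 1), ρ ⟨g, hHG hg⟩ v ∈ F (i + 1) := by
      intro hsu g hg v hv
      obtain ⟨c, hc⟩ := hgu g hg
      rw [hFs] at hv ⊢
      exact mem_of_mem_sup_span _ (ih g hg) hc hsu hv
    by_cases hsu : s i ∈ F i ⊔ Submodule.span k {u}
    · exact hstable hsu
    -- the root subgroups in the Borel subgroup that move `u` in the direction of `s i`
    have hmove : ∀ w ∈ B.orthogonal (F (i + 1)),
        (B w u - q w * B (s i) u) • s i - (η * B (s i) u) • w ∈ F i ⊔ Submodule.span k {u} := by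
      intro w hw
      have hsw : B (s i) w = 0 := hw _ hsF
      choose g hgA hgρ using h.unipotent (s i) w (hiso _ _ hsF _ _ hsF) hsw
      have hT : ∀ t, (g t : Aˣ) ∈ (flagStabilizer ρ F).map G.subtype := by
        refine fun t => ⟨g t, fun j x hx => ?_, rfl⟩
        rw [hgρ, hiso _ _ hsF _ _ hx, mul_zero, mul_zero, zero_smul, zero_smul, sub_zero, sub_zero]
        refine (F j).add_mem hx ((F j).smul_mem _ ?_)
        by_cases hj : j ≤ i + 1
        · rw [h.isRefl _ _ (hw x (hmono hj hx)), zero_smul]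
          exact (F j).zero_mem
        · exact (F j).smul_mem _ (hmono (by omega) hsF)
      have hmem := hle (mem_identityComponent_of_line (m (s i) w) (fun t => (g t : Aˣ)) hgA hT 1)
      obtain ⟨c, hc⟩ := hgu _ hmem
      have e : ρ ⟨(g 1 : Aˣ), hHG hmem⟩ u = u + (1 : k) • (B w u • s i - (η * B (s i) u) • w) -
        ((1 : k) ^ 2 * q w * B (s i) u) • s i := hgρ 1 u
      rw [e] at hc
      have e2 : (B w u - q w * B (s i) u) • s i - (η * B (s i) u) • w =
          (u + (1 : k) • (B w u • s i - (η * B (s i) u) • w) -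
          ((1 : k) ^ 2 * q w * B (s i) u) • s i - c • u) + (c - 1) • u := by
        rw [one_pow]
        module
      rw [e2]
      exact Submodule.add_mem_sup hc (Submodule.smul_mem _ _ (Submodule.mem_span_singleton_self _))
    by_cases hB : B (s i) u = 0
    · have h1 : u ∈ B.orthogonal (B.orthogonal (F (i + 1))) := by
        intro w hw
        by_contra hne
        refine hsu ?_
        have h1 := hmove w hw
        rw [hB, mul_zero, mul_zero, zero_smul, sub_zero, sub_zero] at h1
        have h2 := Submodule.smul_mem _ (B w u)⁻¹ h1
        rwa [smul_smul, inv_mul_cancel₀ hne, one_smul] at h2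
      rw [h.orthogonal_orthogonal, hFs] at h1
      exact hstable (mem_sup_span_of_mem_sup_span hu h1)
    have hmove' : ∀ w ∈ B.orthogonal (F (i + 1)),
        (B w u - q w * B (s i) u) • s i - (η * B (s i) u) • w ∈ F i := by
      intro w hw
      obtain ⟨x, hx, z, hz, hxz⟩ := Submodule.mem_sup.1 (hmove w hw)
      obtain ⟨d, rfl⟩ := Submodule.mem_span_singleton.1 hz
      have h1 := congrArg (B (s i)) hxz
      have h2 : B (s i) w = 0 := hw _ hsF
      simp only [map_add, map_sub, map_smul, hiso _ _ hsF _ _ hsF, hiso _ _ hsF _ _ hx, h2,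
        smul_eq_mul, mul_zero, sub_zero, zero_add] at h1
      rw [← hxz, (mul_eq_zero.1 h1).resolve_right hB, zero_smul, add_zero]
      exact hx
    rcases h.sign' with hη | hη
    · refine fun g hg v hv => h.mem_of_selfdual hη hHG hH (hFs i)
        (fun x hx y hy => hiso _ _ hy _ _ hx) (fun w hw => ?_) huo hB ih g hg hv
      have h1 := hmove' w hw
      have e : w = -((B (s i) u)⁻¹ • ((B w u - q w * B (s i) u) • s i - (η * B (s i) u) • w)) +
          ((B (s i) u)⁻¹ * (B w u - q w * B (s i) u)) • s i := by
        rw [hη, one_mul, smul_sub, smul_smul, smul_smul, inv_mul_cancel₀ hB, one_smul]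
        abel
      rw [e, hFs]
      exact Submodule.add_mem_sup (Submodule.neg_mem _ (Submodule.smul_mem _ _ h1))
        (Submodule.smul_mem _ _ (Submodule.mem_span_singleton_self _))
    · exfalso
      have h1 := hmove' (s i) (fun x hx => hiso _ _ hx _ _ hsF)
      rw [h.quadratic_eq_zero (hiso _ _ hsF _ _ hsF), hη] at h1
      have e : s i = (2 * B (s i) u)⁻¹ •
          ((B (s i) u - 0 * B (s i) u) • s i - (-1 * B (s i) u) • s i) := by
        rw [← sub_smul, smul_smul, zero_mul, sub_zero, neg_one_mul, sub_neg_eq_add, ← two_mul,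
          inv_mul_cancel₀ (mul_ne_zero h.two_ne_zero hB), one_smul]
      rw [e] at hs
      exact hs (Submodule.smul_mem _ _ h1)

/-- The stabilizer of an isotropic subspace is parabolic. -/
theorem isParabolic_stabilizer [IsAlgClosed k] [FiniteDimensional k V]
    (h : IsFormGroup G B η q ρ σ m) (W : Submodule k V) (hW : W ≤ B.orthogonal W) :
    IsParabolic k G ((flagStabilizer ρ fun _ : Unit => W).map G.subtype) := by
  have hcoef := h.isDifferential.hasCoefficientsIn
  obtain ⟨M, hWM, hM, hmax⟩ := exists_maximal_isotropic h.symm W hW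
  obtain ⟨v, hv⟩ := exists_orthogonal_eq_sup_span h.two_ne_zero h.symm h.sign' M hM hmax
  obtain ⟨F, s, a, n, hF0, hFs, hFa, hFn, hFM⟩ := exists_flag W M hWM
  have hle : ∀ {ι : Type} (F : ι → Submodule k V), (flagStabilizer ρ F).map G.subtype ≤ G :=
    fun F => Subgroup.map_subtype_le _
  refine ⟨hle _, isClosed_map_flagStabilizer h.isClosed hcoef _,
    identityComponent k ((flagStabilizer ρ F).map G.subtype), ?_, ?_⟩
  · refine isBorel_identityComponent (hle _) (isClosed_map_flagStabilizer h.isClosed hcoef _) ?_ ?_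
    · refine isSolvable_of_isotropic_flag (ρ.comp (Subgroup.inclusion (hle F)))
        (fun g => h.isometry _) (fun a b ha hb => ?_) hF0 hFs (by rw [hFn, hv]) (fun g => ?_)
      · exact Subgroup.inclusion_injective (hle F) (by simpa using h.comm_of_ker _ _ ha hb)
      · exact (mem_map_flagStabilizer.1 g.2).2
    · intro H hHG hH hsol hle' g hg
      exact mem_map_flagStabilizer.2
        ⟨hHG hg, fun i => h.le_stabilizer_flag hM hF0 hFs hFM hHG hH hsol hle' i g hg⟩
  · refine (identityComponent_le _).trans fun g hg => ?_
    rw [mem_map_flagStabilizer] at hg ⊢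
    obtain ⟨hg, hF⟩ := hg
    refine ⟨hg, fun _ => ?_⟩
    rw [← hFa]
    exact hF a

end IsFormGroup

end FormGroup

section FormGroup

variable {k V A : Type*} [Field k] [AddCommGroup V] [Module k V] [Ring A] [Algebra k A]

attribute [local instance 100] LieRing.ofAssociativeRing

namespace IsFormGroup

variable {G : Subgroup Aˣ} {B : LinearMap.BilinForm k V} {η : k} {q : V → k}
  {ρ : G →* Module.End k V} {σ : lieAlg k G →ₗ⁅k⁆ Module.End k V} {m : V →ₗ[k] V →ₗ[k] A}

theorem mem_lieAlg_of_stabilizes_line [FiniteDimensional k V] [Infinite k]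
    (h : IsFormGroup G B η q ρ σ m) {W : Submodule k V} {v w : V} (hvv : B v v = 0)
    (hvw : B v w = 0) (hW : ∀ u ∈ W, B v u = 0 ∧ B w u • v ∈ W) :
    m v w ∈ lieAlg k ((flagStabilizer ρ fun _ : Unit => W).map G.subtype) := by
  refine mem_lieAlg_of_line _ _ fun t => ?_
  obtain ⟨g, hg, hgρ⟩ := h.unipotent v w hvv hvw t
  refine ⟨g, ⟨g, fun _ u hu => ?_, rfl⟩, hg⟩
  obtain ⟨h1, h2⟩ := hW u hu
  rw [hgρ, h1, mul_zero, mul_zero, zero_smul, zero_smul, sub_zero, sub_zero]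
  exact W.add_mem hu (W.smul_mem t h2)

/-- The elements `m v w` with `v` isotropic that stabilize `W` for the reason that `B v` vanishes on
`W` are tangent to the stabilizer of `W`, up to scalars. -/
theorem mem_sup_of_isotropic [FiniteDimensional k V] [Infinite k]
    (h : IsFormGroup G B η q ρ σ m) {W : Submodule k V} {v w : V} (hvv : B v v = 0)
    (hW : ∀ u ∈ W, B v u = 0 ∧ B w u • v ∈ W) :
    m v w ∈ (lieAlg k ((flagStabilizer ρ fun _ : Unit => W).map G.subtype)).toSubmodule ⊔
      Submodule.span k {1} := by
  by_cases hvw : B v w = 0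
  · exact Submodule.mem_sup_left (h.mem_lieAlg_of_stabilizes_line hvv hvw hW)
  have hvv' : m v v ∈ (lieAlg k ((flagStabilizer ρ fun _ : Unit => W).map
      G.subtype)).toSubmodule ⊔ Submodule.span k {1} := by
    refine Submodule.mem_sup_left (h.mem_lieAlg_of_stabilizes_line hvv hvv fun u hu => ?_)
    rw [(hW u hu).1, zero_smul]
    exact ⟨rfl, W.zero_mem⟩
  -- `w` is a combination of `v` and of `z`, where `v`, `z` is a hyperbolic pair
  obtain ⟨c, d, z, hc, hw, hzz, hvz⟩ : ∃ (c d : k) (z : V), c ≠ 0 ∧ w = c • z + d • v ∧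
      B z z = 0 ∧ B v z = 1 := by
    have h2 := h.two_ne_zero
    have hwv := h.symm w v
    refine ⟨B v w, B w w * (2 * B v w)⁻¹,
      (B v w)⁻¹ • (w - (B w w * (2 * B v w)⁻¹) • v), hvw, ?_, ?_, ?_⟩
    · rw [smul_smul, mul_inv_cancel₀ hvw, one_smul, sub_add_cancel]
    · rcases h.sign' with hη | hη
      · simp only [map_sub, map_smul, LinearMap.sub_apply, LinearMap.smul_apply, smul_eq_mul, hvv,
          hwv, hη, one_mul]
        field_simp
        ring
      · have hww : B w w = 0 := by
          have h1 := h.symm w w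
          rw [hη, neg_one_mul, eq_neg_iff_add_eq_zero, ← two_mul] at h1
          exact (mul_eq_zero.1 h1).resolve_left h2
        simp [hww]
    · simp [hvv, hvw]
  obtain ⟨e, he⟩ := h.torus v z hvv hzz hvz
    ((flagStabilizer ρ fun _ : Unit => W).map G.subtype) (by
      rintro g ⟨a, b, hg⟩
      refine ⟨g, fun _ u hu => ?_, rfl⟩
      obtain ⟨h1, h3⟩ := hW u hu
      rw [hw, map_add, map_smul, map_smul, LinearMap.add_apply, LinearMap.smul_apply,
        LinearMap.smul_apply, h1, smul_zero, add_zero, smul_eq_mul] at h3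
      rw [hg, h1, mul_zero, zero_smul, add_zero]
      have h4 := W.smul_mem (a * c⁻¹) h3
      rw [smul_smul, mul_assoc, inv_mul_cancel_left₀ hc] at h4
      exact W.add_mem hu h4)
  have hz : m v z ∈ (lieAlg k ((flagStabilizer ρ fun _ : Unit => W).map
      G.subtype)).toSubmodule ⊔ Submodule.span k {1} := by
    rw [← sub_add_cancel (m v z) (e • 1)]
    exact Submodule.add_mem_sup he (Submodule.smul_mem _ _ (Submodule.mem_span_singleton_self _))
  rw [hw, map_add, map_smul, map_smul]
  exact Submodule.add_mem _ (Submodule.smul_mem _ _ hz) (Submodule.smul_mem _ _ hvv')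

theorem mem_sup_of_swap (h : IsFormGroup G B η q ρ σ m) {S : Submodule k A} {v w : V}
    (hm : m w v ∈ S ⊔ Submodule.span k {1}) : m v w ∈ S ⊔ Submodule.span k {1} := by
  obtain ⟨c, hc⟩ := h.swap v w
  rw [eq_sub_of_add_eq hc]
  exact Submodule.sub_mem _ (Submodule.mem_sup_right
    (Submodule.smul_mem _ _ (Submodule.mem_span_singleton_self _))) (Submodule.smul_mem _ _ hm)

theorem mem_sup_of_mem_orthogonal [FiniteDimensional k V] [IsAlgClosed k]
    (h : IsFormGroup G B η q ρ σ m) {W : Submodule k V} {v w : V} (hv : v ∈ B.orthogonal W)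
    (hw : w ∈ B.orthogonal W) :
    m v w ∈ (lieAlg k ((flagStabilizer ρ fun _ : Unit => W).map G.subtype)).toSubmodule ⊔
      Submodule.span k {1} := by
  have : Infinite k := IsAlgClosed.instInfinite
  have key : ∀ v ∈ B.orthogonal W, ∀ w ∈ B.orthogonal W, B v v = 0 →
      m v w ∈ (lieAlg k ((flagStabilizer ρ fun _ : Unit => W).map G.subtype)).toSubmodule ⊔
        Submodule.span k {1} := fun v hv w hw hvv =>
    h.mem_sup_of_isotropic hvv fun u hu => by
      rw [h.isRefl _ _ (hv u hu), h.isRefl _ _ (hw u hu), zero_smul]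
      exact ⟨rfl, W.zero_mem⟩
  by_cases hvv : B v v = 0
  · exact key v hv w hw hvv
  have hη : η = 1 := h.sign'.resolve_right fun hη => by
    have h1 := h.symm v v
    rw [hη, neg_one_mul, eq_neg_iff_add_eq_zero, ← two_mul] at h1
    exact hvv ((mul_eq_zero.1 h1).resolve_left h.two_ne_zero)
  obtain ⟨c, hc⟩ := exists_add_smul_isotropic h.two_ne_zero
    (fun u v => by rw [h.symm, hη, one_mul]) hvv w
  have h1 := h.mem_sup_of_swap
    (key _ (Submodule.add_mem _ hw (Submodule.smul_mem _ c hv)) v hv hc)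
  rw [map_add, map_smul] at h1
  have h2 : m v v ∈ (lieAlg k ((flagStabilizer ρ fun _ : Unit => W).map
      G.subtype)).toSubmodule ⊔ Submodule.span k {1} := by
    obtain ⟨d, hd⟩ := h.swap v v
    rw [hη, one_smul, ← two_smul k] at hd
    have h3 : m v v = ((2 : k)⁻¹ * d) • (1 : A) := by
      rw [mul_smul, ← hd, smul_smul, inv_mul_cancel₀ h.two_ne_zero, one_smul]
    rw [h3]
    exact Submodule.mem_sup_right
      (Submodule.smul_mem _ _ (Submodule.mem_span_singleton_self _))
  rw [← add_sub_cancel_right (m v w) (c • m v v)]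
  exact Submodule.sub_mem _ h1 (Submodule.smul_mem _ _ h2)

/-- An endomorphism that preserves the isotropic subspace `W` and its orthogonal complement is a sum
of operators of rank one, of three kinds. -/
theorem exists_eq_sum_apply_smul [FiniteDimensional k V] (h : IsFormGroup G B η q ρ σ m)
    {W : Submodule k V} (hW : W ≤ B.orthogonal W) (x : Module.End k V) (hx : ∀ w ∈ W, x w ∈ W)
    (hx' : ∀ w ∈ B.orthogonal W, x w ∈ B.orthogonal W) :
    ∃ (ι : Type) (_ : Fintype ι) (v w : ι → V), (∀ u, x u = ∑ i, B (w i) u • v i) ∧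
      ∀ i, v i ∈ W ∨ w i ∈ W ∨ (v i ∈ B.orthogonal W ∧ w i ∈ B.orthogonal W) := by
  have hproj : ∀ X : Submodule k V, ∃ P : Module.End k V, (∀ u, P u ∈ X) ∧ ∀ u ∈ X, P u = u := by
    intro X
    obtain ⟨p, hp⟩ := X.subtype.exists_leftInverse_of_injective X.ker_subtype
    exact ⟨X.subtype ∘ₗ p, fun u => (p u).2,
      fun u hu => congrArg Subtype.val (LinearMap.congr_fun hp ⟨u, hu⟩)⟩
  obtain ⟨P, hPm, hP⟩ := hproj W
  obtain ⟨R, hRm, hR⟩ := hproj (B.orthogonal W)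
  have hdual : ∀ φ : Module.Dual k V, ∃ w, ∀ u, B w u = φ u := fun φ => by
    obtain ⟨w, hw⟩ := (B.toDual h.nondegenerate).surjective φ
    exact ⟨w, fun u => by rw [← hw, LinearMap.BilinForm.toDual_def]⟩
  choose D hD using hdual
  let b := Module.finBasis k V
  refine ⟨Fin (Module.finrank k V) ⊕ Fin (Module.finrank k V) ⊕ Fin (Module.finrank k V),
    inferInstance,
    Sum.elim (fun i => P (b i)) (Sum.elim (fun i => R (b i)) (fun i => x (b i))),
    Sum.elim (fun i => D (b.coord i ∘ₗ x ∘ₗ P)) (Sum.elim (fun i => D (b.coord i ∘ₗ x ∘ₗ (R - P)))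
      (fun i => D (b.coord i ∘ₗ (1 - R)))), fun u => ?_, ?_⟩
  · have h1 : ∀ (f : Module.End k V) w, ∑ i, b.coord i w • f (b i) = f w := by
      intro f w
      conv_rhs => rw [← b.sum_repr w]
      rw [map_sum]
      simp only [map_smul, Module.Basis.coord_apply]
    rw [Fintype.sum_sum_type, Fintype.sum_sum_type]
    simp only [Sum.elim_inl, Sum.elim_inr, hD, LinearMap.comp_apply, h1]
    rw [hP _ (hx _ (hPm u)), hR _ (hx' _ (by
      rw [LinearMap.sub_apply]; exact Submodule.sub_mem _ (hRm u) (hW (hPm u))))]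
    simp only [LinearMap.sub_apply, map_sub, Module.End.one_apply]
    abel
  · rintro (i | i | i)
    · exact Or.inl (hPm _)
    · refine Or.inr (Or.inr ⟨hRm _, fun u hu => h.isRefl _ _ ?_⟩)
      change B (D _) u = 0
      rw [hD, LinearMap.comp_apply, LinearMap.comp_apply, LinearMap.sub_apply, hP u hu,
        hR u (hW hu), sub_self, map_zero, map_zero]
    · refine Or.inr (Or.inl ?_)
      rw [← h.orthogonal_orthogonal W]
      refine fun u hu => h.isRefl _ _ ?_
      change B (D _) u = 0
      rw [hD, LinearMap.comp_apply, LinearMap.sub_apply, hR u hu, Module.End.one_apply, sub_self,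
        map_zero]

theorem apply_mem_orthogonal (h : IsFormGroup G B η q ρ σ m) {W : Submodule k V}
    (x : lieAlg k G) (hx : ∀ w ∈ W, σ x w ∈ W) {u : V} (hu : u ∈ B.orthogonal W) :
    σ x u ∈ B.orthogonal W := by
  intro w hw
  have h1 := h.skew x w u
  rwa [hu _ (hx w hw), zero_add] at h1

/-- The stabilizer of an isotropic subspace in `Lie G` is the Lie algebra of its stabilizer in `G`.
-/
theorem mem_lieAlg_stabilizer [FiniteDimensional k V] [IsAlgClosed k]
    (h : IsFormGroup G B η q ρ σ m) {W : Submodule k V} (hW : W ≤ B.orthogonal W)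
    (x : lieAlg k G) (hx : ∀ w ∈ W, σ x w ∈ W) :
    (x : A) ∈ lieAlg k ((flagStabilizer ρ fun _ : Unit => W).map G.subtype) := by
  have : Infinite k := IsAlgClosed.instInfinite
  obtain ⟨ι, _, v, w, hsum, hvw⟩ := h.exists_eq_sum_apply_smul hW (σ x) hx
    fun u hu => h.apply_mem_orthogonal x hx hu
  have hsum' : ∀ u, σ x u = -∑ i, (η * B (v i) u) • w i := by
    intro u
    refine eq_neg_of_add_eq_zero_left (h.nondegenerate.1 _ fun y => ?_)
    have h1 := h.skew x u y
    rw [hsum y, map_sum] at h1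
    rw [map_add, LinearMap.add_apply, map_sum, LinearMap.sum_apply, ← h1]
    congr 1
    refine Finset.sum_congr rfl fun i _ => ?_
    rw [map_smul, map_smul, LinearMap.smul_apply, smul_eq_mul, smul_eq_mul, h.symm u (v i), mul_comm]
  obtain ⟨c, hc⟩ := h.expand x v w fun u => by
    rw [Finset.sum_sub_distrib, ← hsum, two_smul, sub_eq_add_neg, ← hsum']
  have hS : (x : A) ∈ (lieAlg k ((flagStabilizer ρ fun _ : Unit => W).map
      G.subtype)).toSubmodule ⊔ Submodule.span k {1} := by
    have h1 : (2 : k) • (x : A) ∈ (lieAlg k ((flagStabilizer ρ fun _ : Unit => W).map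
        G.subtype)).toSubmodule ⊔ Submodule.span k {1} := by
      rw [hc]
      refine Submodule.add_mem _ (Submodule.sum_mem _ fun i _ => ?_) (Submodule.mem_sup_right
        (Submodule.smul_mem _ _ (Submodule.mem_span_singleton_self _)))
      have hmem : ∀ {v w : V}, v ∈ W → m v w ∈ (lieAlg k ((flagStabilizer ρ fun _ : Unit => W).map
          G.subtype)).toSubmodule ⊔ Submodule.span k {1} := fun {v w} hv =>
        h.mem_sup_of_isotropic (hW hv v hv) fun u hu => ⟨hW hu v hv, W.smul_mem _ hv⟩
      rcases hvw i with hi | hi | ⟨hi, hi'⟩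
      · exact hmem hi
      · exact h.mem_sup_of_swap (hmem hi)
      · exact h.mem_sup_of_mem_orthogonal hi hi'
    have h2 := Submodule.smul_mem _ (2 : k)⁻¹ h1
    rwa [smul_smul, inv_mul_cancel₀ h.two_ne_zero, one_smul] at h2
  obtain ⟨y, hy, z, hz, hyz⟩ := Submodule.mem_sup.1 hS
  obtain ⟨c, rfl⟩ := Submodule.mem_span_singleton.1 hz
  have hy' : y ∈ lieAlg k G := lieAlg_mono (Subgroup.map_subtype_le _) hy
  have h1 : c = 0 := by
    refine h.eq_zero_of_smul_one_mem c ?_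
    rw [eq_sub_of_add_eq' hyz]
    exact (lieAlg k G).sub_mem x.2 hy'
  rw [← hyz, h1, zero_smul, add_zero]
  exact hy

/-- For suitable `v` in `W` and `w` in its orthogonal complement the operator by which `m v w` acts
is not zero. It maps `V` to the orthogonal complement of `W`, that complement to `W`, and `W` to
zero. -/
theorem exists_apply_ne_zero [FiniteDimensional k V] (h : IsFormGroup G B η q ρ σ m)
    {W : Submodule k V} (hW : W ≤ B.orthogonal W) (hW0 : W ≠ ⊥) :
    ∃ v ∈ W, ∃ w ∈ B.orthogonal W, ∃ u, B w u • v - (η * B v u) • w ≠ 0 := by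
  obtain ⟨v, hv, hv0⟩ := Submodule.exists_mem_ne_zero_of_ne_bot hW0
  obtain ⟨u, hu⟩ : ∃ u, B v u ≠ 0 := by
    by_contra! hu
    exact hv0 (h.nondegenerate.1 v hu)
  rcases h.sign with ⟨hη, hn⟩ | hη
  · obtain ⟨w, hw, hwv⟩ : ∃ w ∈ B.orthogonal W, w ∉ Submodule.span k {v} := by
      by_contra! hle
      have hle' : B.orthogonal W ≤ Submodule.span k {v} := hle
      have h1 := LinearMap.BilinForm.finrank_orthogonal h.nondegenerate W
      have h2 := Submodule.finrank_mono hle'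
      have h3 := Submodule.finrank_mono hW
      have h4 := finrank_span_le_card (R := k) ({v} : Set V)
      simp at h4
      omega
    refine ⟨v, hv, w, hw, u, fun h0 => hwv ?_⟩
    rw [hη, one_mul, sub_eq_zero] at h0
    refine Submodule.mem_span_singleton.2 ⟨(B v u)⁻¹ * B w u, ?_⟩
    rw [mul_smul, h0, smul_smul, inv_mul_cancel₀ hu, one_smul]
  · refine ⟨v, hv, v, hW hv, u, ?_⟩
    rw [hη, ← sub_smul, neg_one_mul, sub_neg_eq_add, ← two_mul]
    exact smul_ne_zero (mul_ne_zero h.two_ne_zero hu) hv0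

theorem isParabolicSubalgebra [FiniteDimensional k V] [IsAlgClosed k]
    (hG : IsFormGroup G B η q ρ σ m) (h : LieSubalgebra k (lieAlg k G))
    (hh : IsMaximalNonSemisimple h) : IsParabolicSubalgebra h := by
  have : Infinite k := IsAlgClosed.instInfinite
  obtain ⟨W, hW0, hWW, hW⟩ := exists_invariant_isotropic hG.two_ne_zero B (σ.comp h.incl)
    (hG.injective.comp Subtype.val_injective) hh.prop (fun x => hG.skew x.1)
  have hWo : W ≤ B.orthogonal W := fun u hu v hv => hWW v hv u hu
  have hpar := hG.isParabolic_stabilizer W hWo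
  obtain ⟨v, hv, w, hw, u, hu⟩ := hG.exists_apply_ne_zero hWo hW0
  have hy : m v w ∈ lieAlg k G := mem_lieAlg_of_line _ _ fun t => by
    obtain ⟨g, hg, -⟩ := hG.unipotent v w (hWW v hv v hv) (hw v hv) t
    exact ⟨g, g.2, hg⟩
  refine isParabolicSubalgebra_of_stabilizer hpar σ hG.injective W (B.orthogonal W) hWo
    (fun x hx => hG.mem_lieAlg_stabilizer hWo x hx)
    (fun x hx u hu => hG.isDifferential.mem_of_mem_lieAlg hpar.1 W
      (fun g hg => (mem_map_flagStabilizer.1 hg).2 ()) x hx hu)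
    (fun x hx u hu => hG.apply_mem_orthogonal x hx hu) ⟨_, hy⟩ ?_ ?_ ?_ ?_ h hh
    (fun x hx => hW ⟨x, hx⟩)
  · intro h0
    refine hu ?_
    rw [← hG.differential_apply v w hy, h0, map_zero, LinearMap.zero_apply]
  · intro u hu
    rw [hG.differential_apply, hWW v hv u hu, hG.isRefl _ _ (hw u hu), mul_zero, zero_smul,
      zero_smul, sub_zero]
  · intro u hu
    rw [hG.differential_apply, hu v hv, mul_zero, zero_smul, sub_zero]
    exact W.smul_mem _ hv
  · intro u
    rw [hG.differential_apply]
    exact Submodule.sub_mem _ (Submodule.smul_mem _ _ (hWo hv)) (Submodule.smul_mem _ _ hw)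

end IsFormGroup

end FormGroup

/-! ### The symplectic group -/

section Symplectic

variable {k V : Type*} [Field k] [AddCommGroup V] [Module k V]

attribute [local instance 100] LieRing.ofAssociativeRing

theorem mem_Sp_iff {ω : LinearMap.BilinForm k V} {g : (Module.End k V)ˣ} :
    g ∈ Sp ω ↔ ∀ v w : V, ω ((g : Module.End k V) v) ((g : Module.End k V) w) = ω v w := Iff.rfl

theorem exists_polyFun_form [FiniteDimensional k V] (ω : LinearMap.BilinForm k V) (v w : V) :
    ∃ f : PolyFun k (Module.End k V), (∀ a, PolyFun.evalAt a f = ω (a v) (a w) - ω v w) ∧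
      ∀ x, PolyFun.evalDual 1 x f = TrivSqZeroExt.inr (ω v (x w) + ω (x v) w) := by
  obtain ⟨f, hf, hf'⟩ := exists_polyFun_bilin
    (ω.compl₁₂ (LinearMap.applyₗ v : Module.End k V →ₗ[k] V) (LinearMap.applyₗ w))
  refine ⟨f - algebraMap k _ (ω v w), fun a => ?_, fun x => ?_⟩
  · rw [map_sub, hf, AlgHom.commutes]
    rfl
  · rw [map_sub, hf', AlgHom.commutes, TrivSqZeroExt.algebraMap_eq_inl]
    simp

theorem isClosed_Sp [FiniteDimensional k V] (ω : LinearMap.BilinForm k V) :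
    @IsClosed (Module.End k V)ˣ (zariski k (Module.End k V)) (Sp ω : Set (Module.End k V)ˣ) := by
  choose f hf _ using fun p : V × V => exists_polyFun_form ω p.1 p.2
  convert isClosed_vanishing_set (Set.range f) using 1
  ext g
  rw [SetLike.mem_coe, mem_Sp_iff, Set.mem_ofPred_eq, Set.forall_mem_range]
  simp only [hf, sub_eq_zero, Prod.forall]

theorem apply_add_apply_eq_zero_of_mem_lieAlg_Sp [FiniteDimensional k V]
    {ω : LinearMap.BilinForm k V} {x : Module.End k V} (hx : x ∈ lieAlg k (Sp ω)) (v w : V) :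
    ω (x v) w + ω v (x w) = 0 := by
  obtain ⟨f, hf, hf'⟩ := exists_polyFun_form ω v w
  have h := hx f fun g hg => by rw [hf, hg, sub_self]
  rw [hf'] at h
  rw [add_comm]
  simpa using congrArg TrivSqZeroExt.snd h

/-- The element `u ↦ ω w u • v + ω v u • w` of the symplectic Lie algebra. -/
def symOp (ω : LinearMap.BilinForm k V) : V →ₗ[k] V →ₗ[k] Module.End k V :=
  LinearMap.mk₂ k (fun v w => (ω w).smulRight v + (ω v).smulRight w)
    (fun _ _ _ => by ext; simp; module) (fun _ _ _ => by ext; simp; module)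
    (fun _ _ _ => by ext; simp; module) (fun _ _ _ => by ext; simp; module)

@[simp]
theorem symOp_apply (ω : LinearMap.BilinForm k V) (v w u : V) :
    symOp ω v w u = ω w u • v + ω v u • w := rfl

/-- The isometry that multiplies `v` by `t⁻¹` and `w` by `t`, for a hyperbolic pair `v`, `w`. -/
def hyperbolicUnit (ω : LinearMap.BilinForm k V) (hω : ω.IsAlt) {v w : V} (hvw : ω v w = 1)
    (t : kˣ) : (Module.End k V)ˣ :=
  have hvv : ω v v = 0 := hω v
  have hww : ω w w = 0 := hω w
  have hwv : ω w v = -1 := by rw [← hω.neg_eq v w, hvw]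
  { val := 1 + (ω w).smulRight ((1 - (t : k)⁻¹) • v) + (ω v).smulRight (((t : k) - 1) • w)
    inv := 1 + (ω w).smulRight ((1 - (t : k)) • v) + (ω v).smulRight (((t : k)⁻¹ - 1) • w)
    val_inv := by
      have ht : (t : k) * (t : k)⁻¹ = 1 := mul_inv_cancel₀ t.ne_zero
      ext u
      simp only [Module.End.mul_apply, LinearMap.add_apply, LinearMap.smulRight_apply,
        Module.End.one_apply, map_add, map_smul, hvv, hww, hvw, hwv]
      match_scalars
      · ring
      · linear_combination -(ω w u) * ht
      · linear_combination (ω v u) * ht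
    inv_val := by
      have ht : (t : k) * (t : k)⁻¹ = 1 := mul_inv_cancel₀ t.ne_zero
      ext u
      simp only [Module.End.mul_apply, LinearMap.add_apply, LinearMap.smulRight_apply,
        Module.End.one_apply, map_add, map_smul, hvv, hww, hvw, hwv]
      match_scalars
      · ring
      · linear_combination -(ω w u) * ht
      · linear_combination (ω v u) * ht }

theorem isFormGroup_Sp [IsAlgClosed k] [FiniteDimensional k V] (h2 : (2 : k) ≠ 0)
    (hV : 0 < Module.finrank k V) {ω : LinearMap.BilinForm k V} (hω : ω.IsAlt)
    (hnd : ω.Nondegenerate) :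
    IsFormGroup (Sp ω) ω (-1) (fun _ => 0) (tautologicalRep k V (Sp ω)) (lieAlg k (Sp ω)).incl
      (symOp ω) where
  two_ne_zero := h2
  isClosed := isClosed_Sp ω
  isDifferential := isDifferential_tautologicalRep _
  injective := Subtype.val_injective
  isometry := fun g => g.2
  skew := fun x => apply_add_apply_eq_zero_of_mem_lieAlg_Sp x.2
  nondegenerate := hnd
  symm := fun u v => by rw [← hω.neg_eq u v, neg_one_mul, neg_neg]
  apply_self := fun v => by rw [hω, mul_zero]
  sign := Or.inr rfl
  comm_of_ker := fun g h hg hh => by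
    have hg' : g = 1 := Subtype.ext (Units.ext hg)
    rw [hg', one_mul, mul_one]
  unipotent := fun v w hvv hvw t => by
    have hww : ω w w = 0 := hω w
    have hwv : ω w v = 0 := by rw [← hω.neg_eq v w, hvw, neg_zero]
    have hsq : symOp ω v w * symOp ω v w = 0 := by
      ext u
      simp [hvv, hvw, hww, hwv]
    refine ⟨⟨oneAddUnit _ hsq t, fun x y => ?_⟩, rfl, fun u => ?_⟩
    · have h1 := hω.neg_eq x v
      have h3 := hω.neg_eq x w
      simp only [oneAddUnit, LinearMap.add_apply, Module.End.one_apply, LinearMap.smul_apply,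
        symOp_apply, map_add, map_smul, smul_eq_mul, hvv, hvw, hww, hwv, ← h1, ← h3]
      ring
    · simp [oneAddUnit]
  torus := fun v w hvv hww hvw P hP => by
    have hwv : ω w v = -1 := by rw [← hω.neg_eq v w, hvw]
    refine ⟨0, ?_⟩
    have h := mem_lieAlg_of_curve P ((ω w).smulRight (-v)) ((ω v).smulRight w)
      (1 - (ω w).smulRight (-v) - (ω v).smulRight w) (-1) 1 0 (by abel) fun t => by
        refine ⟨hyperbolicUnit ω hω hvw t, hP ⟨_, fun x y => ?_⟩ ⟨1 - (t : k)⁻¹, (t : k) - 1,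
          fun u => ?_⟩, ?_⟩
        · have ht : (t : k) * (t : k)⁻¹ = 1 := mul_inv_cancel₀ t.ne_zero
          have h1 := hω.neg_eq x v
          have h3 := hω.neg_eq x w
          simp only [LinearMap.add_apply, Module.End.one_apply,
            LinearMap.smulRight_apply, map_add, map_smul, LinearMap.smul_apply, smul_eq_mul, hvv,
            hvw, hww, hwv, ← h1, ← h3]
          linear_combination (ω x w * ω v y - ω x v * ω w y) * ht
        · simp only [tautologicalRep_apply, LinearMap.add_apply,
            Module.End.one_apply, LinearMap.smulRight_apply]
          module
        · ext u
          simp only [hyperbolicUnit, LinearMap.add_apply, Module.End.one_apply, zpow_one,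
            LinearMap.smulRight_apply, LinearMap.smul_apply, LinearMap.sub_apply, zpow_neg_one,
            zpow_zero, Units.val_one, Units.val_inv_eq_inv_val]
          module
    convert h using 1
    ext u
    simp
  differential_apply := fun v w h u => by
    change symOp ω v w u = _
    rw [symOp_apply]
    module
  swap := fun v w => ⟨0, by ext u; simp; abel⟩
  expand := fun x ι _ v w hx => ⟨0, by
    ext u
    have h := hx u
    rw [LieSubalgebra.coe_incl] at h
    rw [zero_smul, add_zero, LinearMap.smul_apply, h, LinearMap.sum_apply]
    refine Finset.sum_congr rfl fun i _ => ?_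
    rw [symOp_apply]
    module⟩
  eq_zero_of_smul_one_mem := fun c hc => by
    have : Nontrivial V := Module.finrank_pos_iff.1 hV
    obtain ⟨v, hv⟩ := exists_ne (0 : V)
    obtain ⟨w, hw⟩ : ∃ w, ω v w ≠ 0 := by
      by_contra! h
      exact hv (hnd.1 v h)
    have h := apply_add_apply_eq_zero_of_mem_lieAlg_Sp hc v w
    simp only [LinearMap.smul_apply, Module.End.one_apply, map_smul, smul_eq_mul] at h
    have h' : 2 * ω v w * c = 0 := by linear_combination h
    exact (mul_eq_zero.1 h').resolve_left (mul_ne_zero h2 hw)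

end Symplectic

/-! ### Clifford algebras -/

section Clifford

open CliffordAlgebra

variable {k V : Type*} [Field k] [AddCommGroup V] [Module k V] (Q : QuadraticForm k V)

/-- The span of the ordered products `s i₁ * ⋯ * s iᵣ` of vectors with `j > i₁ > ⋯ > iᵣ`, in the
Clifford algebra. -/
def cliffordSpan (s : ℕ → V) : ℕ → Submodule k (CliffordAlgebra Q)
  | 0 => Submodule.span k {1}
  | j + 1 => cliffordSpan s j ⊔ (cliffordSpan s j).map (LinearMap.mulLeft k (ι Q (s j)))

variable {Q}

theorem one_mem_cliffordSpan (s : ℕ → V) (j : ℕ) : (1 : CliffordAlgebra Q) ∈ cliffordSpan Q s j := by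
  induction j with
  | zero => exact Submodule.mem_span_singleton_self 1
  | succ j ih => exact Submodule.mem_sup_left ih

theorem finiteDimensional_cliffordSpan (s : ℕ → V) (j : ℕ) :
    FiniteDimensional k (cliffordSpan Q s j) := by
  induction j with
  | zero => exact inferInstanceAs (FiniteDimensional k (Submodule.span k {(1 : CliffordAlgebra Q)}))
  | succ j ih =>
    exact inferInstanceAs (FiniteDimensional k (cliffordSpan Q s j ⊔
      (cliffordSpan Q s j).map (LinearMap.mulLeft k (ι Q (s j))) : Submodule k _))

theorem ι_mul_mem_cliffordSpan (s : ℕ → V) {i j : ℕ} (hij : i < j) {x : CliffordAlgebra Q}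
    (hx : x ∈ cliffordSpan Q s j) : ι Q (s i) * x ∈ cliffordSpan Q s j := by
  induction j generalizing x with
  | zero => omega
  | succ j ih =>
    obtain ⟨a, ha, _, ⟨b, hb, rfl⟩, rfl⟩ := Submodule.mem_sup.1 hx
    rw [LinearMap.mulLeft_apply, mul_add]
    refine Submodule.add_mem _ ?_ ?_
    · rcases Nat.lt_succ_iff_lt_or_eq.1 hij with h | rfl
      · exact Submodule.mem_sup_left (ih h ha)
      · exact Submodule.mem_sup_right ⟨a, ha, rfl⟩
    · rcases Nat.lt_succ_iff_lt_or_eq.1 hij with h | rfl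
      · rw [← mul_assoc, eq_sub_of_add_eq (ι_mul_ι_add_swap (Q := Q) (s i) (s j)), sub_mul,
          mul_assoc, ← Algebra.smul_def]
        exact Submodule.sub_mem _ (Submodule.mem_sup_left (Submodule.smul_mem _ _ hb))
          (Submodule.mem_sup_right ⟨_, ih h hb, rfl⟩)
      · rw [← mul_assoc, ι_sq_scalar, ← Algebra.smul_def]
        exact Submodule.mem_sup_left (Submodule.smul_mem _ _ hb)

theorem contractLeft_eq_zero_of_mem_cliffordSpan (s : ℕ → V) (d : Module.Dual k V) {j : ℕ}
    (hd : ∀ i < j, d (s i) = 0) {x : CliffordAlgebra Q} (hx : x ∈ cliffordSpan Q s j) :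
    contractLeft d x = 0 := by
  induction j generalizing x with
  | zero =>
    obtain ⟨c, rfl⟩ := Submodule.mem_span_singleton.1 hx
    rw [map_smul, contractLeft_one, smul_zero]
  | succ j ih =>
    obtain ⟨a, ha, _, ⟨b, hb, rfl⟩, rfl⟩ := Submodule.mem_sup.1 hx
    have hd' : ∀ i < j, d (s i) = 0 := fun i hi => hd i (by omega)
    rw [map_add, ih hd' ha, LinearMap.mulLeft_apply, contractLeft_ι_mul, ih hd' hb,
      hd j (by omega), zero_smul, mul_zero, sub_zero, add_zero]

variable (k V) in
/-- A sequence of vectors that starts with a basis and continues with zeros. -/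
theorem exists_basis_sequence [FiniteDimensional k V] : ∃ (n : ℕ) (s : ℕ → V),
    (∀ X : Submodule k V, (∀ i < n, s i ∈ X) → X = ⊤) ∧
    ∀ j < n, ∃ d : Module.Dual k V, d (s j) = 1 ∧ ∀ i < j, d (s i) = 0 := by
  let b := Module.finBasis k V
  refine ⟨Module.finrank k V, fun i => if h : i < _ then b ⟨i, h⟩ else 0, fun X hX => ?_,
    fun j hj => ⟨b.coord ⟨j, hj⟩, by simp [hj], fun i hi => ?_⟩⟩
  · rw [← top_le_iff, ← b.span_eq, Submodule.span_le]
    rintro _ ⟨i, rfl⟩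
    have h := hX i i.2
    simpa using h
  · have h1 : i < Module.finrank k V := by omega
    have h2 : (⟨i, h1⟩ : Fin (Module.finrank k V)) ≠ ⟨j, hj⟩ := fun h => hi.ne (Fin.mk.inj_iff.1 h)
    simp [h1, h2]

theorem cliffordSpan_eq_top {s : ℕ → V} {n : ℕ}
    (hs : ∀ X : Submodule k V, (∀ i < n, s i ∈ X) → X = ⊤) : cliffordSpan Q s n = ⊤ := by
  rw [eq_top_iff]
  intro x _
  induction x using CliffordAlgebra.left_induction with
  | algebraMap r =>
    rw [Algebra.algebraMap_eq_smul_one]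
    exact Submodule.smul_mem _ r (one_mem_cliffordSpan s n)
  | add x y hx hy => exact Submodule.add_mem _ (hx trivial) (hy trivial)
  | ι_mul x m hx =>
    have h := hs ((cliffordSpan Q s n).comap (LinearMap.mulRight k x ∘ₗ ι Q)) fun i hi =>
      ι_mul_mem_cliffordSpan s hi (hx trivial)
    have hm : m ∈ (⊤ : Submodule k V) := trivial
    rw [← h] at hm
    exact hm

instance finiteDimensional_cliffordAlgebra [FiniteDimensional k V] :
    FiniteDimensional k (CliffordAlgebra Q) := by
  obtain ⟨n, s, hs, -⟩ := exists_basis_sequence k V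
  have h1 := finiteDimensional_cliffordSpan (Q := Q) s n
  rw [cliffordSpan_eq_top hs] at h1
  exact Module.finite_def.2 (Module.Finite.iff_fg.1 h1)

/-- The only elements of the Clifford algebra that are killed by all contractions are the scalars.
-/
theorem exists_eq_algebraMap_of_contractLeft [FiniteDimensional k V] {x : CliffordAlgebra Q}
    (hx : ∀ d : Module.Dual k V, contractLeft d x = 0) :
    ∃ c : k, x = algebraMap k (CliffordAlgebra Q) c := by
  obtain ⟨n, s, hs, hd⟩ := exists_basis_sequence k V
  have key : ∀ j ≤ n, x ∈ cliffordSpan Q s j → x ∈ cliffordSpan Q s 0 := by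
    intro j
    induction j with
    | zero => exact fun _ h => h
    | succ j ih =>
      intro hj h
      refine ih (by omega) ?_
      obtain ⟨a, ha, _, ⟨b, hb, rfl⟩, rfl⟩ := Submodule.mem_sup.1 h
      obtain ⟨d, hd1, hd0⟩ := hd j (by omega)
      have h1 := hx d
      rw [map_add, LinearMap.mulLeft_apply, contractLeft_ι_mul, hd1, one_smul,
        contractLeft_eq_zero_of_mem_cliffordSpan s d hd0 ha,
        contractLeft_eq_zero_of_mem_cliffordSpan s d hd0 hb, mul_zero, sub_zero, zero_add] at h1
      rw [h1, map_zero, add_zero]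
      exact ha
  have h := key n le_rfl (by rw [cliffordSpan_eq_top hs]; trivial)
  obtain ⟨c, hc⟩ := Submodule.mem_span_singleton.1 h
  exact ⟨c, by rw [Algebra.algebraMap_eq_smul_one, hc]⟩

/-- The twisted commutator with a vector is a contraction. -/
theorem ι_mul_sub_involute_mul_ι (v : V) (x : CliffordAlgebra Q) :
    ι Q v * x - involute x * ι Q v = contractLeft (Q.polarBilin v) x := by
  induction x using CliffordAlgebra.left_induction with
  | algebraMap r =>
    rw [AlgHom.commutes, contractLeft_algebraMap, Algebra.commutes, sub_self]
  | add x y hx hy =>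
    rw [map_add, map_add, ← hx, ← hy]
    noncomm_ring
  | ι_mul x m hx =>
    rw [contractLeft_ι_mul, ← hx, map_mul, involute_ι, QuadraticMap.polarBilin_apply_apply,
      Algebra.smul_def, ← ι_mul_ι_add_swap]
    noncomm_ring

/-- The elements that commute with all vectors, in the twisted sense, are the scalars. -/
theorem exists_eq_algebraMap_of_twisted [FiniteDimensional k V]
    (hQ : LinearMap.Nondegenerate Q.polarBilin) {x : CliffordAlgebra Q}
    (hx : ∀ v, ι Q v * x = involute x * ι Q v) :
    ∃ c : k, x = algebraMap k (CliffordAlgebra Q) c := by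
  refine exists_eq_algebraMap_of_contractLeft fun d => ?_
  obtain ⟨v, hv⟩ := (LinearMap.BilinForm.toDual Q.polarBilin hQ).surjective d
  have h : Q.polarBilin v = d := by
    ext u
    rw [← hv, LinearMap.BilinForm.toDual_def]
  rw [← h, ← ι_mul_sub_involute_mul_ι, hx, sub_self]

/-- The reflection in the hyperplane orthogonal to an anisotropic vector `a`. -/
noncomputable def orthReflection (Q : QuadraticForm k V) (a : V) : Module.End k V :=
  1 - (Q.polarBilin a).smulRight ((Q a)⁻¹ • a)

theorem orthReflection_apply (a v : V) :
    orthReflection Q a v = v - (QuadraticMap.polar Q a v * (Q a)⁻¹) • a := by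
  simp [orthReflection, smul_smul]

theorem map_orthReflection {a : V} (ha : Q a ≠ 0) (v : V) : Q (orthReflection Q a v) = Q v := by
  rw [orthReflection_apply, sub_eq_add_neg, ← neg_smul, QuadraticMap.map_add Q,
    QuadraticMap.map_smul, QuadraticMap.polar_smul_right, QuadraticMap.polar_comm Q v a]
  simp only [smul_eq_mul]
  field_simp
  ring

theorem ι_orthReflection_mul {a : V} (ha : Q a ≠ 0) (v : V) :
    ι Q (orthReflection Q a v) * ι Q a = -(ι Q a * ι Q v) := by
  rw [orthReflection_apply, map_sub, map_smul, sub_mul, smul_mul_assoc, ι_sq_scalar,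
    Algebra.smul_def, ← map_mul (algebraMap k _), mul_assoc, inv_mul_cancel₀ ha, mul_one,
    ← ι_mul_ι_add_swap]
  noncomm_ring

theorem orthReflection_of_polar_eq_zero {a v : V} (h : QuadraticMap.polar Q a v = 0) :
    orthReflection Q a v = v := by
  rw [orthReflection_apply, h, zero_mul, zero_smul, sub_zero]

/-- The reflection in `u - v` exchanges the vectors `u` and `v` of equal length. -/
theorem orthReflection_sub {u v : V} (h : Q u = Q v) (huv : Q (u - v) ≠ 0) :
    orthReflection Q (u - v) u = v := by
  have h1 : QuadraticMap.polar Q (u - v) u = Q (u - v) := by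
    have h2 := QuadraticMap.map_add Q (u - v) v
    have h3 : QuadraticMap.polar Q (u - v) u = QuadraticMap.polar Q (u - v) v +
        QuadraticMap.polar Q (u - v) (u - v) := by
      rw [← QuadraticMap.polar_add_right, add_sub_cancel]
    rw [sub_add_cancel] at h2
    rw [h3, QuadraticMap.polar_self, nsmul_eq_mul, Nat.cast_ofNat]
    linear_combination -h2 + h
  rw [orthReflection_apply, h1, mul_inv_cancel₀ huv, one_smul, sub_sub_cancel]

theorem exists_lipschitz_unit {a : V} (ha : Q a ≠ 0) :
    ∃ y ∈ lipschitzGroup Q, (y : CliffordAlgebra Q) = ι Q a := by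
  obtain ⟨y, hy⟩ := isUnit_ι_of_isUnit Q (IsUnit.mk0 _ ha)
  exact ⟨y, Subgroup.subset_closure ⟨a, hy.symm⟩, hy⟩

/-- An element of the Lipschitz group induces the inverse of the isometry `T` in the twisted sense.
-/
def IsInducedByLipschitz (Q : QuadraticForm k V) (T : Module.End k V) : Prop :=
  ∃ y ∈ lipschitzGroup Q, ∀ v,
    involute (y : CliffordAlgebra Q) * ι Q (T v) = ι Q v * (y : CliffordAlgebra Q)

theorem IsInducedByLipschitz.of_orthReflection_mul {a : V} (ha : Q a ≠ 0) {T : Module.End k V}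
    (h : IsInducedByLipschitz Q (orthReflection Q a * T)) : IsInducedByLipschitz Q T := by
  obtain ⟨y, hy, hyT⟩ := h
  obtain ⟨z, hz, hza⟩ := exists_lipschitz_unit ha
  refine ⟨y * z, Subgroup.mul_mem _ hy hz, fun v => ?_⟩
  have h1 := ι_orthReflection_mul ha (T v)
  have h2 := hyT v
  rw [Module.End.mul_apply] at h2
  rw [Units.val_mul, map_mul, hza, involute_ι, ← mul_assoc (ι Q v), ← h2, mul_assoc, mul_assoc, h1,
    neg_mul]

/-- The theorem of Cartan and Dieudonné: isometries of a non-degenerate quadratic space are induced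
by elements of the Lipschitz group, that is, they are products of reflections. -/
theorem isInducedByLipschitz_of_isometry [FiniteDimensional k V] (h2 : (2 : k) ≠ 0)
    (hQ : LinearMap.Nondegenerate Q.polarBilin) (T : Module.End k V) (hT : ∀ v, Q (T v) = Q v) :
    IsInducedByLipschitz Q T := by
  have : Invertible (2 : k) := invertibleOfNonzero h2
  have hsymm : LinearMap.IsSymm Q.polarBilin := ⟨fun u v => QuadraticMap.polar_comm Q u v⟩
  obtain ⟨b, hb⟩ := LinearMap.BilinForm.exists_orthogonal_basis hsymm
  have hort : ∀ i j, i ≠ j → QuadraticMap.polar Q (b i) (b j) = 0 := fun i j hij => hb hij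
  have hself : ∀ v, QuadraticMap.polar Q v v = 2 * Q v := fun v => by
    rw [QuadraticMap.polar_self, nsmul_eq_mul, Nat.cast_ofNat]
  have hne : ∀ i, Q (b i) ≠ 0 := by
    intro i h0
    refine b.ne_zero i (hQ.1 _ fun y => ?_)
    have h1 : Q.polarBilin (b i) = 0 := b.ext fun j => by
      by_cases hij : i = j
      · rw [← hij, QuadraticMap.polarBilin_apply_apply, hself, h0, mul_zero, LinearMap.zero_apply]
      · exact hort i j hij
    rw [h1, LinearMap.zero_apply]
  have hpolar : ∀ {S : Module.End k V}, (∀ v, Q (S v) = Q v) → ∀ u v,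
      QuadraticMap.polar Q (S u) (S v) = QuadraticMap.polar Q u v := by
    intro S hS u v
    rw [QuadraticMap.polar, QuadraticMap.polar, ← map_add, hS, hS, hS]
  -- downward induction on the number of basis vectors that are fixed
  have key : ∀ m j, m + j = Module.finrank k V → ∀ T : Module.End k V, (∀ v, Q (T v) = Q v) →
      (∀ i : Fin (Module.finrank k V), (i : ℕ) < j → T (b i) = b i) → IsInducedByLipschitz Q T := by
    intro m
    induction m with
    | zero =>
      intro j hj T _ hTb
      have hT1 : T = 1 := b.ext fun i => hTb i (by omega)
      exact ⟨1, Subgroup.one_mem _, fun v => by simp [hT1]⟩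
    | succ m ih =>
      intro j hj T hT hTb
      have hjn : j < Module.finrank k V := by omega
      set e := b ⟨j, hjn⟩ with he
      have hstep : ∀ a, Q a ≠ 0 → (∀ i : Fin (Module.finrank k V), (i : ℕ) < j → QuadraticMap.polar Q a (b i) = 0) →
          ∀ S : Module.End k V, (∀ v, Q (S v) = Q v) →
          (∀ i : Fin (Module.finrank k V), (i : ℕ) < j → S (b i) = b i) → orthReflection Q a (S e) = e →
          IsInducedByLipschitz Q S := by
        intro a ha hab S hS hSb hSe
        refine IsInducedByLipschitz.of_orthReflection_mul ha (ih (j + 1) (by omega) _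
          (fun v => by rw [Module.End.mul_apply, map_orthReflection ha, hS]) fun i hi => ?_)
        rw [Module.End.mul_apply]
        rcases Nat.lt_succ_iff_lt_or_eq.1 hi with h | h
        · rw [hSb i h, orthReflection_of_polar_eq_zero (hab i h)]
        · have : i = ⟨j, hjn⟩ := Fin.ext h
          rw [this, ← he, hSe]
      have hei : ∀ i : Fin (Module.finrank k V), (i : ℕ) < j → QuadraticMap.polar Q e (b i) = 0 := fun i hi =>
        hort _ _ fun h => by rw [← h] at hi; exact lt_irrefl _ hi
      have hTei : ∀ i : Fin (Module.finrank k V), (i : ℕ) < j → QuadraticMap.polar Q (T e) (b i) = 0 := by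
        intro i hi
        have h1 := hpolar hT e (b i)
        rw [hTb i hi] at h1
        rw [h1, hei i hi]
      by_cases h1 : Q (T e - e) = 0
      · -- the reflection in `T e + e` maps `T e` to `-e`
        have h3 : Q (T e + e) ≠ 0 := by
          have h4 := QuadraticMap.map_add Q (T e) e
          have h5 := QuadraticMap.map_add Q (T e) (-e)
          rw [← sub_eq_add_neg, h1, QuadraticMap.map_neg, QuadraticMap.polar_neg_right] at h5
          have h6 : Q (T e + e) = 2 * (2 * Q e) := by
            rw [h4, ← sub_eq_zero]
            rw [hT] at h5 ⊢
            linear_combination h5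
          rw [h6]
          exact mul_ne_zero h2 (mul_ne_zero h2 (hne _))
        have h4 : orthReflection Q (T e + e) (T e) = -e := by
          rw [← sub_neg_eq_add]
          exact orthReflection_sub (by rw [hT, QuadraticMap.map_neg]) (by rwa [sub_neg_eq_add])
        refine IsInducedByLipschitz.of_orthReflection_mul h3 (hstep e (hne _) hei _ (fun v => by
          rw [Module.End.mul_apply, map_orthReflection h3, hT]) (fun i hi => ?_) ?_)
        · rw [Module.End.mul_apply, hTb i hi, orthReflection_of_polar_eq_zero]
          rw [QuadraticMap.polar_add_left, hTei i hi, hei i hi, add_zero]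
        · rw [Module.End.mul_apply, h4, orthReflection_apply, QuadraticMap.polar_neg_right, hself,
            neg_mul, mul_assoc, mul_inv_cancel₀ (hne _), mul_one]
          module
      · refine hstep (T e - e) h1 (fun i hi => ?_) T hT hTb (orthReflection_sub (hT e) h1)
        rw [QuadraticMap.polar_sub_left, hTei i hi, hei i hi, sub_zero]
  exact key _ 0 rfl T hT fun i hi => absurd hi (Nat.not_lt_zero _)

theorem ι_injective_of_nondegenerate [Nontrivial (CliffordAlgebra Q)]
    (hQ : LinearMap.Nondegenerate Q.polarBilin) : Function.Injective (ι Q) := by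
  rw [injective_iff_map_eq_zero]
  intro v hv
  refine hQ.1 v fun w => ?_
  have h := ι_mul_ι_add_swap (Q := Q) v w
  rw [hv, zero_mul, mul_zero, add_zero, eq_comm, map_eq_zero] at h
  exact h

theorem mem_Spin_iff_mem_spinGroup {g : (CliffordAlgebra Q)ˣ} :
    g ∈ Spin Q ↔ (g : CliffordAlgebra Q) ∈ spinGroup Q := by
  constructor
  · rintro ⟨x, rfl⟩
    exact x.2
  · intro h
    exact ⟨⟨g, h⟩, Units.ext rfl⟩

theorem star_eq_inv_of_mul_star {g : (CliffordAlgebra Q)ˣ}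
    (h : (g : CliffordAlgebra Q) * star (g : CliffordAlgebra Q) = 1) :
    star (g : CliffordAlgebra Q) = ((g⁻¹ : (CliffordAlgebra Q)ˣ) : CliffordAlgebra Q) :=
  Units.eq_inv_of_mul_eq_one_left h

/-- The spin group consists of the even elements of spinor norm one that normalize the space of
vectors. -/
theorem mem_Spin_iff [FiniteDimensional k V] [Nontrivial V] (h2 : (2 : k) ≠ 0)
    (hQ : LinearMap.Nondegenerate Q.polarBilin) {g : (CliffordAlgebra Q)ˣ} :
    g ∈ Spin Q ↔ (g : CliffordAlgebra Q) ∈ evenOdd Q 0 ∧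
      (g : CliffordAlgebra Q) * star (g : CliffordAlgebra Q) = 1 ∧
      ∀ v, (g : CliffordAlgebra Q) * ι Q v * star (g : CliffordAlgebra Q) ∈
        LinearMap.range (ι Q) := by
  have : Invertible (2 : k) := invertibleOfNonzero h2
  rw [mem_Spin_iff_mem_spinGroup]
  constructor
  · intro h
    have h1 := spinGroup.mul_star_self_of_mem h
    refine ⟨spinGroup.mem_even h, h1, fun v => ?_⟩
    have h3 := spinGroup.conjAct_smul_ι_mem_range_ι h v
    rwa [ConjAct.units_smul_def, ConjAct.ofConjAct_toConjAct, ← star_eq_inv_of_mul_star h1] at h3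
  · rintro ⟨hev, hone, hV⟩
    have hstar := star_eq_inv_of_mul_star hone
    have hone' : star (g : CliffordAlgebra Q) * (g : CliffordAlgebra Q) = 1 := by
      rw [hstar, Units.inv_mul]
    refine spinGroup.mem_iff.2 ⟨pinGroup.mem_iff.2 ⟨⟨g, ?_, rfl⟩, hone', hone⟩, hev⟩
    have hinj := ι_injective_of_nondegenerate hQ
    obtain ⟨p, hp⟩ := (ι Q).exists_leftInverse_of_injective (LinearMap.ker_eq_bot.2 hinj)
    let T : Module.End k V := p ∘ₗ LinearMap.mulRight k (star (g : CliffordAlgebra Q)) ∘ₗ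
      LinearMap.mulLeft k (g : CliffordAlgebra Q) ∘ₗ ι Q
    have hT : ∀ v, ι Q (T v) = g * ι Q v * star (g : CliffordAlgebra Q) := by
      intro v
      obtain ⟨w, hw⟩ := hV v
      have h3 : T v = w := by
        change p (g * ι Q v * star (g : CliffordAlgebra Q)) = w
        rw [← hw]
        exact LinearMap.congr_fun hp w
      rw [h3, hw]
    have hT' : ∀ v, ι Q (T v) * g = g * ι Q v := fun v => by
      rw [hT, mul_assoc, hone', mul_one]
    have hTQ : ∀ v, Q (T v) = Q v := by
      intro v
      refine (algebraMap k (CliffordAlgebra Q)).injective ?_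
      rw [← ι_sq_scalar, hT, mul_assoc, ← mul_assoc (star _), ← mul_assoc (star _), hone', one_mul,
        mul_assoc, ← mul_assoc (ι Q v), ι_sq_scalar, Algebra.commutes, ← mul_assoc, hone, one_mul]
    obtain ⟨y, hy, hyT⟩ := isInducedByLipschitz_of_isometry h2 hQ T hTQ
    obtain ⟨c, hc⟩ := exists_eq_algebraMap_of_twisted hQ
      (x := (y : CliffordAlgebra Q) * (g : CliffordAlgebra Q)) fun v => by
        rw [← mul_assoc, ← hyT, mul_assoc, hT', map_mul, involute_eq_of_mem_even hev, mul_assoc]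
    have hc0 : c ≠ 0 := by
      rintro rfl
      rw [map_zero, ← Units.val_mul] at hc
      exact (y * g).ne_zero hc
    -- a non-zero scalar is the product of two anisotropic vectors
    have hscalar : y * g ∈ lipschitzGroup Q := by
      obtain ⟨a, ha⟩ : ∃ a, Q a ≠ 0 := by
        by_contra! h0
        obtain ⟨v, hv⟩ := exists_ne (0 : V)
        exact hv (hQ.1 v fun w => by
          rw [QuadraticMap.polarBilin_apply_apply, QuadraticMap.polar, h0, h0, h0, sub_zero,
            sub_zero])
      have ha' : Q ((c * (Q a)⁻¹) • a) ≠ 0 := by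
        rw [QuadraticMap.map_smul, smul_eq_mul]
        exact mul_ne_zero (mul_self_ne_zero.2 (mul_ne_zero hc0 (inv_ne_zero ha))) ha
      obtain ⟨z, hz, hza⟩ := exists_lipschitz_unit ha
      obtain ⟨z', hz', hza'⟩ := exists_lipschitz_unit ha'
      have : y * g = z * z' := by
        refine Units.ext ?_
        rw [Units.val_mul, hc, Units.val_mul, hza, hza', map_smul, mul_smul_comm, ι_sq_scalar,
          Algebra.smul_def, ← map_mul, mul_assoc, inv_mul_cancel₀ ha, mul_one]
      rw [this]
      exact Subgroup.mul_mem _ hz hz'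
    have h3 := Subgroup.mul_mem _ (Subgroup.inv_mem _ hy) hscalar
    rwa [inv_mul_cancel_left] at h3

end Clifford

/-! ### The spin group -/

section SpinGroup

open CliffordAlgebra

variable {k V : Type*} [Field k] [AddCommGroup V] [Module k V] {Q : QuadraticForm k V}

attribute [local instance 100] LieRing.ofAssociativeRing

/-- The conjugation of the Clifford algebra as a linear map. -/
def starLinear (Q : QuadraticForm k V) : CliffordAlgebra Q →ₗ[k] CliffordAlgebra Q where
  toFun := star
  map_add' := star_add
  map_smul' := CliffordAlgebra.star_smul

@[simp]
theorem starLinear_apply (x : CliffordAlgebra Q) : starLinear Q x = star x := rfl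

/-- The matrix coefficients of the action `a ↦ a * c * star a` are polynomial functions. -/
theorem exists_polyFun_star [FiniteDimensional k V] (φ : Module.Dual k (CliffordAlgebra Q))
    (c : CliffordAlgebra Q) : ∃ f : PolyFun k (CliffordAlgebra Q),
      (∀ a, PolyFun.evalAt a f = φ (a * c * star a)) ∧
      ∀ x, PolyFun.evalDual 1 x f =
        TrivSqZeroExt.inl (φ c) + TrivSqZeroExt.inr (φ (c * star x + x * c)) := by
  obtain ⟨f, hf, hf'⟩ := exists_polyFun_bilin
    (((LinearMap.mul k (CliffordAlgebra Q)).compl₁₂ (LinearMap.mulRight k c)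
      (starLinear Q)).compr₂ φ)
  refine ⟨f, fun a => ?_, fun x => ?_⟩
  · rw [hf]
    simp
  · rw [hf']
    simp

section

variable [FiniteDimensional k V] [Nontrivial V]

theorem isClosed_Spin (h2 : (2 : k) ≠ 0) (hQ : LinearMap.Nondegenerate Q.polarBilin) :
    @IsClosed (CliffordAlgebra Q)ˣ (zariski k (CliffordAlgebra Q))
      (Spin Q : Set (CliffordAlgebra Q)ˣ) := by
  choose f hf _ using fun p : Module.Dual k (CliffordAlgebra Q) × CliffordAlgebra Q =>
    exists_polyFun_star p.1 p.2
  convert isClosed_vanishing_set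
    ({F | ∃ φ : Module.Dual k (CliffordAlgebra Q), evenOdd Q 0 ≤ LinearMap.ker φ ∧
        F = MvPolynomial.X φ} ∪
      {F | ∃ φ : Module.Dual k (CliffordAlgebra Q),
        F = f (φ, 1) - algebraMap k (PolyFun k (CliffordAlgebra Q)) (φ 1)} ∪
      {F | ∃ φ : Module.Dual k (CliffordAlgebra Q), LinearMap.range (ι Q) ≤ LinearMap.ker φ ∧
        ∃ v, F = f (φ, ι Q v)}) using 1
  ext g
  rw [SetLike.mem_coe, mem_Spin_iff h2 hQ, Set.mem_ofPred_eq]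
  constructor
  · rintro ⟨h1, h3, h4⟩ F ((⟨φ, hφ, rfl⟩ | ⟨φ, rfl⟩) | ⟨φ, hφ, v, rfl⟩)
    · rw [PolyFun.evalAt_X]
      exact hφ h1
    · rw [map_sub, hf, AlgHom.commutes, mul_one, h3]
      exact sub_self _
    · rw [hf]
      exact hφ (h4 v)
  · intro h
    refine ⟨?_, ?_, fun v => ?_⟩
    · by_contra hn
      obtain ⟨φ, hφ, hle⟩ := Submodule.exists_le_ker_of_notMem hn
      have h1 := h _ (Or.inl (Or.inl ⟨φ, hle, rfl⟩))
      rw [PolyFun.evalAt_X] at h1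
      exact hφ h1
    · rw [← sub_eq_zero, ← Module.forall_dual_apply_eq_zero_iff k]
      intro φ
      have h1 := h _ (Or.inl (Or.inr ⟨φ, rfl⟩))
      rw [map_sub, hf, AlgHom.commutes, mul_one] at h1
      rw [map_sub]
      exact h1
    · by_contra hn
      obtain ⟨φ, hφ, hle⟩ := Submodule.exists_le_ker_of_notMem hn
      have h1 := h _ (Or.inr ⟨φ, hle, v, rfl⟩)
      rw [hf] at h1
      exact hφ h1

/-- Elements of the Lie algebra of the spin group are even, skew, and normalize the space of
vectors. -/
theorem mem_of_mem_lieAlg_Spin (h2 : (2 : k) ≠ 0) (hQ : LinearMap.Nondegenerate Q.polarBilin)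
    {x : CliffordAlgebra Q} (hx : x ∈ lieAlg k (Spin Q)) :
    x ∈ evenOdd Q 0 ∧ star x = -x ∧ ∀ v, x * ι Q v - ι Q v * x ∈ LinearMap.range (ι Q) := by
  have hstar : star x = -x := by
    rw [eq_neg_iff_add_eq_zero, ← Module.forall_dual_apply_eq_zero_iff k]
    intro φ
    obtain ⟨f, hf, hf'⟩ := exists_polyFun_star φ (1 : CliffordAlgebra Q)
    have h := hx (f - algebraMap k (PolyFun k (CliffordAlgebra Q)) (φ 1)) fun g hg => by
      rw [map_sub, hf, AlgHom.commutes, mul_one, ((mem_Spin_iff h2 hQ).1 hg).2.1]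
      exact sub_self _
    rw [map_sub, hf', AlgHom.commutes, TrivSqZeroExt.algebraMap_eq_inl] at h
    simpa using congrArg TrivSqZeroExt.snd h
  refine ⟨?_, hstar, fun v => ?_⟩
  · by_contra hn
    obtain ⟨φ, hφ, hle⟩ := Submodule.exists_le_ker_of_notMem hn
    have h := hx (MvPolynomial.X φ) fun g hg => by
      rw [PolyFun.evalAt_X]
      exact hle ((mem_Spin_iff h2 hQ).1 hg).1
    rw [PolyFun.evalDual_X] at h
    exact hφ (by simpa using congrArg TrivSqZeroExt.snd h)
  · by_contra hn
    obtain ⟨φ, hφ, hle⟩ := Submodule.exists_le_ker_of_notMem hn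
    obtain ⟨f, hf, hf'⟩ := exists_polyFun_star φ (ι Q v)
    have h := hx f fun g hg => by
      rw [hf]
      exact hle (((mem_Spin_iff h2 hQ).1 hg).2.2 v)
    rw [hf'] at h
    refine hφ ?_
    have h1 := congrArg TrivSqZeroExt.snd h
    simp only [TrivSqZeroExt.snd_add, TrivSqZeroExt.snd_inl, TrivSqZeroExt.snd_inr, zero_add,
      TrivSqZeroExt.snd_zero, hstar] at h1
    rw [← h1]
    congr 1
    noncomm_ring

end

/-- The map `v w ↦ v * w` from pairs of vectors to the Clifford algebra. -/
def vecMul (Q : QuadraticForm k V) : V →ₗ[k] V →ₗ[k] CliffordAlgebra Q :=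
  (LinearMap.mul k (CliffordAlgebra Q)).compl₁₂ (ι Q) (ι Q)

@[simp]
theorem vecMul_apply (v w : V) : vecMul Q v w = ι Q v * ι Q w := rfl

theorem ι_mul_ι_mul_ι_sub (v w u : V) :
    ι Q v * ι Q w * ι Q u - ι Q u * (ι Q v * ι Q w) =
      ι Q (QuadraticMap.polar Q w u • v - QuadraticMap.polar Q v u • w) := by
  have h1 : QuadraticMap.polar Q w u • ι Q v = ι Q v * (ι Q w * ι Q u + ι Q u * ι Q w) := by
    rw [ι_mul_ι_add_swap, ← Algebra.commutes, Algebra.smul_def]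
  have h3 : QuadraticMap.polar Q v u • ι Q w = (ι Q v * ι Q u + ι Q u * ι Q v) * ι Q w := by
    rw [ι_mul_ι_add_swap, Algebra.smul_def]
  rw [map_sub, map_smul, map_smul, h1, h3]
  noncomm_ring

theorem ι_mul_self_eq_zero {v : V} (hv : Q v = 0) : ι Q v * ι Q v = 0 := by
  rw [ι_sq_scalar, hv, map_zero]

theorem star_ι_mul_ι (v w : V) : star (ι Q v * ι Q w) = ι Q w * ι Q v := by
  rw [star_mul, star_ι, star_ι, neg_mul_neg]

/-- An even element that commutes with all vectors is a scalar. -/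
theorem exists_eq_algebraMap_of_even_of_commute [FiniteDimensional k V]
    (hQ : LinearMap.Nondegenerate Q.polarBilin) {x : CliffordAlgebra Q} (hx : x ∈ evenOdd Q 0)
    (h : ∀ v, x * ι Q v = ι Q v * x) : ∃ c : k, x = algebraMap k (CliffordAlgebra Q) c :=
  exists_eq_algebraMap_of_twisted hQ fun v => by rw [involute_eq_of_mem_even hx, h]

theorem star_mul_self_of_mem_Spin {g : (CliffordAlgebra Q)ˣ} (hg : g ∈ Spin Q) :
    star (g : CliffordAlgebra Q) * (g : CliffordAlgebra Q) = 1 :=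
  spinGroup.star_mul_self_of_mem (mem_Spin_iff_mem_spinGroup.1 hg)

theorem mul_star_self_of_mem_Spin {g : (CliffordAlgebra Q)ˣ} (hg : g ∈ Spin Q) :
    (g : CliffordAlgebra Q) * star (g : CliffordAlgebra Q) = 1 :=
  spinGroup.mul_star_self_of_mem (mem_Spin_iff_mem_spinGroup.1 hg)

theorem exists_leftInverse_ι (h2 : (2 : k) ≠ 0) (hQ : LinearMap.Nondegenerate Q.polarBilin) :
    Function.Injective (ι Q) ∧ ∃ p : CliffordAlgebra Q →ₗ[k] V, ∀ v, p (ι Q v) = v := by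
  have : Invertible (2 : k) := invertibleOfNonzero h2
  have hinj := ι_injective_of_nondegenerate hQ
  obtain ⟨p, hp⟩ := (ι Q).exists_leftInverse_of_injective (LinearMap.ker_eq_bot.2 hinj)
  exact ⟨hinj, p, LinearMap.congr_fun hp⟩

section

variable [FiniteDimensional k V] [Nontrivial V]

/-- The vector representation of the spin group. -/
theorem exists_spinRep (h2 : (2 : k) ≠ 0) (hQ : LinearMap.Nondegenerate Q.polarBilin) :
    ∃ ρ : Spin Q →* Module.End k V, ∀ g v, ι Q (ρ g v) =
      ((g : (CliffordAlgebra Q)ˣ) : CliffordAlgebra Q) * ι Q v *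
        star ((g : (CliffordAlgebra Q)ˣ) : CliffordAlgebra Q) := by
  obtain ⟨hinj, p, hp⟩ := exists_leftInverse_ι h2 hQ
  let T : Spin Q → Module.End k V := fun g => p ∘ₗ
    LinearMap.mulRight k (star ((g : (CliffordAlgebra Q)ˣ) : CliffordAlgebra Q)) ∘ₗ
    LinearMap.mulLeft k ((g : (CliffordAlgebra Q)ˣ) : CliffordAlgebra Q) ∘ₗ ι Q
  have hT : ∀ g v, ι Q (T g v) = ((g : (CliffordAlgebra Q)ˣ) : CliffordAlgebra Q) * ι Q v *
      star ((g : (CliffordAlgebra Q)ˣ) : CliffordAlgebra Q) := by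
    intro g v
    obtain ⟨w, hw⟩ := ((mem_Spin_iff h2 hQ).1 g.2).2.2 v
    have h : T g v = w := by
      change p (_ * _ * _) = w
      rw [← hw, hp]
    rw [h, hw]
  refine ⟨{ toFun := T, map_one' := ?_, map_mul' := fun g h => ?_ }, hT⟩
  · ext v
    refine hinj ?_
    rw [hT]
    simp
  · ext v
    refine hinj ?_
    rw [Module.End.mul_apply, hT, hT, hT]
    simp only [Subgroup.coe_mul, Units.val_mul, star_mul, mul_assoc]

/-- The differential of the vector representation of the spin group. -/
theorem exists_spinRep_differential (h2 : (2 : k) ≠ 0)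
    (hQ : LinearMap.Nondegenerate Q.polarBilin) :
    ∃ σ : lieAlg k (Spin Q) →ₗ⁅k⁆ Module.End k V, ∀ x v, ι Q (σ x v) =
      (x : CliffordAlgebra Q) * ι Q v - ι Q v * (x : CliffordAlgebra Q) := by
  obtain ⟨hinj, p, hp⟩ := exists_leftInverse_ι h2 hQ
  let T : CliffordAlgebra Q →ₗ[k] Module.End k V := LinearMap.mk₂ k
    (fun x v => p (x * ι Q v - ι Q v * x))
    (fun x y v => by rw [← map_add]; congr 1; noncomm_ring)
    (fun c x v => by rw [← map_smul, smul_mul_assoc, mul_smul_comm, smul_sub])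
    (fun x v w => by rw [← map_add, map_add]; congr 1; noncomm_ring)
    (fun c x v => by rw [← map_smul p, map_smul, smul_mul_assoc, mul_smul_comm, smul_sub])
  have hT : ∀ x ∈ lieAlg k (Spin Q), ∀ v, ι Q (T x v) = x * ι Q v - ι Q v * x := by
    intro x hx v
    obtain ⟨w, hw⟩ := (mem_of_mem_lieAlg_Spin h2 hQ hx).2.2 v
    have h : T x v = w := by
      change p (_ * _ - _ * _) = w
      rw [← hw, hp]
    rw [h, hw]
  refine ⟨{ T ∘ₗ (lieAlg k (Spin Q)).toSubmodule.subtype with map_lie' := fun {x y} => ?_ },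
    fun x v => hT x x.2 v⟩
  ext v
  refine hinj ?_
  change ι Q (T ⁅(x : CliffordAlgebra Q), (y : CliffordAlgebra Q)⁆ v) =
    ι Q (T x (T y v) - T y (T x v))
  rw [map_sub, hT _ ((lieAlg k (Spin Q)).lie_mem x.2 y.2), hT x x.2, hT y y.2, hT y y.2, hT x x.2,
    LieRing.of_associative_ring_bracket]
  noncomm_ring

end

/-- The multiplication table of the idempotents `a * b` and `b * a` attached to a hyperbolic pair.
-/
theorem mul_of_hyperbolic {A : Type*} [Ring A] {a b : A} (ha : a * a = 0) (hb : b * b = 0)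
    (hab : a * b + b * a = 1) : a * b * a = a ∧ b * a * b = b ∧ a * b * (a * b) = a * b ∧
      a * b * (b * a) = 0 ∧ b * a * (a * b) = 0 ∧ b * a * (b * a) = b * a := by
  have h1 : a * b * a = a := by
    rw [eq_sub_of_add_eq hab, sub_mul, one_mul, mul_assoc, ha, mul_zero, sub_zero]
  have h2 : b * a * b = b := by
    rw [eq_sub_of_add_eq' hab, sub_mul, one_mul, mul_assoc, hb, mul_zero, sub_zero]
  refine ⟨h1, h2, ?_, ?_, ?_, ?_⟩
  · rw [← mul_assoc, h1]
  · rw [mul_assoc, ← mul_assoc b, hb, zero_mul, mul_zero]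
  · rw [mul_assoc, ← mul_assoc a, ha, zero_mul, mul_zero]
  · rw [← mul_assoc, h2]

/-- The unit `t * (a * b) + t⁻¹ * (b * a)`, for a hyperbolic pair `a`, `b`. -/
def torusUnit {A : Type*} [Ring A] [Algebra k A] {a b : A} (ha : a * a = 0) (hb : b * b = 0)
    (hab : a * b + b * a = 1) (t : kˣ) : Aˣ :=
  have h : ∀ s t : k, s * t = 1 →
      (s • (a * b) + t • (b * a)) * (t • (a * b) + s • (b * a)) = 1 := fun s t hst => by
    obtain ⟨-, -, h3, h4, h5, h6⟩ := mul_of_hyperbolic ha hb hab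
    simp only [add_mul, mul_add, smul_mul_smul_comm, h3, h4, h5, h6, smul_zero, zero_add, add_zero]
    rw [hst, mul_comm t s, hst, one_smul, one_smul, hab]
  { val := (t : k) • (a * b) + ((t⁻¹ : kˣ) : k) • (b * a)
    inv := ((t⁻¹ : kˣ) : k) • (a * b) + (t : k) • (b * a)
    val_inv := h _ _ t.mul_inv
    inv_val := h _ _ t.inv_mul }

theorem torus_conj {A : Type*} [Ring A] [Algebra k A] {a b u : A} (ha : a * a = 0) (hb : b * b = 0)
    (hab : a * b + b * a = 1) {s t α β : k} (hst : t * s = 1)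
    (h1 : a * b * u - u * (a * b) = α • a - β • b)
    (h2 : b * a * u - u * (b * a) = β • b - α • a) :
    (t • (a * b) + s • (b * a)) * u * (s • (a * b) + t • (b * a)) =
      u + ((t ^ 2 - 1) * α) • a + ((s ^ 2 - 1) * β) • b := by
  obtain ⟨h3, h4, h5, h6, h7, h8⟩ := mul_of_hyperbolic ha hb hab
  have e1 : (t • (a * b) + s • (b * a)) * u =
      u * (t • (a * b) + s • (b * a)) + (t - s) • (α • a - β • b) := by
    simp only [add_mul, mul_add, smul_mul_assoc, mul_smul_comm, sub_eq_iff_eq_add.1 h1,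
      sub_eq_iff_eq_add.1 h2]
    module
  have e2 : (t • (a * b) + s • (b * a)) * (s • (a * b) + t • (b * a)) = 1 := by
    simp only [add_mul, mul_add, smul_mul_smul_comm, h5, h6, h7, h8, smul_zero, zero_add, add_zero]
    rw [hst, mul_comm s t, hst, one_smul, one_smul, hab]
  have e3 : a * (s • (a * b) + t • (b * a)) = t • a := by
    rw [mul_add, mul_smul_comm, mul_smul_comm, ← mul_assoc, ha, zero_mul, smul_zero, zero_add,
      ← mul_assoc, h3]
  have e4 : b * (s • (a * b) + t • (b * a)) = s • b := by
    rw [mul_add, mul_smul_comm, mul_smul_comm, ← mul_assoc, h4, ← mul_assoc, hb, zero_mul,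
      smul_zero, add_zero]
  rw [e1, add_mul, mul_assoc, e2, mul_one, smul_mul_assoc, sub_mul, smul_mul_assoc,
    smul_mul_assoc, e3, e4]
  match_scalars
  · ring
  · linear_combination -α * hst
  · linear_combination -β * hst

theorem star_torusUnit {v w : V} (ha : ι Q v * ι Q v = 0) (hb : ι Q w * ι Q w = 0)
    (hab : ι Q v * ι Q w + ι Q w * ι Q v = 1) (t : kˣ) :
    star (torusUnit ha hb hab t : CliffordAlgebra Q) =
      ((t⁻¹ : kˣ) : k) • (ι Q v * ι Q w) + (t : k) • (ι Q w * ι Q v) := by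
  change star ((t : k) • (ι Q v * ι Q w) + ((t⁻¹ : kˣ) : k) • (ι Q w * ι Q v)) = _
  rw [star_add, CliffordAlgebra.star_smul, CliffordAlgebra.star_smul, star_ι_mul_ι, star_ι_mul_ι,
    add_comm]

/-- The action of the unipotent element `1 + t * v * w` on vectors. -/
theorem unipotent_conj {v w : V} (ha : ι Q v * ι Q v = 0)
    (hba : ι Q w * ι Q v = -(ι Q v * ι Q w)) (hN : ι Q v * ι Q w * (ι Q v * ι Q w) = 0) (t : k)
    (u : V) : (1 + t • (ι Q v * ι Q w)) * ι Q u * (1 - t • (ι Q v * ι Q w)) =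
      ι Q (u + t • (QuadraticMap.polar Q w u • v - QuadraticMap.polar Q v u • w) -
        (t ^ 2 * Q w * QuadraticMap.polar Q v u) • v) := by
  have h1 := ι_mul_ι_mul_ι_sub (Q := Q) v w u
  have h2 : ι Q (QuadraticMap.polar Q w u • v - QuadraticMap.polar Q v u • w) *
      (ι Q v * ι Q w) = (Q w * QuadraticMap.polar Q v u) • ι Q v := by
    rw [map_sub, map_smul, map_smul, sub_mul, smul_mul_assoc, smul_mul_assoc, ← mul_assoc, ha,
      zero_mul, smul_zero, ← mul_assoc, hba, neg_mul, mul_assoc, ι_sq_scalar, ← Algebra.commutes,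
      ← Algebra.smul_def, smul_neg, smul_smul, zero_sub, neg_neg, mul_comm]
  have e : (1 + t • (ι Q v * ι Q w)) * ι Q u * (1 - t • (ι Q v * ι Q w)) =
      ι Q u + t • (ι Q v * ι Q w * ι Q u - ι Q u * (ι Q v * ι Q w)) -
        t ^ 2 • ((ι Q v * ι Q w * ι Q u - ι Q u * (ι Q v * ι Q w)) * (ι Q v * ι Q w) +
          ι Q u * (ι Q v * ι Q w * (ι Q v * ι Q w))) := by
    simp only [add_mul, mul_sub, sub_mul, one_mul, mul_one, smul_mul_assoc, mul_smul_comm,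
      mul_assoc]
    module
  rw [e, h1, hN, mul_zero, add_zero, h2]
  simp only [map_sub, map_add, map_smul, smul_smul, mul_assoc]

theorem isFormGroup_Spin [IsAlgClosed k] [FiniteDimensional k V] (h2 : (2 : k) ≠ 0)
    (hV : 3 ≤ Module.finrank k V) (hQ : LinearMap.Nondegenerate Q.polarBilin)
    {ρ : Spin Q →* Module.End k V} (hρ : ∀ g v, ι Q (ρ g v) =
      ((g : (CliffordAlgebra Q)ˣ) : CliffordAlgebra Q) * ι Q v *
        star ((g : (CliffordAlgebra Q)ˣ) : CliffordAlgebra Q))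
    {σ : lieAlg k (Spin Q) →ₗ⁅k⁆ Module.End k V} (hσ : ∀ x v, ι Q (σ x v) =
      (x : CliffordAlgebra Q) * ι Q v - ι Q v * (x : CliffordAlgebra Q)) :
    IsFormGroup (Spin Q) Q.polarBilin 1 Q ρ σ (vecMul Q) := by
  have hVn : Nontrivial V := Module.finrank_pos_iff.1 (by omega : 0 < Module.finrank k V)
  have : Invertible (2 : k) := invertibleOfNonzero h2
  obtain ⟨hinj, p, hp⟩ := exists_leftInverse_ι h2 hQ
  have hself : ∀ v, QuadraticMap.polar Q v v = 2 * Q v := fun v => by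
    rw [QuadraticMap.polar_self, nsmul_eq_mul, Nat.cast_ofNat]
  have hq : ∀ {v}, QuadraticMap.polar Q v v = 0 → Q v = 0 := fun {v} h => by
    rw [hself] at h
    exact (mul_eq_zero.1 h).resolve_left h2
  have hQρ : ∀ g v, Q (ρ g v) = Q v := by
    intro g v
    refine (algebraMap k (CliffordAlgebra Q)).injective ?_
    rw [← ι_sq_scalar, hρ, mul_assoc, ← mul_assoc (star _), ← mul_assoc (star _),
      star_mul_self_of_mem_Spin g.2, one_mul, mul_assoc, ← mul_assoc (ι Q v), ι_sq_scalar,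
      Algebra.commutes, ← mul_assoc, mul_star_self_of_mem_Spin g.2, one_mul]
  exact {
    two_ne_zero := h2
    isClosed := isClosed_Spin h2 hQ
    isDifferential := fun v φ => by
      obtain ⟨f, hf, hf'⟩ := exists_polyFun_star (φ ∘ₗ p) (ι Q v)
      refine ⟨f, fun g => ?_, fun x => ?_⟩
      · rw [hf, ← hρ, LinearMap.comp_apply, hp]
      · rw [hf', (mem_of_mem_lieAlg_Spin h2 hQ x.2).2.1]
        have e : ι Q v * -(x : CliffordAlgebra Q) + x * ι Q v = ι Q (σ x v) := by
          rw [hσ]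
          noncomm_ring
        rw [e, LinearMap.comp_apply, LinearMap.comp_apply, hp, hp]
    injective := by
      rw [injective_iff_map_eq_zero]
      intro x hx
      have hx' := mem_of_mem_lieAlg_Spin h2 hQ x.2
      obtain ⟨c, hc⟩ := exists_eq_algebraMap_of_even_of_commute hQ hx'.1 fun v => by
        rw [← sub_eq_zero, ← hσ, hx, LinearMap.zero_apply, map_zero]
      have h1 := hx'.2.1
      rw [hc, star_algebraMap, eq_neg_iff_add_eq_zero, ← map_add, map_eq_zero, ← two_mul] at h1
      refine Subtype.ext ?_
      rw [hc, (mul_eq_zero.1 h1).resolve_left h2, map_zero]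
      rfl
    isometry := fun g u v => by
      rw [QuadraticMap.polarBilin_apply_apply, QuadraticMap.polarBilin_apply_apply,
        QuadraticMap.polar, QuadraticMap.polar, ← map_add, hQρ, hQρ, hQρ]
    skew := fun x u v => by
      refine (algebraMap k (CliffordAlgebra Q)).injective ?_
      rw [map_add, map_zero, QuadraticMap.polarBilin_apply_apply,
        QuadraticMap.polarBilin_apply_apply, ← ι_mul_ι_add_swap, ← ι_mul_ι_add_swap, hσ, hσ]
      have h1 := Algebra.commutes (QuadraticMap.polar Q u v) (x : CliffordAlgebra Q)
      rw [← ι_mul_ι_add_swap, ← sub_eq_zero] at h1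
      rw [← neg_eq_zero, ← h1]
      noncomm_ring
    nondegenerate := hQ
    symm := fun u v => by
      rw [one_mul]
      exact QuadraticMap.polar_comm Q u v
    apply_self := hself
    sign := Or.inl ⟨rfl, hV⟩
    comm_of_ker := fun g h hg _ => by
      have hg' := (mem_Spin_iff h2 hQ).1 g.2
      obtain ⟨c, hc⟩ := exists_eq_algebraMap_of_even_of_commute hQ hg'.1 fun v => by
        have h1 := hρ g v
        rw [hg, Module.End.one_apply] at h1
        conv_rhs => rw [h1, mul_assoc, star_mul_self_of_mem_Spin g.2, mul_one]
      refine Subtype.ext (Units.ext ?_)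
      rw [Subgroup.coe_mul, Subgroup.coe_mul, Units.val_mul, Units.val_mul, hc, Algebra.commutes]
    unipotent := fun v w hvv hvw t => by
      have ha := ι_mul_self_eq_zero (hq hvv)
      have hba : ι Q w * ι Q v = -(ι Q v * ι Q w) := by
        have h1 := ι_mul_ι_add_swap (Q := Q) v w
        rw [show QuadraticMap.polar Q v w = 0 from hvw, map_zero] at h1
        exact eq_neg_of_add_eq_zero_right h1
      have hN : ι Q v * ι Q w * (ι Q v * ι Q w) = 0 := by
        rw [mul_assoc, ← mul_assoc (ι Q w), hba, neg_mul, mul_neg, mul_assoc, ← mul_assoc, ha,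
          zero_mul, neg_zero]
      have hconj := unipotent_conj (Q := Q) ha hba hN t
      have hstar : star (1 + t • (ι Q v * ι Q w)) = 1 - t • (ι Q v * ι Q w) := by
        rw [star_add, star_one, CliffordAlgebra.star_smul, star_ι_mul_ι, hba, smul_neg,
          sub_eq_add_neg]
      refine ⟨⟨oneAddUnit _ hN t, (mem_Spin_iff h2 hQ).2 ⟨?_, ?_, fun u => ?_⟩⟩, rfl, fun u => ?_⟩
      · exact (even Q).add_mem (even Q).one_mem
          ((even Q).smul_mem (ι_mul_ι_mem_evenOdd_zero Q v w) t)
      · change (1 + t • (ι Q v * ι Q w)) * star (1 + t • (ι Q v * ι Q w)) = 1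
        rw [hstar]
        exact (oneAddUnit _ hN t).mul_inv
      · change (1 + t • (ι Q v * ι Q w)) * ι Q u * star (1 + t • (ι Q v * ι Q w)) ∈ _
        rw [hstar, hconj]
        exact ⟨_, rfl⟩
      · refine hinj ?_
        rw [hρ]
        change (1 + t • (ι Q v * ι Q w)) * ι Q u * star (1 + t • (ι Q v * ι Q w)) = _
        rw [hstar, hconj, one_mul]
        rfl
    torus := fun v w hvv hww hvw P hP => by
      have ha := ι_mul_self_eq_zero (hq hvv)
      have hb := ι_mul_self_eq_zero (hq hww)
      have hab : ι Q v * ι Q w + ι Q w * ι Q v = 1 := by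
        rw [ι_mul_ι_add_swap, show QuadraticMap.polar Q v w = 1 from hvw, map_one]
      have hconj : ∀ (t : kˣ) u, (torusUnit ha hb hab t : CliffordAlgebra Q) * ι Q u *
          star (torusUnit ha hb hab t : CliffordAlgebra Q) =
            ι Q (u + (((t : k) ^ 2 - 1) * QuadraticMap.polar Q w u) • v +
              ((((t⁻¹ : kˣ) : k) ^ 2 - 1) * QuadraticMap.polar Q v u) • w) := by
        intro t u
        have h1 := ι_mul_ι_mul_ι_sub (Q := Q) v w u
        have h3 := ι_mul_ι_mul_ι_sub (Q := Q) w v u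
        rw [map_sub, map_smul, map_smul] at h1 h3
        rw [star_torusUnit, map_add, map_add, map_smul, map_smul]
        exact torus_conj ha hb hab t.mul_inv h1 h3
      have hmem : ∀ t : kˣ, torusUnit ha hb hab t ∈ Spin Q := by
        refine fun t => (mem_Spin_iff h2 hQ).2 ⟨?_, ?_, fun u => ⟨_, (hconj t u).symm⟩⟩
        · exact (even Q).add_mem ((even Q).smul_mem (ι_mul_ι_mem_evenOdd_zero Q v w) _)
            ((even Q).smul_mem (ι_mul_ι_mem_evenOdd_zero Q w v) _)
        · rw [star_torusUnit]
          exact (torusUnit ha hb hab t).mul_inv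
      have h := mem_lieAlg_of_curve P (ι Q v * ι Q w) (ι Q w * ι Q v) 0 1 (-1) 0
        (by rw [add_zero, hab]) fun t => ⟨torusUnit ha hb hab t, hP ⟨_, hmem t⟩
          ⟨(t : k) ^ 2 - 1, ((t⁻¹ : kˣ) : k) ^ 2 - 1, fun u => hinj (by rw [hρ, hconj]; rfl)⟩, by
          rw [zpow_one, zpow_neg_one, smul_zero, add_zero]
          rfl⟩
      refine ⟨2⁻¹, ?_⟩
      have e : vecMul Q v w - (2 : k)⁻¹ • 1 = (2 : k)⁻¹ • (((1 : ℤ) : k) • (ι Q v * ι Q w) +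
          ((-1 : ℤ) : k) • (ι Q w * ι Q v) + ((0 : ℤ) : k) • 0) := by
        rw [vecMul_apply, ← hab]
        match_scalars
        · field_simp
          ring
        · field_simp
      rw [e]
      exact (lieAlg k P).smul_mem _ h
    differential_apply := fun v w h u => hinj (by
      rw [hσ, one_mul]
      exact ι_mul_ι_mul_ι_sub v w u)
    swap := fun v w => ⟨QuadraticMap.polar Q v w, by
      rw [one_smul, vecMul_apply, vecMul_apply, ι_mul_ι_add_swap, Algebra.algebraMap_eq_smul_one]⟩
    expand := fun x ι' _ v w hx => by
      obtain ⟨c, hc⟩ := exists_eq_algebraMap_of_even_of_commute hQ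
        (x := (2 : k) • (x : CliffordAlgebra Q) - ∑ i, vecMul Q (v i) (w i))
        ((even Q).sub_mem ((even Q).smul_mem (mem_of_mem_lieAlg_Spin h2 hQ x.2).1 2)
          ((even Q).sum_mem fun i _ => ι_mul_ι_mem_evenOdd_zero Q (v i) (w i))) fun u => by
          have h1 := congrArg (ι Q) (hx u)
          rw [map_smul, hσ, map_sum] at h1
          have h3 : ∀ i, ι Q (Q.polarBilin (w i) u • v i - (1 * Q.polarBilin (v i) u) • w i) =
              vecMul Q (v i) (w i) * ι Q u - ι Q u * vecMul Q (v i) (w i) := fun i => by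
            rw [one_mul]
            exact (ι_mul_ι_mul_ι_sub (v i) (w i) u).symm
          simp only [h3] at h1
          rw [Finset.sum_sub_distrib, ← Finset.sum_mul, ← Finset.mul_sum, smul_sub] at h1
          rw [sub_mul, mul_sub, smul_mul_assoc, mul_smul_comm, sub_eq_sub_iff_sub_eq_sub, h1]
      exact ⟨c, by rw [eq_add_of_sub_eq' hc, Algebra.algebraMap_eq_smul_one]⟩
    eq_zero_of_smul_one_mem := fun c hc => by
      have h1 := (mem_of_mem_lieAlg_Spin h2 hQ hc).2.1
      rw [← Algebra.algebraMap_eq_smul_one, star_algebraMap, eq_neg_iff_add_eq_zero, ← map_add,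
        map_eq_zero, ← two_mul] at h1
      exact (mul_eq_zero.1 h1).resolve_left h2 }

theorem isParabolicSubalgebra_Spin [IsAlgClosed k] [FiniteDimensional k V] (h2 : (2 : k) ≠ 0)
    (hV : 3 ≤ Module.finrank k V) (hQ : Q.Nondegenerate) (h : LieSubalgebra k (lieAlg k (Spin Q)))
    (hh : IsMaximalNonSemisimple h) : IsParabolicSubalgebra h := by
  have : Invertible (2 : k) := invertibleOfNonzero h2
  have hVn : Nontrivial V := Module.finrank_pos_iff.1 (by omega : 0 < Module.finrank k V)
  have hQ' := QuadraticMap.nondegenerate_polar_iff.2 hQ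
  obtain ⟨ρ, hρ⟩ := exists_spinRep h2 hQ'
  obtain ⟨σ, hσ⟩ := exists_spinRep_differential h2 hQ'
  exact (isFormGroup_Spin h2 hV hQ' hρ hσ).isParabolicSubalgebra h hh

end SpinGroup

end ClassicalLie

theorem theoremC {k V : Type*} [Field k] [IsAlgClosed k] [AddCommGroup V] [Module k V]
    [FiniteDimensional k V] (p : ℕ) [CharP k p] (hp : p.Prime) (hp2 : 2 < p) :
    -- type A: `SL(V)` with `dim V ≥ 2`; the very good primes are those not dividing `dim V`
    (2 ≤ Module.finrank k V → ¬ p ∣ Module.finrank k V →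
      ∀ h : LieSubalgebra k (ClassicalLie.lieAlg k (ClassicalLie.SL k V)),
        ClassicalLie.IsMaximalNonSemisimple h → ClassicalLie.IsParabolicSubalgebra h) ∧
    -- type C: `Sp(V)`; every prime `p > 2` is very good
    (0 < Module.finrank k V → ∀ ω : LinearMap.BilinForm k V, ω.IsAlt → ω.Nondegenerate →
      ∀ h : LieSubalgebra k (ClassicalLie.lieAlg k (ClassicalLie.Sp ω)),
        ClassicalLie.IsMaximalNonSemisimple h → ClassicalLie.IsParabolicSubalgebra h) ∧
    -- types B and D: `Spin(V)` with `dim V ≥ 3`; every prime `p > 2` is very good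
    (3 ≤ Module.finrank k V → ∀ Q : QuadraticForm k V, Q.Nondegenerate →
      ∀ h : LieSubalgebra k (ClassicalLie.lieAlg k (ClassicalLie.Spin Q)),
        ClassicalLie.IsMaximalNonSemisimple h → ClassicalLie.IsParabolicSubalgebra h) := by
  have h2 : (2 : k) ≠ 0 := fun h0 => by
    have h1 := (CharP.cast_eq_zero_iff k p 2).1 (by exact_mod_cast h0)
    exact absurd (Nat.le_of_dvd two_pos h1) (by omega)
  refine ⟨fun _ hn h hh => ?_, fun hV ω hω hnd h hh => ?_, fun hV Q hQ h hh => ?_⟩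
  · exact ClassicalLie.isParabolicSubalgebra_SL (mt (CharP.cast_eq_zero_iff k p _).1 hn) h hh
  · exact (ClassicalLie.isFormGroup_Sp h2 hV hω hnd).isParabolicSubalgebra h hh
  · exact ClassicalLie.isParabolicSubalgebra_Spin h2 hV hQ h hh
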